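/- Let $\phi$ be a parabolic automorphism of the unit disk $\mathbb D$, i.e. a holomorphic bijection of $\mathbb D$ onto itself with exactly one boundary fixed point (exactly one $\zeta$ with $|\zeta|=1$ such that $\phi(z)\to\zeta$ as $z\to\zeta$, $z\in\mathbb D$). Let $\alpha<1$ be real and let $\omega:\mathbb N\to(1,+\infty)$ satisfy $\omega(\kappa)\to+\infty$. Let $X=H^2(\mathbb D)$ be the Hardy space of holomorphic functions $f(z)=\sum_{n\ge0}a_nz^n$ on $\mathbb D$ with $\|f\|^2=\sum_n|a_n|^2<\infty$. Let $E_\omega$ be the set of functions $f:X\to\mathbb R$ that are infinitely (real) differentiable at $0$, satisfy $f(x)=\sum_{\kappa\ge0}\frac{D^\kappa f(0)}{\kappa!}(x,\dots,x)$ for every $x\in X$, and have $\sup_{\kappa\ge0}\|D^\kappa f(0)\|\,\omega(\kappa)^\kappa<\infty$. Then the composition operator $C_\phi f=f\circ\phi$ is a bounded linear operator on $X$, and there exists a Borel probability measure $\mu$ on $X$ such that: - $\mu$ is $C_\phi$-invariant; - $C_\phi$ is strongly mixing with respect to $\mu$, i.e. $\mu(A\cap C_\phi^{-n}(B))\to\mu(A)\mu(B)$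 for all Borel sets $A,B\subset X$; - $\mu$ has full support, i.e. $\mu(U)>0$ for every nonempty open $U\subset X$; - $E_\omega\subset L^2(X,\mu)$; - for all $f,g\in E_\omega$, $\mathrm{Cov}(f\circ C_\phi^n,g)=O(n^{1-2\alpha})$ as $n\to\infty$, where $\mathrm{Cov}(u,v)=\int_X uv\,d\mu-\int_X u\,d\mu\int_X v\,d\mu$. -/

import Mathlib

open MeasureTheory Filter Topology
open scoped ENNReal Complex.UnitDisc

noncomputable section

/-! ### The Hardy space of the unit disc -/

/-- The Taylor coefficients at `0` of a function on the unit disc are unique. -/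
theorem taylorCoeff_unique {f : 𝔻 → ℂ} {a b : ℕ → ℂ}
    (ha : ∀ z : 𝔻, HasSum (fun n => a n * (z : ℂ) ^ n) (f z))
    (hb : ∀ z : 𝔻, HasSum (fun n => b n * (z : ℂ) ^ n) (f z)) : a = b := by
  have key : ∀ c : ℕ → ℂ, (∀ z : 𝔻, HasSum (fun n => c n * (z : ℂ) ^ n) (f z)) →
      HasFPowerSeriesAt (fun z : ℂ => ∑' n, a n * z ^ n)
        (FormalMultilinearSeries.ofScalars ℂ c) 0 := by
    intro c hc
    refine hasFPowerSeriesAt_iff.2 ?_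
    filter_upwards [Metric.ball_mem_nhds (0 : ℂ) one_pos] with z hz
    have hz' : ‖z‖ < 1 := by simpa using hz
    have h1 := hc (Complex.UnitDisc.mk z hz')
    have h2 := (ha (Complex.UnitDisc.mk z hz')).tsum_eq
    simp only [Complex.UnitDisc.coe_mk] at h1 h2
    simp only [zero_add, h2]
    simpa only [FormalMultilinearSeries.coeff_ofScalars, smul_eq_mul, mul_comm] using h1
  have h := (key a ha).eq_formalMultilinearSeries (key b hb)
  funext n
  have hn := congrArg (fun p : FormalMultilinearSeries ℂ ℂ ℂ => p.coeff n) h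
  simpa [FormalMultilinearSeries.coeff_ofScalars] using hn

/-- The Hardy space `H²(𝔻)` as a space of functions on the disc: the holomorphic functions
`f(z) = ∑ aₙ zⁿ` on `𝔻` whose Taylor coefficients satisfy `∑ |aₙ|² < ∞`. -/
def hardySubmodule : Submodule ℂ (𝔻 → ℂ) where
  carrier := {f | ∃ a : lp (fun _ : ℕ => ℂ) 2,
    ∀ z : 𝔻, HasSum (fun n => a n * (z : ℂ) ^ n) (f z)}
  add_mem' := by
    rintro f g ⟨a, ha⟩ ⟨b, hb⟩
    refine ⟨a + b, fun z => ?_⟩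
    simpa [add_mul] using (ha z).add (hb z)
  zero_mem' := ⟨0, fun z => by simp [hasSum_zero]⟩
  smul_mem' := by
    rintro c f ⟨a, ha⟩
    refine ⟨c • a, fun z => ?_⟩
    simpa [mul_assoc] using (ha z).mul_left c

/-- The Hardy space `H²(𝔻)`. This is a type synonym for `hardySubmodule`, so that it carries the
Hardy norm and not the topology of pointwise convergence. -/
def HardySpace : Type := hardySubmodule

namespace HardySpace

instance : AddCommGroup HardySpace := inferInstanceAs (AddCommGroup hardySubmodule)

instance : Module ℂ HardySpace := inferInstanceAs (Module ℂ hardySubmodule)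

instance : CoeFun HardySpace (fun _ => 𝔻 → ℂ) := ⟨fun f => f.1⟩

/-- The sequence of Taylor coefficients at `0` of an element of `H²(𝔻)`. -/
def coeff : HardySpace →ₗ[ℂ] lp (fun _ : ℕ => ℂ) 2 where
  toFun f := f.2.choose
  map_add' f g := by
    refine lp.ext (taylorCoeff_unique (f := (f + g : HardySpace)) (f + g).2.choose_spec ?_)
    intro z
    have h := (f.2.choose_spec z).add (g.2.choose_spec z)
    simp only [← add_mul] at h
    exact h
  map_smul' c f := by
    refine lp.ext (taylorCoeff_unique (f := (c • f : HardySpace)) (c • f).2.choose_spec ?_)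
    intro z
    have h := (f.2.choose_spec z).mul_left c
    simp only [← mul_assoc] at h
    exact h

theorem hasSum_coeff (f : HardySpace) (z : 𝔻) :
    HasSum (fun n => coeff f n * (z : ℂ) ^ n) (f z) := f.2.choose_spec z

theorem coeff_injective : Function.Injective coeff := by
  intro f g h
  refine Subtype.ext (funext fun z => ?_)
  have hf := hasSum_coeff f z
  rw [h] at hf
  exact hf.unique (hasSum_coeff g z)

/-- The Hardy norm `‖f‖ = (∑ |aₙ|²)^{1/2}`. -/
instance : NormedAddCommGroup HardySpace :=
  NormedAddCommGroup.induced HardySpace (lp (fun _ : ℕ => ℂ) 2) coeff coeff_injective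

instance : NormedSpace ℂ HardySpace :=
  NormedSpace.induced ℂ HardySpace (lp (fun _ : ℕ => ℂ) 2) coeff

instance : MeasurableSpace HardySpace := borel HardySpace

instance : BorelSpace HardySpace := ⟨rfl⟩

end HardySpace

/-! ### Parabolic automorphisms of the disc -/

/-- `φ` is an automorphism of the unit disc: a holomorphic bijection of `𝔻` onto itself. -/
def IsDiscAutomorphism (φ : 𝔻 → 𝔻) : Prop :=
  Function.Bijective φ ∧
    ∃ F : ℂ → ℂ, DifferentiableOn ℂ F (Metric.ball 0 1) ∧ ∀ z : 𝔻, F z = φ z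

/-- `ζ` is a boundary fixed point of `φ`: a point of the unit circle at which `φ` extends
continuously by the value `ζ`. -/
def IsBoundaryFixedPoint (φ : 𝔻 → 𝔻) (ζ : ℂ) : Prop :=
  ‖ζ‖ = 1 ∧ Tendsto (fun z : 𝔻 => (φ z : ℂ)) (comap (fun z : 𝔻 => (z : ℂ)) (𝓝 ζ)) (𝓝 ζ)

/-- A parabolic automorphism of the disc: an automorphism with a unique boundary fixed point. -/
def IsParabolicAutomorphism (φ : 𝔻 → 𝔻) : Prop :=
  IsDiscAutomorphism φ ∧ ∃! ζ : ℂ, IsBoundaryFixedPoint φ ζ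

/-! ### Strong mixing and the class `E_ω` -/

/-- `T` is strongly mixing with respect to `μ`: `μ(A ∩ T⁻ⁿ B) → μ(A) μ(B)` for all measurable
sets `A` and `B`. -/
def StronglyMixing {X : Type*} [MeasurableSpace X] (T : X → X) (μ : Measure X) : Prop :=
  ∀ A B : Set X, MeasurableSet A → MeasurableSet B →
    Tendsto (fun n : ℕ => μ (A ∩ T^[n] ⁻¹' B)) atTop (𝓝 (μ A * μ B))

/-- The class `E_ω` of functions `f : X → ℝ` that are infinitely differentiable at `0`, are
everywhere the sum of their Taylor series at `0`, and satisfy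
`sup_κ ‖D^κ f(0)‖ ω(κ)^κ < ∞`. -/
def classE (X : Type*) [NormedAddCommGroup X] [NormedSpace ℝ X] (ω : ℕ → ℝ) : Set (X → ℝ) :=
  {f | ContDiffAt ℝ (⊤ : ℕ∞) f 0 ∧
    (∀ x : X, HasSum (fun κ : ℕ => (κ.factorial : ℝ)⁻¹ * iteratedFDeriv ℝ κ f 0 (fun _ => x))
      (f x)) ∧
    BddAbove (Set.range fun κ : ℕ => ‖iteratedFDeriv ℝ κ f 0‖ * ω κ ^ κ)}

end

/-! Let `w` be the conjugate of the boundary fixed point. In the coordinate `(1 - w z)⁻¹` the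
automorphism is a translation by `i b` with `b` real and nonzero
(`IsParabolicAutomorphism.exists_normal_form`). So the functions `F_s(z) = ((1 - w z)⁻¹ + i s)⁻¹`
satisfy `F_s ∘ φ = F_(s+b)`, and `‖F_s‖² = 2 / (1 + s²)`. The vectors `2⁻ʲ F_s` and `2⁻ʲ i F_s` with
`s = b k + 1/(j+1)`, `k ∈ ℤ`, `j ∈ ℕ`, form a family `u` which the composition operator `T` permutes
by `k ↦ k + 1`. Their squared norms are summable and their real span is dense.

The measure is the law of `∑ ξ_i u_i` with independent standard real Gaussian `ξ_i`. It is invariant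
because `T` only relabels the variables, and it has full support because the span is dense.

Correlations are controlled without any spectral theory. Replacing the variables in one of the two
functions by independent copies, one index at a time, bounds the covariance of `f ∘ T^n` and `g` by
a constant times `∑ ‖T^n u_i‖ ‖u_i‖` (`abs_covariance_gaussianSum_le`). This works for all functions
whose Lipschitz constant grows at most exponentially, which covers both `E_ω` and bounded Lipschitz
functions. The integrability comes from `E cosh ‖∑ ξ_i u_i‖ ≤ exp (∑ ‖u_i‖² / 2)`, a consequence of
the parallelogram identity.

Here the correlation sum is at most a constant times `∑_k (1 + |k+n|)⁻¹ (1 + |k|)⁻¹`, which is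
`O(n^(-β))` for every `β < 1`. This gives the rate, and, approximating indicators by Lipschitz
functions, strong mixing.

Boundedness of `T` rests on the fact that multiplication by a Möbius automorphism is an isometry of
the Hardy space, so that the powers of `φ` times a suitable reproducing kernel are orthogonal. -/

/-! ### Finite Gaussian sums -/

open ProbabilityTheory in
/-- The law of a family of independent standard Gaussian variables. -/
noncomputable def stdGaussianPi (J : Type*) : Measure (J → ℝ) :=
  Measure.infinitePi fun _ => gaussianReal 0 1

noncomputable instance (J : Type*) : IsProbabilityMeasure (stdGaussianPi J) := by
  unfold stdGaussianPi; infer_instance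

/-- Serves both for relabelling variables by a permutation and for selecting, index by index, one of
two independent copies. -/
theorem stdGaussianPi_measurePreserving_comp {I J : Type*} {e : I → J}
    (he : Function.Injective e) :
    MeasurePreserving (fun (x : J → ℝ) i => x (e i)) (stdGaussianPi J) (stdGaussianPi I) :=
  ⟨by fun_prop, Measure.map_infinitePi_infinitePi_of_inj (P := fun _ : J =>
    ProbabilityTheory.gaussianReal 0 1) he⟩

/-! ### Hyperbolic cosine and the parallelogram identity -/

section Cosh

/-- Both `p` and `q` lie in `[y, x]`, and equality of the sums makes them complementary convex
combinations of the endpoints; convexity of the power does the rest. -/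
theorem pow_add_pow_le_of_add_eq {p q x y : ℝ} (hp : p ≤ x) (hq : q ≤ x) (hy : 0 ≤ y)
    (h : p + q = x + y) (n : ℕ) : p ^ n + q ^ n ≤ x ^ n + y ^ n := by
  have hyp : y ≤ p := by linarith
  have hyq : y ≤ q := by linarith
  rcases eq_or_lt_of_le (hyp.trans hp) with hxy | hxy
  · have h1 : p = x := by linarith
    have h2 : q = y := by linarith
    rw [h1, h2]
  · have hc := (convexOn_pow (𝕜 := ℝ) n).2
    have hd : 0 < x - y := sub_pos.2 hxy
    have e1 : (p - y) / (x - y) + (x - p) / (x - y) = 1 := by field_simp; ring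
    have e2 : (q - y) / (x - y) + (x - q) / (x - y) = 1 := by field_simp; ring
    have h1 := hc (Set.mem_Ici.2 (hy.trans hxy.le)) (Set.mem_Ici.2 hy)
      (div_nonneg (sub_nonneg.2 hyp) hd.le) (div_nonneg (sub_nonneg.2 hp) hd.le) e1
    have h2 := hc (Set.mem_Ici.2 (hy.trans hxy.le)) (Set.mem_Ici.2 hy)
      (div_nonneg (sub_nonneg.2 hyq) hd.le) (div_nonneg (sub_nonneg.2 hq) hd.le) e2
    simp only [smul_eq_mul] at h1 h2
    have r1 : (p - y) / (x - y) * x + (x - p) / (x - y) * y = p := by field_simp; ring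
    have r2 : (q - y) / (x - y) * x + (x - q) / (x - y) * y = q := by field_simp; ring
    rw [r1] at h1
    rw [r2] at h2
    refine (add_le_add h1 h2).trans (le_of_eq ?_)
    have hq' : q = x + y - p := by linarith
    subst hq'
    field_simp
    ring

/-- The right side is `cosh (a + b) + cosh (a - b)`. Since `cosh` is a power series in the square
with nonnegative coefficients, it suffices to compare powers of `p²`, `q²` with those of `(a + b)²`,
`(a - b)²`, a pair with the same sum and wider spread. -/
theorem cosh_add_cosh_le {p q a b : ℝ} (hp0 : 0 ≤ p) (hq0 : 0 ≤ q)
    (hp : p ≤ a + b) (hq : q ≤ a + b) (h : p ^ 2 + q ^ 2 = 2 * (a ^ 2 + b ^ 2)) :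
    Real.cosh p + Real.cosh q ≤ 2 * (Real.cosh a * Real.cosh b) := by
  have e : 2 * (Real.cosh a * Real.cosh b) = Real.cosh (a + b) + Real.cosh (a - b) := by
    rw [Real.cosh_add, Real.cosh_sub]; ring
  rw [e]
  refine hasSum_le (fun n => ?_) ((Real.hasSum_cosh p).add (Real.hasSum_cosh q))
    ((Real.hasSum_cosh (a + b)).add (Real.hasSum_cosh (a - b)))
  rw [← add_div, ← add_div]
  refine div_le_div_of_nonneg_right ?_ (by positivity)
  simp only [pow_mul]
  exact pow_add_pow_le_of_add_eq (pow_le_pow_left₀ hp0 hp 2) (pow_le_pow_left₀ hq0 hq 2)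
    (sq_nonneg _) (by rw [h]; ring) n

theorem one_add_sq_half_le_cosh (x : ℝ) : 1 + x ^ 2 / 2 ≤ Real.cosh x := by
  have h := sum_le_hasSum (Finset.range 2) (fun n _ => by rw [pow_mul]; positivity)
    (Real.hasSum_cosh x)
  simpa [Finset.sum_range_succ, Nat.factorial] using h

/-- The moment bounds below use Hilbert geometry only through this inequality, which averages over
the sign of one summand. -/
theorem cosh_norm_add_add_cosh_norm_sub_le {H : Type*} [NormedAddCommGroup H]
    [InnerProductSpaceable H] (s v : H) :
    Real.cosh ‖s + v‖ + Real.cosh ‖s - v‖ ≤ 2 * (Real.cosh ‖s‖ * Real.cosh ‖v‖) := by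
  refine cosh_add_cosh_le (norm_nonneg _) (norm_nonneg _) (norm_add_le _ _) (norm_sub_le _ _) ?_
  have := InnerProductSpaceable.parallelogram_identity s v
  simp only [sq]
  exact this

end Cosh

/-! ### Exponential moments of finite Gaussian sums -/

section GaussianSum

variable {H : Type*} [NormedAddCommGroup H] [NormedSpace ℝ H] {J : Type*}

/-- The finite sum `∑ ξ_j u_j`, `j ∈ t`. -/
def gaussianSum (u : J → H) (t : Finset J) (x : J → ℝ) : H := ∑ j ∈ t, x j • u j

theorem gaussianSum_stronglyMeasurable (u : J → H) (t : Finset J) :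
    StronglyMeasurable (gaussianSum u t) := by
  unfold gaussianSum
  refine Finset.stronglyMeasurable_fun_sum _ fun j _ => ?_
  exact (measurable_pi_apply j).stronglyMeasurable.smul_const _

variable [MeasurableSpace H] [BorelSpace H]

theorem gaussianSum_measurable (u : J → H) (t : Finset J) : Measurable (gaussianSum u t) :=
  (gaussianSum_stronglyMeasurable u t).measurable

theorem gaussianSum_indepFun (u v : J → H) {t s : Finset J} (h : Disjoint t s) :
    ProbabilityTheory.IndepFun (gaussianSum u t) (gaussianSum v s) (stdGaussianPi J) := by
  have h0 : ProbabilityTheory.iIndepFun (fun j (x : J → ℝ) => x j) (stdGaussianPi J) :=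
    ProbabilityTheory.iIndepFun_infinitePi (X := fun _ x => x) (by fun_prop)
  have h1 := h0.indepFun_finset t s h (fun j => by fun_prop)
  have key : ∀ (w : J → H) (r : Finset J),
      Measurable (fun y : r → ℝ => ∑ j : r, y j • w j) := fun w r =>
    Continuous.measurable (by fun_prop)
  have h2 := h1.comp (key u t) (key v s)
  have e : ∀ (w : J → H) (r : Finset J),
      (fun y : r → ℝ => ∑ j : r, y j • w j) ∘ (fun (a : J → ℝ) (i : r) => a i) =
        gaussianSum w r := by
    intro w r
    funext a
    simp only [Function.comp, gaussianSum]
    exact Finset.sum_coe_sort r (fun j => a j • w j)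
  rwa [e, e] at h2

theorem lintegral_cosh_mul_gaussian (c : ℝ) (j : J) :
    ∫⁻ x, ENNReal.ofReal (Real.cosh (x j * c)) ∂(stdGaussianPi J)
      = ENNReal.ofReal (Real.exp (c ^ 2 / 2)) := by
  have hmp : MeasurePreserving (fun x : J → ℝ => x j) (stdGaussianPi J)
      (ProbabilityTheory.gaussianReal 0 1) := measurePreserving_eval_infinitePi _ j
  have hmeas : Measurable fun r : ℝ => ENNReal.ofReal (Real.cosh (r * c)) :=
    ENNReal.measurable_ofReal.comp
      ((Real.continuous_cosh.comp (continuous_id.mul continuous_const)).measurable)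
  rw [hmp.lintegral_comp (f := fun r => ENNReal.ofReal (Real.cosh (r * c))) hmeas]
  have hi : ∀ t : ℝ, Integrable (fun r : ℝ => Real.exp (t * r))
      (ProbabilityTheory.gaussianReal 0 1) := fun t =>
    ProbabilityTheory.integrable_exp_mul_gaussianReal t
  have hm : ∀ t : ℝ, ∫ r, Real.exp (t * r) ∂(ProbabilityTheory.gaussianReal 0 1)
      = Real.exp (t ^ 2 / 2) := by
    intro t
    have := congrFun (ProbabilityTheory.mgf_id_gaussianReal (μ := 0) (v := 1)) t
    simpa [ProbabilityTheory.mgf] using this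
  have hc : ∀ r : ℝ, Real.cosh (r * c) = (Real.exp (c * r) + Real.exp (-c * r)) / 2 := by
    intro r
    rw [Real.cosh_eq]
    ring_nf
  simp only [hc]
  have hsum : Integrable (fun r : ℝ => (Real.exp (c * r) + Real.exp (-c * r)) / 2)
      (ProbabilityTheory.gaussianReal 0 1) := ((hi c).add (hi (-c))).div_const 2
  rw [← ofReal_integral_eq_lintegral_ofReal hsum (ae_of_all _ fun r => by positivity)]
  rw [integral_div]
  have := integral_add (hi c) (hi (-c))
  rw [this, hm, hm]
  congr 1
  rw [neg_sq]; ring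

/-- Induction on the index set. Changing the sign of the new variable preserves the law, so the
integrand may be averaged over that sign and bounded by `cosh ‖S‖ cosh (ξ_i ‖u_i‖)`. Independence
splits the integral, and the scalar factor is `exp (‖u_i‖² / 2)`. The bound sees only `∑ ‖u_j‖²`, so
it survives the passage to infinite sums. -/
theorem lintegral_cosh_norm_gaussianSum_le [InnerProductSpaceable H] (u : J → H) (t : Finset J) :
    ∫⁻ x, ENNReal.ofReal (Real.cosh ‖gaussianSum u t x‖) ∂(stdGaussianPi J)
      ≤ ENNReal.ofReal (Real.exp ((∑ j ∈ t, ‖u j‖ ^ 2) / 2)) := by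
  classical
  induction t using Finset.induction_on with
  | empty => simp [gaussianSum]
  | insert i t hi ih =>
    set S := gaussianSum u t
    have hS : Measurable S := gaussianSum_measurable u t
    set flip : (J → ℝ) → J → ℝ := fun x j => (if j = i then (fun r => -r) else id) (x j)
    have hflip : MeasurePreserving flip (stdGaussianPi J) (stdGaussianPi J) := by
      have hm : ∀ j, Measurable (if j = i then (fun r : ℝ => -r) else id) := fun j => by
        split_ifs <;> fun_prop
      refine ⟨measurable_pi_lambda _ fun j => (hm j).comp (measurable_pi_apply j), ?_⟩
      unfold stdGaussianPi
      rw [Measure.infinitePi_map_pi (fun _ => ProbabilityTheory.gaussianReal 0 1) hm]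
      congr 1
      funext j
      split_ifs
      · simpa using ProbabilityTheory.gaussianReal_map_neg (μ := 0) (v := 1)
      · simp
    have hSf : ∀ x, S (flip x) = S x := by
      intro x
      refine Finset.sum_congr rfl fun j hj => ?_
      have : j ≠ i := fun h => hi (h ▸ hj)
      simp [flip, this]
    have hins : ∀ x, gaussianSum u (insert i t) x = S x + x i • u i := by
      intro x
      rw [gaussianSum, Finset.sum_insert hi, add_comm]
      rfl
    have hmc : ∀ {g : (J → ℝ) → H}, StronglyMeasurable g →
        Measurable fun x => ENNReal.ofReal (Real.cosh ‖g x‖) := fun hg =>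
      ENNReal.measurable_ofReal.comp (Real.continuous_cosh.measurable.comp hg.norm.measurable)
    have hsm1 := gaussianSum_stronglyMeasurable u (insert i t)
    have hflipint : ∫⁻ x, ENNReal.ofReal (Real.cosh ‖S x + x i • u i‖) ∂(stdGaussianPi J)
        = ∫⁻ x, ENNReal.ofReal (Real.cosh ‖S x - x i • u i‖) ∂(stdGaussianPi J) := by
      have := hflip.lintegral_comp (hmc hsm1)
      simp only [hins] at this
      rw [← this]
      refine lintegral_congr fun x => ?_
      rw [hSf]
      simp [flip, sub_eq_add_neg]
    have hind : ProbabilityTheory.IndepFun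
        (fun x => ENNReal.ofReal (Real.cosh ‖S x‖))
        (fun x => ENNReal.ofReal (Real.cosh (x i * ‖u i‖))) (stdGaussianPi J) := by
      have h := gaussianSum_indepFun u u (t := t) (s := {i}) (by simpa using hi)
      have hφ : Measurable fun y : H => ENNReal.ofReal (Real.cosh ‖y‖) :=
        ENNReal.measurable_ofReal.comp (Real.continuous_cosh.comp continuous_norm).measurable
      have h2 := h.comp hφ hφ
      have e : (fun x : J → ℝ => ENNReal.ofReal (Real.cosh (x i * ‖u i‖)))
          = (fun y : H => ENNReal.ofReal (Real.cosh ‖y‖)) ∘ gaussianSum u {i} := by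
        funext x
        simp only [Function.comp, gaussianSum, Finset.sum_singleton, norm_smul, Real.norm_eq_abs]
        rw [← Real.cosh_abs (x i * _), abs_mul, abs_norm]
      rw [e]
      exact h2
    have hmS : Measurable fun x => ENNReal.ofReal (Real.cosh ‖S x‖) :=
      hmc (gaussianSum_stronglyMeasurable u t)
    have hmi : Measurable fun x : J → ℝ => ENNReal.ofReal (Real.cosh (x i * ‖u i‖)) :=
      ENNReal.measurable_ofReal.comp
        (Real.continuous_cosh.measurable.comp ((measurable_pi_apply i).mul_const _))
    simp only [hins]
    -- One of the two copies of the integral is replaced by its sign-flipped form.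
    have h2 : 2 * ∫⁻ x, ENNReal.ofReal (Real.cosh ‖S x + x i • u i‖) ∂(stdGaussianPi J)
        ≤ 2 * (∫⁻ x, ENNReal.ofReal (Real.cosh ‖S x‖) * ENNReal.ofReal (Real.cosh (x i * ‖u i‖))
          ∂(stdGaussianPi J)) := by
      rw [two_mul]
      nth_rewrite 2 [hflipint]
      rw [← lintegral_add_left (by simpa only [hins] using hmc hsm1),
        ← lintegral_const_mul' _ _ ENNReal.ofNat_ne_top]
      refine lintegral_mono fun x => ?_
      have h := cosh_norm_add_add_cosh_norm_sub_le (S x) (x i • u i)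
      have e : Real.cosh ‖x i • u i‖ = Real.cosh (x i * ‖u i‖) := by
        rw [norm_smul, Real.norm_eq_abs, ← Real.cosh_abs (x i * ‖u i‖), abs_mul, abs_norm]
      rw [e] at h
      rw [← ENNReal.ofReal_add (Real.cosh_pos _).le (Real.cosh_pos _).le,
        ← ENNReal.ofReal_mul (Real.cosh_pos _).le]
      refine (ENNReal.ofReal_le_ofReal h).trans (le_of_eq ?_)
      rw [ENNReal.ofReal_mul zero_le_two]
      simp
    have h3 := (ENNReal.mul_le_mul_iff_right two_ne_zero ENNReal.ofNat_ne_top).1 h2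
    refine h3.trans ?_
    have h4 := ProbabilityTheory.lintegral_mul_eq_lintegral_mul_lintegral_of_indepFun hmS hmi hind
    simp only [Pi.mul_apply] at h4
    rw [h4, lintegral_cosh_mul_gaussian, Finset.sum_insert hi]
    refine (mul_le_mul_left ih _).trans (le_of_eq ?_)
    rw [← ENNReal.ofReal_mul (Real.exp_pos _).le, ← Real.exp_add]
    congr 2
    ring

theorem lintegral_exp_norm_gaussianSum_le [InnerProductSpaceable H] (u : J → H) (t : Finset J)
    (c : ℝ) :
    ∫⁻ x, ENNReal.ofReal (Real.exp (c * ‖gaussianSum u t x‖)) ∂(stdGaussianPi J)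
      ≤ ENNReal.ofReal (2 * Real.exp (c ^ 2 * (∑ j ∈ t, ‖u j‖ ^ 2) / 2)) := by
  have h := lintegral_cosh_norm_gaussianSum_le (fun j => c • u j) t
  have e : ∀ x, gaussianSum (fun j => c • u j) t x = c • gaussianSum u t x := by
    intro x
    simp only [gaussianSum, Finset.smul_sum]
    exact Finset.sum_congr rfl fun j _ => smul_comm _ _ _
  simp only [e, norm_smul, Real.norm_eq_abs, mul_pow, sq_abs, ← Finset.mul_sum] at h
  rw [ENNReal.ofReal_mul zero_le_two]
  refine le_trans ?_ (mul_le_mul_right h _)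
  rw [← lintegral_const_mul' _ _ ENNReal.ofReal_ne_top]
  refine lintegral_mono fun x => ?_
  rw [← ENNReal.ofReal_mul zero_le_two]
  refine ENNReal.ofReal_le_ofReal ?_
  have h1 : Real.cosh (|c| * ‖gaussianSum u t x‖) = Real.cosh (c * ‖gaussianSum u t x‖) := by
    rw [← Real.cosh_abs (c * _), abs_mul, abs_norm]
  rw [h1, Real.cosh_eq]
  have := Real.exp_pos (-(c * ‖gaussianSum u t x‖))
  linarith

/-- Integrate `r² / 2 ≤ cosh r - 1`. Keeping the `- 1` makes the bound tend to zero with `∑ ‖u_j‖²`,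
as the Cauchy criterion in `L²` requires. -/
theorem lintegral_norm_sq_gaussianSum_le [InnerProductSpaceable H] (u : J → H) (t : Finset J) :
    ∫⁻ x, ENNReal.ofReal (‖gaussianSum u t x‖ ^ 2) ∂(stdGaussianPi J)
      ≤ ENNReal.ofReal (2 * (Real.exp ((∑ j ∈ t, ‖u j‖ ^ 2) / 2) - 1)) := by
  have h := lintegral_cosh_norm_gaussianSum_le u t
  have hm : Measurable fun x => ENNReal.ofReal (‖gaussianSum u t x‖ ^ 2 / 2) :=
    ENNReal.measurable_ofReal.comp
      (((gaussianSum_stronglyMeasurable u t).norm.measurable.pow_const 2).div_const 2)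
  have h1 : (∫⁻ x, ENNReal.ofReal (‖gaussianSum u t x‖ ^ 2 / 2) ∂(stdGaussianPi J)) + 1
      ≤ ENNReal.ofReal (Real.exp ((∑ j ∈ t, ‖u j‖ ^ 2) / 2)) := by
    refine le_trans ?_ h
    have : (1 : ℝ≥0∞) = ∫⁻ _x, 1 ∂(stdGaussianPi J) := by simp
    rw [this, ← lintegral_add_left hm]
    refine lintegral_mono fun x => ?_
    rw [← ENNReal.ofReal_one, ← ENNReal.ofReal_add (by positivity) zero_le_one]
    refine ENNReal.ofReal_le_ofReal ?_
    have := one_add_sq_half_le_cosh ‖gaussianSum u t x‖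
    linarith
  have h2 : (∫⁻ x, ENNReal.ofReal (‖gaussianSum u t x‖ ^ 2 / 2) ∂(stdGaussianPi J))
      ≤ ENNReal.ofReal (Real.exp ((∑ j ∈ t, ‖u j‖ ^ 2) / 2) - 1) := by
    rw [ENNReal.ofReal_sub _ zero_le_one, ENNReal.ofReal_one]
    exact ENNReal.le_sub_of_add_le_right ENNReal.one_ne_top h1
  have h3 : ∀ x, ENNReal.ofReal (‖gaussianSum u t x‖ ^ 2)
      = ENNReal.ofReal 2 * ENNReal.ofReal (‖gaussianSum u t x‖ ^ 2 / 2) := by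
    intro x
    rw [← ENNReal.ofReal_mul zero_le_two]
    congr 1
    ring
  simp only [h3]
  rw [lintegral_const_mul _ hm, ENNReal.ofReal_mul zero_le_two]
  exact mul_le_mul_right h2 _

end GaussianSum

/-! ### Functions of exponential growth with exponentially growing Lipschitz constant -/

section ExpLipschitz

variable {H : Type*} [NormedAddCommGroup H]

/-- `f` is Lipschitz with a constant that grows at most exponentially. -/
def ExpLipschitz (K c : ℝ) (f : H → ℝ) : Prop :=
  ∀ x y, |f x - f y| ≤ K * ‖x - y‖ * Real.exp (c * (‖x‖ + ‖y‖))

/-- `f` is Lipschitz with a constant that grows at most exponentially, for some constants. -/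
def IsExpLipschitz (f : H → ℝ) : Prop :=
  ∃ K c : ℝ, 0 ≤ K ∧ 0 ≤ c ∧ ExpLipschitz K c f

theorem ExpLipschitz.mono {K c K' c' : ℝ} {f : H → ℝ} (hf : ExpLipschitz K c f) (hK : K ≤ K')
    (hK0 : 0 ≤ K') (hc : c ≤ c') : ExpLipschitz K' c' f := fun x y => by
  refine (hf x y).trans ?_
  have h1 : K * ‖x - y‖ ≤ K' * ‖x - y‖ := mul_le_mul_of_nonneg_right hK (norm_nonneg _)
  have h2 : c * (‖x‖ + ‖y‖) ≤ c' * (‖x‖ + ‖y‖) := mul_le_mul_of_nonneg_right hc (by positivity)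
  exact mul_le_mul h1 (Real.exp_le_exp.2 h2) (Real.exp_pos _).le (by positivity)

theorem ExpLipschitz.abs_le {K c : ℝ} {f : H → ℝ} (hK : 0 ≤ K) (hf : ExpLipschitz K c f)
    (hc : 0 ≤ c) (x : H) : |f x| ≤ (|f 0| + K) * Real.exp ((c + 1) * ‖x‖) := by
  have h := hf x 0
  simp only [sub_zero, norm_zero, add_zero] at h
  have h1 : |f x| ≤ |f 0| + |f x - f 0| := by
    have := abs_add_le (f 0) (f x - f 0)
    rwa [add_sub_cancel] at this
  -- The linear factor is absorbed at the price of raising the exponent from `c` to `c + 1`.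
  have h2 : ‖x‖ ≤ Real.exp ‖x‖ := by linarith [Real.add_one_le_exp ‖x‖]
  have h3 : 1 ≤ Real.exp ((c + 1) * ‖x‖) := Real.one_le_exp (by positivity)
  have h4 : K * ‖x‖ * Real.exp (c * ‖x‖) ≤ K * Real.exp ((c + 1) * ‖x‖) := by
    rw [add_mul, one_mul, Real.exp_add, mul_assoc, mul_comm ‖x‖]
    gcongr
  have h5 : |f 0| ≤ |f 0| * Real.exp ((c + 1) * ‖x‖) := le_mul_of_one_le_right (abs_nonneg _) h3
  rw [add_mul]
  linarith

theorem IsExpLipschitz.continuous {f : H → ℝ} (hf : IsExpLipschitz f) : Continuous f := by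
  obtain ⟨K, c, hK, hc, hf⟩ := hf
  refine continuous_iff_continuousAt.2 fun x => ?_
  rw [ContinuousAt, tendsto_iff_norm_sub_tendsto_zero]
  have hlim : Tendsto (fun y : H => K * ‖y - x‖ * Real.exp (c * (‖y‖ + ‖x‖))) (𝓝 x)
      (𝓝 (K * ‖x - x‖ * Real.exp (c * (‖x‖ + ‖x‖)))) :=
    Continuous.tendsto (by fun_prop) x
  simp only [sub_self, norm_zero, mul_zero, zero_mul] at hlim
  exact squeeze_zero (fun _ => norm_nonneg _) (fun y => hf y x) hlim

/-- Closure under products reduces square integrability, and the convergence of the mixed integrals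
in a covariance, to statements about a single function. -/
theorem IsExpLipschitz.mul {f g : H → ℝ} (hf : IsExpLipschitz f) (hg : IsExpLipschitz g) :
    IsExpLipschitz fun x => f x * g x := by
  obtain ⟨K, c, hK, hc, hf⟩ := hf
  obtain ⟨L, d, hL, hd, hg⟩ := hg
  refine ⟨(|f 0| + K) * L + K * (|g 0| + L), c + d + 1, by positivity, by positivity,
    fun x y => ?_⟩
  have e : f x * g x - f y * g y = f x * (g x - g y) + (f x - f y) * g y := by ring
  have hE : ∀ {a b : ℝ}, a ≤ b → Real.exp a ≤ Real.exp b := fun h => Real.exp_le_exp.2 h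
  rw [e]
  refine (abs_add_le _ _).trans ?_
  rw [abs_mul, abs_mul]
  have h1 := mul_le_mul (hf.abs_le hK hc x) (hg x y) (abs_nonneg _) (by positivity)
  have h2 := mul_le_mul (hf x y) (hg.abs_le hL hd y) (abs_nonneg _) (by positivity)
  have hx := norm_nonneg x
  have hy := norm_nonneg y
  have h3 : Real.exp ((c + 1) * ‖x‖) * Real.exp (d * (‖x‖ + ‖y‖))
      ≤ Real.exp ((c + d + 1) * (‖x‖ + ‖y‖)) := by
    rw [← Real.exp_add]
    exact hE (by nlinarith [mul_nonneg hc hy])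
  have h4 : Real.exp (c * (‖x‖ + ‖y‖)) * Real.exp ((d + 1) * ‖y‖)
      ≤ Real.exp ((c + d + 1) * (‖x‖ + ‖y‖)) := by
    rw [← Real.exp_add]
    exact hE (by nlinarith [mul_nonneg hd hx])
  have hn := norm_nonneg (x - y)
  calc _ ≤ ((|f 0| + K) * L) * ‖x - y‖ *
          (Real.exp ((c + 1) * ‖x‖) * Real.exp (d * (‖x‖ + ‖y‖)))
        + (K * (|g 0| + L)) * ‖x - y‖ *
          (Real.exp (c * (‖x‖ + ‖y‖)) * Real.exp ((d + 1) * ‖y‖)) := by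
        refine (add_le_add h1 h2).trans (le_of_eq ?_)
        ring
    _ ≤ ((|f 0| + K) * L) * ‖x - y‖ * Real.exp ((c + d + 1) * (‖x‖ + ‖y‖))
        + (K * (|g 0| + L)) * ‖x - y‖ * Real.exp ((c + d + 1) * (‖x‖ + ‖y‖)) := by
        gcongr
    _ = _ := by ring

theorem IsExpLipschitz.comp_clm [NormedSpace ℝ H] {f : H → ℝ} (hf : IsExpLipschitz f)
    (T : H →L[ℝ] H) : IsExpLipschitz fun x => f (T x) := by
  obtain ⟨K, c, hK, hc, hf⟩ := hf
  refine ⟨K * ‖T‖, c * ‖T‖, by positivity, by positivity, fun x y => (hf _ _).trans ?_⟩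
  have h1 : ‖T x - T y‖ ≤ ‖T‖ * ‖x - y‖ := by rw [← map_sub]; exact T.le_opNorm _
  have h2 : ‖T x‖ + ‖T y‖ ≤ ‖T‖ * (‖x‖ + ‖y‖) := by
    rw [mul_add]; exact add_le_add (T.le_opNorm _) (T.le_opNorm _)
  calc _ ≤ K * (‖T‖ * ‖x - y‖) * Real.exp (c * (‖T‖ * (‖x‖ + ‖y‖))) := by gcongr
    _ = _ := by simp only [mul_assoc]

theorem IsExpLipschitz.of_lipschitz {f : H → ℝ} {K : NNReal} (hf : LipschitzWith K f) :
    IsExpLipschitz f := by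
  refine ⟨K, 0, K.2, le_rfl, fun x y => ?_⟩
  have := hf.dist_le_mul x y
  simpa [Real.dist_eq, dist_eq_norm] using this

/-- As `ω > 1`, all derivatives at `0` have norm at most one constant `C`. With `M = ‖x‖ + ‖y‖`, the
Taylor terms of degree `k` at `x` and `y` differ by at most `C ‖x - y‖ k M^(k-1) / k!`, and these
bounds sum to `C ‖x - y‖ exp M`. -/
theorem isExpLipschitz_of_mem_classE [NormedSpace ℝ H] {ω : ℕ → ℝ} (hω : ∀ k, 1 < ω k)
    {f : H → ℝ} (hf : f ∈ classE H ω) : IsExpLipschitz f := by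
  obtain ⟨-, hsum, C, hC⟩ := hf
  have hC' : ∀ k, ‖iteratedFDeriv ℝ k f 0‖ ≤ C := by
    intro k
    refine le_trans ?_ (hC ⟨k, rfl⟩)
    exact le_mul_of_one_le_right (norm_nonneg _) (one_le_pow₀ (hω k).le)
  have hC0 : 0 ≤ C := (norm_nonneg _).trans (hC' 0)
  refine ⟨C, 1, hC0, zero_le_one, fun x y => ?_⟩
  set M := ‖x‖ + ‖y‖
  have hM : 0 ≤ M := by positivity
  have h1 := (hsum x).sub (hsum y)
  have h2 : HasSum (fun k : ℕ => C * ‖x - y‖ * ((k.factorial : ℝ)⁻¹ * (k * M ^ (k - 1))))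
      (C * ‖x - y‖ * Real.exp M) := by
    refine HasSum.mul_left _ ?_
    -- The term of degree `0` vanishes because of the factor `k`; the shifted series is that of the
    -- exponential.
    rw [hasSum_nat_add_iff' 1 |>.symm]
    simp only [Finset.range_one, Finset.sum_singleton, CharP.cast_eq_zero, zero_mul, mul_zero,
      sub_zero, add_tsub_cancel_right]
    have h3 := NormedSpace.expSeries_div_hasSum_exp (𝔸 := ℝ) M
    rw [← Real.exp_eq_exp_ℝ] at h3
    refine h3.congr_fun fun k => ?_
    rw [Nat.factorial_succ]
    push_cast
    have : (k.factorial : ℝ) ≠ 0 := by positivity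
    have : (k + 1 : ℝ) ≠ 0 := by positivity
    field_simp
  rw [one_mul]
  have h4 : ∀ k : ℕ, ‖(k.factorial : ℝ)⁻¹ * iteratedFDeriv ℝ k f 0 (fun _ => x)
      - (k.factorial : ℝ)⁻¹ * iteratedFDeriv ℝ k f 0 (fun _ => y)‖
      ≤ C * ‖x - y‖ * ((k.factorial : ℝ)⁻¹ * (k * M ^ (k - 1))) := by
    intro k
    rw [← mul_sub, norm_mul]
    have h5 := (iteratedFDeriv ℝ k f 0).norm_image_sub_le (fun _ => x) (fun _ => y)
    have e : (fun _ : Fin k => x) - (fun _ => y) = fun _ => x - y := rfl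
    rw [e, Fintype.card_fin] at h5
    have h6 : ∀ z : H, ‖fun _ : Fin k => z‖ ≤ ‖z‖ := fun z => pi_norm_const_le z
    have h7 : max ‖fun _ : Fin k => x‖ ‖fun _ : Fin k => y‖ ≤ M :=
      max_le ((h6 x).trans (le_add_of_nonneg_right (norm_nonneg _)))
        ((h6 y).trans (le_add_of_nonneg_left (norm_nonneg _)))
    have h8 : ‖iteratedFDeriv ℝ k f 0 (fun _ => x) - iteratedFDeriv ℝ k f 0 (fun _ => y)‖
        ≤ C * k * M ^ (k - 1) * ‖x - y‖ := by
      refine h5.trans ?_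
      have := hC' k
      have := h6 (x - y)
      gcongr
    rw [norm_inv, Real.norm_natCast]
    calc _ ≤ (k.factorial : ℝ)⁻¹ * (C * k * M ^ (k - 1) * ‖x - y‖) := by gcongr
      _ = _ := by ring
  have h9 := tsum_of_norm_bounded h2 h4
  rwa [h1.tsum_eq] at h9

end ExpLipschitz

/-! ### Integrability of exponentially Lipschitz functions of finite Gaussian sums -/

section Moments

variable {H : Type*} [NormedAddCommGroup H] [NormedSpace ℝ H] [MeasurableSpace H] [BorelSpace H]
  [InnerProductSpaceable H] {J : Type*}

theorem integrable_exp_norm_gaussianSum (u : J → H) (t : Finset J) (c : ℝ) :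
    Integrable (fun x => Real.exp (c * ‖gaussianSum u t x‖)) (stdGaussianPi J) := by
  refine ⟨?_, ?_⟩
  · exact (Real.continuous_exp.comp_stronglyMeasurable
      ((gaussianSum_stronglyMeasurable u t).norm.const_mul c)).aestronglyMeasurable
  · rw [hasFiniteIntegral_iff_ofReal (ae_of_all _ fun x => (Real.exp_pos _).le)]
    exact (lintegral_exp_norm_gaussianSum_le u t c).trans_lt ENNReal.ofReal_lt_top

theorem integral_exp_norm_gaussianSum_le (u : J → H) (t : Finset J) (c : ℝ) {M : ℝ}
    (hM : ∑ j ∈ t, ‖u j‖ ^ 2 ≤ M) :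
    ∫ x, Real.exp (c * ‖gaussianSum u t x‖) ∂(stdGaussianPi J)
      ≤ 2 * Real.exp (c ^ 2 * M / 2) := by
  have h := lintegral_exp_norm_gaussianSum_le u t c
  rw [← ofReal_integral_eq_lintegral_ofReal (integrable_exp_norm_gaussianSum u t c)
    (ae_of_all _ fun x => (Real.exp_pos _).le), ENNReal.ofReal_le_ofReal_iff (by positivity)] at h
  refine h.trans ?_
  gcongr

theorem IsExpLipschitz.integrable_gaussianSum {f : H → ℝ} (hf : IsExpLipschitz f) (u : J → H)
    (t : Finset J) : Integrable (fun x => f (gaussianSum u t x)) (stdGaussianPi J) := by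
  have hm := hf.continuous.comp_stronglyMeasurable (gaussianSum_stronglyMeasurable u t)
  obtain ⟨K, c, hK, hc, hf⟩ := hf
  refine ((integrable_exp_norm_gaussianSum u t (c + 1)).const_mul (|f 0| + K)).mono'
    hm.aestronglyMeasurable (ae_of_all _ fun x => hf.abs_le hK hc _)

end Moments

/-! ### A covariance inequality for functions of independent Gaussian variables -/

section Covariance

variable {H : Type*} [NormedAddCommGroup H] [NormedSpace ℝ H] {I : Type*}

open scoped Classical in
/-- The embedding of `I` into `I ⊕ I` that uses the second copy exactly on `A`. -/
noncomputable def mixEmb (A : Finset I) (i : I) : I ⊕ I := if i ∈ A then Sum.inr i else Sum.inl i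

theorem mixEmb_injective (A : Finset I) : Function.Injective (mixEmb A) := by
  intro i j h
  unfold mixEmb at h
  split_ifs at h <;> simpa using h

/-- The Gaussian sum that uses the second copy of the variables on `A`. -/
noncomputable def mixSum (u : I → H) (s A : Finset I) (x : I ⊕ I → ℝ) : H :=
  gaussianSum u s fun i => x (mixEmb A i)

open scoped Classical in
-- Exchanging the two copies of one variable preserves the measure; this is the symmetry behind each
-- step of the covariance estimate.
theorem mixSum_comp_swap (u : I → H) {s A : Finset I} {i : I} (hA : i ∉ A) (x : I ⊕ I → ℝ) :
    mixSum u s A (fun j => x (Equiv.swap (Sum.inl i) (Sum.inr i) j)) = mixSum u s (insert i A) x := by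
  refine Finset.sum_congr rfl fun j _ => ?_
  congr 2
  unfold mixEmb
  rcases eq_or_ne j i with rfl | hj
  · simp [hA]
  · by_cases hjA : j ∈ A
    · simp [hjA, Equiv.swap_apply_of_ne_of_ne, hj]
    · simp [hjA, Equiv.swap_apply_of_ne_of_ne, hj]

open scoped Classical in
theorem mixSum_insert_comp_swap (u : I → H) {s A : Finset I} {i : I} (hA : i ∉ A)
    (x : I ⊕ I → ℝ) :
    mixSum u s (insert i A) (fun j => x (Equiv.swap (Sum.inl i) (Sum.inr i) j)) = mixSum u s A x := by
  rw [← mixSum_comp_swap u hA]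
  simp

open scoped Classical in
theorem norm_mixSum_sub_insert_le (u : I → H) {s A : Finset I} {i : I} (hi : i ∈ s) (hA : i ∉ A)
    (x : I ⊕ I → ℝ) :
    ‖mixSum u s A x - mixSum u s (insert i A) x‖ = |x (Sum.inl i) - x (Sum.inr i)| * ‖u i‖ := by
  have : mixSum u s A x - mixSum u s (insert i A) x = (x (Sum.inl i) - x (Sum.inr i)) • u i := by
    unfold mixSum gaussianSum
    rw [← Finset.sum_sub_distrib, Finset.sum_eq_single_of_mem i hi]
    · simp [mixEmb, hA, sub_smul]
    · intro j _ hj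
      simp [mixEmb, hj]
  rw [this, norm_smul, Real.norm_eq_abs]

theorem measurePreserving_mixEmb (A : Finset I) :
    MeasurePreserving (fun (x : I ⊕ I → ℝ) i => x (mixEmb A i)) (stdGaussianPi (I ⊕ I))
      (stdGaussianPi I) :=
  stdGaussianPi_measurePreserving_comp (mixEmb_injective A)

theorem mixSum_stronglyMeasurable (u : I → H) (s A : Finset I) :
    StronglyMeasurable (mixSum u s A) :=
  (gaussianSum_stronglyMeasurable u s).comp_measurable (measurePreserving_mixEmb A).measurable

theorem integral_comp_mixSum (u : I → H) (s A : Finset I) {f : H → ℝ} (hf : Continuous f) :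
    ∫ x, f (mixSum u s A x) ∂(stdGaussianPi (I ⊕ I))
      = ∫ x, f (gaussianSum u s x) ∂(stdGaussianPi I) := by
  have hmp := measurePreserving_mixEmb A
  have h := integral_map (μ := stdGaussianPi (I ⊕ I)) hmp.measurable.aemeasurable
    (f := fun x => f (gaussianSum u s x))
    (hf.comp_stronglyMeasurable (gaussianSum_stronglyMeasurable u s)).aestronglyMeasurable
  rw [hmp.map_eq] at h
  exact h.symm

variable [MeasurableSpace H] [BorelSpace H] [InnerProductSpaceable H]

theorem integrable_exp_norm_mixSum (u : I → H) (s A : Finset I) (c : ℝ) :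
    Integrable (fun x => Real.exp (c * ‖mixSum u s A x‖)) (stdGaussianPi (I ⊕ I)) :=
  (measurePreserving_mixEmb A).integrable_comp_of_integrable
    (integrable_exp_norm_gaussianSum u s c)

theorem integral_exp_norm_mixSum_le (u : I → H) (s A : Finset I) (c : ℝ) {M : ℝ}
    (hM : ∑ j ∈ s, ‖u j‖ ^ 2 ≤ M) :
    ∫ x, Real.exp (c * ‖mixSum u s A x‖) ∂(stdGaussianPi (I ⊕ I))
      ≤ 2 * Real.exp (c ^ 2 * M / 2) := by
  rw [integral_comp_mixSum u s A (f := fun y => Real.exp (c * ‖y‖)) (by fun_prop)]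
  exact integral_exp_norm_gaussianSum_le u s c hM

theorem integrable_exp_abs_coord {J : Type*} (j : J) (c : ℝ) :
    Integrable (fun x => Real.exp (c * |x j|)) (stdGaussianPi J) ∧
      ∫ x, Real.exp (c * |x j|) ∂(stdGaussianPi J) ≤ 2 * Real.exp (c ^ 2 / 2) := by
  -- A single coordinate is the Gaussian sum in `ℝ` with one vector, equal to `1`.
  have : InnerProductSpaceable ℝ := InnerProductSpace.toInnerProductSpaceable ℝ
  have h1 := integrable_exp_norm_gaussianSum (fun _ : J => (1 : ℝ)) {j} c
  have h2 := integral_exp_norm_gaussianSum_le (fun _ : J => (1 : ℝ)) {j} c (M := 1) (by simp)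
  simp only [gaussianSum, Finset.sum_singleton, smul_eq_mul, mul_one, Real.norm_eq_abs] at h1 h2
  exact ⟨h1, h2⟩

theorem IsExpLipschitz.integrable_mul_mixSum {f g : H → ℝ} (hf : IsExpLipschitz f)
    (hg : IsExpLipschitz g) (u v : I → H) (s A B : Finset I) :
    Integrable (fun x => f (mixSum v s A x) * g (mixSum u s B x)) (stdGaussianPi (I ⊕ I)) := by
  have hm := (hf.continuous.comp_stronglyMeasurable (mixSum_stronglyMeasurable v s A)).mul
    (hg.continuous.comp_stronglyMeasurable (mixSum_stronglyMeasurable u s B))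
  obtain ⟨K, c, hK, hc, hf⟩ := hf
  obtain ⟨L, d, hL, hd, hg⟩ := hg
  refine (((integrable_exp_norm_mixSum v s A (2 * (c + 1))).const_mul ((|f 0| + K) ^ 2)).add
    ((integrable_exp_norm_mixSum u s B (2 * (d + 1))).const_mul ((|g 0| + L) ^ 2))).mono'
    hm.aestronglyMeasurable (ae_of_all _ fun x => ?_)
  have h1 := hf.abs_le hK hc (mixSum v s A x)
  have h2 := hg.abs_le hL hd (mixSum u s B x)
  have e : ∀ a : ℝ, Real.exp (2 * a) = Real.exp a ^ 2 := fun a => by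
    rw [← Real.exp_nat_mul]; norm_num
  simp only [Pi.add_apply, mul_assoc (2 : ℝ), e, ← mul_pow]
  simp only [Real.norm_eq_abs, abs_mul]
  have h3 := mul_le_mul h1 h2 (abs_nonneg _) (by positivity)
  refine h3.trans ?_
  nlinarith [sq_nonneg ((|f 0| + K) * Real.exp ((c + 1) * ‖mixSum v s A x‖) -
    (|g 0| + L) * Real.exp ((d + 1) * ‖mixSum u s B x‖)),
    sq_nonneg ((|f 0| + K) * Real.exp ((c + 1) * ‖mixSum v s A x‖)),
    sq_nonneg ((|g 0| + L) * Real.exp ((d + 1) * ‖mixSum u s B x‖))]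

theorem exp_add_le_half (a b : ℝ) :
    Real.exp (a + b) ≤ (Real.exp (2 * a) + Real.exp (2 * b)) / 2 := by
  have e : ∀ a : ℝ, Real.exp (2 * a) = Real.exp a ^ 2 := fun a => by
    rw [← Real.exp_nat_mul]; norm_num
  rw [e, e, Real.exp_add]
  nlinarith [sq_nonneg (Real.exp a - Real.exp b)]

/-- Repeated use of `exp (x + y) ≤ (exp (2x) + exp (2y)) / 2` separates the variables, so that only
exponential moments of each one alone are needed. Two rounds give the exponent `4`, three give `8`;
the square is first absorbed by `(a - b)² ≤ 2 exp (|a| + |b|)`. -/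
theorem sq_sub_mul_exp_le (a b p q r t : ℝ) :
    (a - b) ^ 2 * Real.exp (p + q + (r + t)) ≤
      (Real.exp (4 * |a|) + Real.exp (4 * |b|)) / 2 +
      (Real.exp (8 * p) + Real.exp (8 * q) + (Real.exp (8 * r) + Real.exp (8 * t))) / 4 := by
  have h1 : (a - b) ^ 2 ≤ 2 * Real.exp (|a| + |b|) := by
    have h := Real.quadratic_le_exp_of_nonneg (x := |a| + |b|) (by positivity)
    have h2 : (a - b) ^ 2 ≤ (|a| + |b|) ^ 2 := sq_le_sq' (by
      have := abs_sub a b; have := neg_abs_le (a - b); linarith) ((le_abs_self _).trans (abs_sub a b))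
    have := abs_nonneg a
    have := abs_nonneg b
    linarith
  have h2 := exp_add_le_half (|a| + |b|) (p + q + (r + t))
  have h3 := exp_add_le_half (2 * |a|) (2 * |b|)
  have h4 := exp_add_le_half (2 * (p + q)) (2 * (r + t))
  have h5 := exp_add_le_half (4 * p) (4 * q)
  have h6 := exp_add_le_half (4 * r) (4 * t)
  have h7 : (a - b) ^ 2 * Real.exp (p + q + (r + t)) ≤
      2 * Real.exp (|a| + |b| + (p + q + (r + t))) := by
    rw [Real.exp_add (|a| + |b|), ← mul_assoc]
    exact mul_le_mul_of_nonneg_right h1 (Real.exp_pos _).le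
  ring_nf at h2 h3 h4 h5 h6 h7 ⊢
  linarith

theorem integral_half_add_quarter {Ω : Type*} [MeasurableSpace Ω] {P : Measure Ω}
    {a b p q r t : Ω → ℝ} (ha : Integrable a P) (hb : Integrable b P) (hp : Integrable p P)
    (hq : Integrable q P) (hr : Integrable r P) (ht : Integrable t P) :
    ∫ x, ((a x + b x) / 2 + (p x + q x + (r x + t x)) / 4) ∂P
      = (∫ x, a x ∂P + ∫ x, b x ∂P) / 2
        + (∫ x, p x ∂P + ∫ x, q x ∂P + (∫ x, r x ∂P + ∫ x, t x ∂P)) / 4 := by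
  have hab : Integrable (fun x => a x + b x) P := ha.add hb
  have hpq : Integrable (fun x => p x + q x) P := hp.add hq
  have hrt : Integrable (fun x => r x + t x) P := hr.add ht
  have h4 : Integrable (fun x => p x + q x + (r x + t x)) P := hpq.add hrt
  rw [integral_add (hab.div_const 2) (h4.div_const 4), integral_div, integral_div,
    integral_add hpq hrt, integral_add ha hb, integral_add hp hq, integral_add hr ht]

/-- The constant in the covariance inequality. -/
noncomputable def covConst (K c M : ℝ) : ℝ :=
  K ^ 2 * (Real.exp 8 + Real.exp (32 * c ^ 2 * M))

open scoped Classical in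
-- Exchanging the two copies of `ξ_i` reverses the sign of the increment of `g` and moves `i` to the
-- second copy inside `f`. So the integral is half that of a product of two increments, of `f` and
-- of `g`, each caused by the change of the single variable `ξ_i`; hence the product `‖v_i‖ ‖u_i‖`.
theorem abs_integral_mixSum_step_le {f g : H → ℝ} {K c M : ℝ} (hK : 0 ≤ K) (hc : 0 ≤ c)
    (hf : ExpLipschitz K c f) (hg : ExpLipschitz K c g) (u v : I → H) {s A : Finset I}
    (hu : ∑ j ∈ s, ‖u j‖ ^ 2 ≤ M) (hv : ∑ j ∈ s, ‖v j‖ ^ 2 ≤ M) {i : I} (hi : i ∈ s)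
    (hA : i ∉ A) :
    |∫ x, f (mixSum v s ∅ x) * (g (mixSum u s A x) - g (mixSum u s (insert i A) x))
        ∂(stdGaussianPi (I ⊕ I))| ≤ covConst K c M * (‖v i‖ * ‖u i‖) := by
  have hf' : IsExpLipschitz f := ⟨K, c, hK, hc, hf⟩
  have hg' : IsExpLipschitz g := ⟨K, c, hK, hc, hg⟩
  set P := stdGaussianPi (I ⊕ I)
  set G : (I ⊕ I → ℝ) → ℝ := fun x => g (mixSum u s A x) - g (mixSum u s (insert i A) x)
  have hint : ∀ B, Integrable (fun x => f (mixSum v s B x) * G x) P := by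
    intro B
    simp only [G, mul_sub]
    exact (hf'.integrable_mul_mixSum hg' u v s B A).sub
      (hf'.integrable_mul_mixSum hg' u v s B (insert i A))
  have hswap : ∫ x, f (mixSum v s ∅ x) * G x ∂P
      = -∫ x, f (mixSum v s (insert i ∅) x) * G x ∂P := by
    have hmp : MeasurePreserving
        (fun (x : I ⊕ I → ℝ) j => x (Equiv.swap (Sum.inl i) (Sum.inr i) j)) P P :=
      stdGaussianPi_measurePreserving_comp (Equiv.injective _)
    have h := integral_map (μ := P) hmp.measurable.aemeasurable
      (f := fun x => f (mixSum v s ∅ x) * G x) (by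
        rw [hmp.map_eq]; exact (hint ∅).aestronglyMeasurable)
    rw [hmp.map_eq] at h
    rw [h, ← integral_neg]
    congr 1
    funext x
    simp only [G, mixSum_comp_swap u hA, mixSum_insert_comp_swap u hA,
      mixSum_comp_swap v (Finset.notMem_empty i)]
    ring
  have h2 : 2 * ∫ x, f (mixSum v s ∅ x) * G x ∂P
      = ∫ x, (f (mixSum v s ∅ x) - f (mixSum v s (insert i ∅) x)) * G x ∂P := by
    simp only [sub_mul]
    rw [integral_sub (hint _) (hint _), two_mul]
    nth_rewrite 2 [hswap]
    ring
  set B : (I ⊕ I → ℝ) → ℝ := fun x =>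
    (Real.exp (4 * |x (Sum.inl i)|) + Real.exp (4 * |x (Sum.inr i)|)) / 2 +
      (Real.exp (8 * c * ‖mixSum v s ∅ x‖) + Real.exp (8 * c * ‖mixSum v s (insert i ∅) x‖)
      + (Real.exp (8 * c * ‖mixSum u s A x‖) + Real.exp (8 * c * ‖mixSum u s (insert i A) x‖))) / 4
  have hB1 := integrable_exp_abs_coord (Sum.inl i : I ⊕ I) 4
  have hB2 := integrable_exp_abs_coord (Sum.inr i : I ⊕ I) 4
  have i1 := integrable_exp_norm_mixSum v s ∅ (8 * c)
  have i2 := integrable_exp_norm_mixSum v s (insert i ∅) (8 * c)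
  have i3 := integrable_exp_norm_mixSum u s A (8 * c)
  have i4 := integrable_exp_norm_mixSum u s (insert i A) (8 * c)
  have hBi : Integrable B P :=
    ((hB1.1.add hB2.1).div_const 2).add (((i1.add i2).add (i3.add i4)).div_const 4)
  -- The exponents are `4² / 2` and `(8c)² M / 2`. The leading `2` cancels against the one produced
  -- by the symmetrization.
  have hBint : ∫ x, B x ∂P ≤ 2 * (Real.exp 8 + Real.exp (32 * c ^ 2 * M)) := by
    have e : ∫ x, B x ∂P = (∫ x, Real.exp (4 * |x (Sum.inl i)|) ∂P
        + ∫ x, Real.exp (4 * |x (Sum.inr i)|) ∂P) / 2 +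
        (∫ x, Real.exp (8 * c * ‖mixSum v s ∅ x‖) ∂P
        + ∫ x, Real.exp (8 * c * ‖mixSum v s (insert i ∅) x‖) ∂P
        + (∫ x, Real.exp (8 * c * ‖mixSum u s A x‖) ∂P
        + ∫ x, Real.exp (8 * c * ‖mixSum u s (insert i A) x‖) ∂P)) / 4 := by
      exact integral_half_add_quarter hB1.1 hB2.1 i1 i2 i3 i4
    rw [e]
    have j1 := integral_exp_norm_mixSum_le v s ∅ (8 * c) hv
    have j2 := integral_exp_norm_mixSum_le v s (insert i ∅) (8 * c) hv
    have j3 := integral_exp_norm_mixSum_le u s A (8 * c) hu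
    have j4 := integral_exp_norm_mixSum_le u s (insert i A) (8 * c) hu
    have k1 := hB1.2
    have k2 := hB2.2
    have e1 : (8 * c) ^ 2 * M / 2 = 32 * c ^ 2 * M := by ring
    have e2 : (4 : ℝ) ^ 2 / 2 = 8 := by norm_num
    rw [e1] at j1 j2 j3 j4
    rw [e2] at k1 k2
    linarith
  have hpt : ∀ x, ‖(f (mixSum v s ∅ x) - f (mixSum v s (insert i ∅) x)) * G x‖
      ≤ K ^ 2 * (‖v i‖ * ‖u i‖) * B x := by
    intro x
    rw [norm_mul, Real.norm_eq_abs, Real.norm_eq_abs]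
    have h1 := hf (mixSum v s ∅ x) (mixSum v s (insert i ∅) x)
    have h3 := hg (mixSum u s A x) (mixSum u s (insert i A) x)
    rw [norm_mixSum_sub_insert_le v hi (Finset.notMem_empty i)] at h1
    rw [norm_mixSum_sub_insert_le u hi hA] at h3
    refine (mul_le_mul h1 h3 (abs_nonneg _) (by positivity)).trans ?_
    have h4 := sq_sub_mul_exp_le (x (Sum.inl i)) (x (Sum.inr i)) (c * ‖mixSum v s ∅ x‖)
      (c * ‖mixSum v s (insert i ∅) x‖) (c * ‖mixSum u s A x‖) (c * ‖mixSum u s (insert i A) x‖)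
    simp only [← mul_assoc (8 : ℝ)] at h4
    refine le_trans (le_of_eq ?_) (mul_le_mul_of_nonneg_left h4
      (by positivity : 0 ≤ K ^ 2 * (‖v i‖ * ‖u i‖)))
    rw [Real.exp_add, mul_add c, mul_add c, ← sq_abs (x (Sum.inl i) - _)]
    ring
  have h3 := norm_integral_le_of_norm_le (hBi.const_mul (K ^ 2 * (‖v i‖ * ‖u i‖)))
    (ae_of_all _ hpt)
  rw [← h2, integral_const_mul, Real.norm_eq_abs, abs_mul, abs_two] at h3
  have h4 := mul_le_mul_of_nonneg_left hBint (by positivity : 0 ≤ K ^ 2 * (‖v i‖ * ‖u i‖))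
  unfold covConst
  linarith

/-- Telescoping: the indices used by `g` move one by one to an independent copy of the variables.
With none moved the integral is that of the product; with all of `s` moved the two factors are
independent and it is the product of the integrals. -/
theorem abs_covariance_gaussianSum_le {f g : H → ℝ} {K c M : ℝ} (hK : 0 ≤ K) (hc : 0 ≤ c)
    (hf : ExpLipschitz K c f) (hg : ExpLipschitz K c g) (u v : I → H) {s : Finset I}
    (hu : ∑ j ∈ s, ‖u j‖ ^ 2 ≤ M) (hv : ∑ j ∈ s, ‖v j‖ ^ 2 ≤ M) :
    |∫ x, f (gaussianSum v s x) * g (gaussianSum u s x) ∂(stdGaussianPi I)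
      - (∫ x, f (gaussianSum v s x) ∂(stdGaussianPi I))
        * ∫ x, g (gaussianSum u s x) ∂(stdGaussianPi I)|
      ≤ covConst K c M * ∑ i ∈ s, ‖v i‖ * ‖u i‖ := by
  classical
  have hf' : IsExpLipschitz f := ⟨K, c, hK, hc, hf⟩
  have hg' : IsExpLipschitz g := ⟨K, c, hK, hc, hg⟩
  set P := stdGaussianPi (I ⊕ I)
  have hI := fun A => hf'.integrable_mul_mixSum hg' u v s ∅ A
  have tele : ∀ A ⊆ s, |∫ x, f (mixSum v s ∅ x) * g (mixSum u s ∅ x) ∂P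
      - ∫ x, f (mixSum v s ∅ x) * g (mixSum u s A x) ∂P|
      ≤ covConst K c M * ∑ i ∈ A, ‖v i‖ * ‖u i‖ := by
    intro A
    induction A using Finset.induction_on with
    | empty => simp
    | insert i A hi ih =>
      intro hA
      have h1 := ih ((Finset.subset_insert _ _).trans hA)
      have h2 := abs_integral_mixSum_step_le hK hc hf hg u v hu hv
        (hA (Finset.mem_insert_self i A)) hi
      simp only [mul_sub] at h2
      rw [integral_sub (hI A) (hI _)] at h2
      rw [Finset.sum_insert hi, mul_add]
      refine (abs_sub_le _ (∫ x, f (mixSum v s ∅ x) * g (mixSum u s A x) ∂P) _).trans ?_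
      linarith
  have h0 := tele s subset_rfl
  have e1 : ∫ x, f (mixSum v s ∅ x) * g (mixSum u s ∅ x) ∂P
      = ∫ x, f (gaussianSum v s x) * g (gaussianSum u s x) ∂(stdGaussianPi I) := by
    have hmp := measurePreserving_mixEmb (∅ : Finset I)
    have h := integral_map (μ := P) hmp.measurable.aemeasurable
      (f := fun x => f (gaussianSum v s x) * g (gaussianSum u s x))
      ((hf'.continuous.comp_stronglyMeasurable (gaussianSum_stronglyMeasurable v s)).mul
      (hg'.continuous.comp_stronglyMeasurable
        (gaussianSum_stronglyMeasurable u s))).aestronglyMeasurable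
    rw [hmp.map_eq] at h
    exact h.symm
  have e2 : ∫ x, f (mixSum v s ∅ x) * g (mixSum u s s x) ∂P
      = (∫ x, f (gaussianSum v s x) ∂(stdGaussianPi I))
        * ∫ x, g (gaussianSum u s x) ∂(stdGaussianPi I) := by
    rw [← integral_comp_mixSum v s ∅ hf'.continuous, ← integral_comp_mixSum u s s hg'.continuous]
    -- The two sums are rewritten as Gaussian sums over the disjoint copies of `s` inside `I ⊕ I`.
    have hind := gaussianSum_indepFun (fun j : I ⊕ I => Sum.elim v v j)
      (fun j : I ⊕ I => Sum.elim u u j) (t := s.map Function.Embedding.inl)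
      (s := s.map Function.Embedding.inr) (by
        rw [Finset.disjoint_left]
        intro j h1 h2
        simp only [Finset.mem_map, Function.Embedding.inl_apply, Function.Embedding.inr_apply]
          at h1 h2
        obtain ⟨a, -, rfl⟩ := h1
        obtain ⟨b, -, h⟩ := h2
        exact Sum.inr_ne_inl h)
    have k1 : gaussianSum (fun j : I ⊕ I => Sum.elim v v j) (s.map Function.Embedding.inl)
        = mixSum v s ∅ := by
      funext x
      simp [gaussianSum, mixSum, mixEmb]
    have k2 : gaussianSum (fun j : I ⊕ I => Sum.elim u u j) (s.map Function.Embedding.inr)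
        = mixSum u s s := by
      funext x
      simp only [gaussianSum, mixSum, mixEmb, Finset.sum_map]
      refine Finset.sum_congr rfl fun j hj => ?_
      simp [hj]
    rw [k1, k2] at hind
    exact (hind.comp hf'.continuous.measurable
      hg'.continuous.measurable).integral_fun_mul_eq_mul_integral
      (hf'.continuous.comp_stronglyMeasurable
        (mixSum_stronglyMeasurable v s ∅)).aestronglyMeasurable
      (hg'.continuous.comp_stronglyMeasurable
        (mixSum_stronglyMeasurable u s s)).aestronglyMeasurable
  rwa [e1, e2] at h0

end Covariance

/-! ### Infinite Gaussian sums -/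

theorem eLpNorm_two_eq {E Ω : Type*} [NormedAddCommGroup E] [MeasurableSpace Ω] {P : Measure Ω} (f : Ω → E) :
    eLpNorm f 2 P = (∫⁻ x, ENNReal.ofReal (‖f x‖ ^ 2) ∂P) ^ (1 / 2 : ℝ) := by
  rw [eLpNorm_eq_lintegral_rpow_enorm_toReal two_ne_zero ENNReal.ofNat_ne_top]
  simp only [ENNReal.toReal_ofNat]
  congr 1
  refine lintegral_congr fun x => ?_
  rw [← ofReal_norm, ENNReal.ofReal_rpow_of_nonneg (norm_nonneg _) zero_le_two]
  norm_num

section GaussianSeries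

variable {H : Type*} [NormedAddCommGroup H] [NormedSpace ℝ H] [MeasurableSpace H] [BorelSpace H]
  [InnerProductSpaceable H] {I : Type*}

theorem eLpNorm_gaussianSum_le (u : I → H) (t : Finset I) :
    eLpNorm (gaussianSum u t) 2 (stdGaussianPi I)
      ≤ ENNReal.ofReal (2 * (Real.exp ((∑ j ∈ t, ‖u j‖ ^ 2) / 2) - 1)) ^ (1 / 2 : ℝ) := by
  rw [eLpNorm_two_eq]
  exact ENNReal.rpow_le_rpow (lintegral_norm_sq_gaussianSum_le u t) (by norm_num)

theorem memLp_gaussianSum (u : I → H) (t : Finset I) :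
    MemLp (gaussianSum u t) 2 (stdGaussianPi I) :=
  ⟨(gaussianSum_stronglyMeasurable u t).aestronglyMeasurable,
    (eLpNorm_gaussianSum_le u t).trans_lt (ENNReal.rpow_lt_top_of_nonneg (by norm_num)
      ENNReal.ofReal_ne_top)⟩

/-- The class of a finite Gaussian sum in `L²`. -/
noncomputable def gaussianLp (u : I → H) (t : Finset I) : Lp H 2 (stdGaussianPi I) :=
  (memLp_gaussianSum u t).toLp _

theorem sum_gaussianLp_singleton (u : I → H) (t : Finset I) :
    ∑ i ∈ t, gaussianLp u {i} = gaussianLp u t := by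
  classical
  induction t using Finset.induction_on with
  | empty =>
    rw [Finset.sum_empty]
    exact (MemLp.toLp_zero _).symm
  | insert i t hi ih =>
    rw [Finset.sum_insert hi, ih]
    unfold gaussianLp
    rw [← MemLp.toLp_add]
    refine MemLp.toLp_congr _ _ (ae_of_all _ fun x => ?_)
    simp [gaussianSum, Finset.sum_insert hi]

theorem norm_gaussianLp_sq_le (u : I → H) (t : Finset I) :
    ‖gaussianLp u t‖ ^ 2 ≤ 2 * (Real.exp ((∑ j ∈ t, ‖u j‖ ^ 2) / 2) - 1) := by
  have h0 : 0 ≤ 2 * (Real.exp ((∑ j ∈ t, ‖u j‖ ^ 2) / 2) - 1) := by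
    have : 0 ≤ (∑ j ∈ t, ‖u j‖ ^ 2) / 2 := by positivity
    have := Real.one_le_exp this
    linarith
  have h := ENNReal.toReal_mono
    (ENNReal.rpow_lt_top_of_nonneg (by norm_num) ENNReal.ofReal_ne_top).ne (eLpNorm_gaussianSum_le u t)
  have e : ‖gaussianLp u t‖ = (eLpNorm (gaussianSum u t) 2 (stdGaussianPi I)).toReal :=
    Lp.norm_toLp _ _
  rw [← e, ← ENNReal.toReal_rpow, ENNReal.toReal_ofReal h0, ← Real.sqrt_eq_rpow] at h
  exact (Real.le_sqrt (norm_nonneg _) h0).1 h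

/-- The sum `∑ ξ_i u_i` in `L²`. -/
noncomputable def gaussianSeries (u : I → H) : Lp H 2 (stdGaussianPi I) :=
  ∑' i, gaussianLp u {i}

theorem stronglyMeasurable_gaussianSeries (u : I → H) : StronglyMeasurable ⇑(gaussianSeries u) :=
  Lp.stronglyMeasurable _

/-- The law of `∑ ξ_i u_i`. -/
noncomputable def gaussianLaw (u : I → H) : Measure H := (stdGaussianPi I).map (gaussianSeries u)

theorem measurable_gaussianSeries (u : I → H) : Measurable ⇑(gaussianSeries u) :=
  (stronglyMeasurable_gaussianSeries u).measurable

instance (u : I → H) : IsProbabilityMeasure (gaussianLaw u) :=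
  Measure.isProbabilityMeasure_map (measurable_gaussianSeries u).aemeasurable

theorem IsExpLipschitz.integral_gaussianLaw {h : H → ℝ} (hh : IsExpLipschitz h) (u : I → H) :
    ∫ y, h y ∂(gaussianLaw u) = ∫ x, h (gaussianSeries u x) ∂(stdGaussianPi I) :=
  integral_map (measurable_gaussianSeries u).aemeasurable hh.continuous.aestronglyMeasurable

variable [CompleteSpace H]

/-- Cauchy criterion: a block over `t` has squared `L²` norm at most `2 (exp (r/2) - 1)` with `r = ∑
‖u_j‖²` over `t`, which is small when `t` avoids a large finite set. -/
theorem summable_gaussianLp {u : I → H} (hu : Summable fun i => ‖u i‖ ^ 2) :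
    Summable fun i => gaussianLp u {i} := by
  rw [summable_iff_vanishing_norm]
  intro ε hε
  have hlim : Tendsto (fun r : ℝ => 2 * (Real.exp (r / 2) - 1)) (𝓝 0) (𝓝 0) := by
    have : Continuous fun r : ℝ => 2 * (Real.exp (r / 2) - 1) := by fun_prop
    simpa using this.tendsto 0
  obtain ⟨δ, hδ, hball⟩ := Metric.eventually_nhds_iff.1
    (hlim.eventually (gt_mem_nhds (by positivity : 0 < ε ^ 2)))
  obtain ⟨s, hs⟩ := summable_iff_vanishing_norm.1 hu δ hδ
  refine ⟨s, fun t ht => ?_⟩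
  rw [sum_gaussianLp_singleton]
  have h1 := hball (y := ∑ j ∈ t, ‖u j‖ ^ 2) (by simpa [dist_zero_right] using hs t ht)
  have h2 := norm_gaussianLp_sq_le u t
  exact lt_of_pow_lt_pow_left₀ 2 hε.le (h2.trans_lt h1)

theorem hasSum_gaussianSeries {u : I → H} (hu : Summable fun i => ‖u i‖ ^ 2) :
    HasSum (fun i => gaussianLp u {i}) (gaussianSeries u) :=
  (summable_gaussianLp hu).hasSum

theorem tendsto_eLpNorm_gaussianSeries {u : I → H} (hu : Summable fun i => ‖u i‖ ^ 2) :
    Tendsto (fun t => eLpNorm (gaussianSum u t - ⇑(gaussianSeries u)) 2 (stdGaussianPi I))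
      atTop (𝓝 0) := by
  have h := hasSum_gaussianSeries hu
  unfold HasSum at h
  simp only [sum_gaussianLp_singleton] at h
  have h2 := (Lp.tendsto_Lp_iff_tendsto_eLpNorm' _ _).1 h
  refine h2.congr fun t => eLpNorm_congr_ae ?_
  exact (MemLp.coeFn_toLp (memLp_gaussianSum u t)).sub (ae_eq_refl _)

/-- Fatou's lemma along a sequence of finite sets whose partial sums converge almost everywhere.
Countability of `I` makes the filter of finite subsets countably generated, which provides such a
sequence. -/
theorem lintegral_exp_norm_gaussianSeries_le [Countable I] {u : I → H}
    (hu : Summable fun i => ‖u i‖ ^ 2) (c : ℝ) :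
    ∫⁻ x, ENNReal.ofReal (Real.exp (c * ‖gaussianSeries u x‖)) ∂(stdGaussianPi I)
      ≤ ENNReal.ofReal (2 * Real.exp (c ^ 2 * (∑' j, ‖u j‖ ^ 2) / 2)) := by
  obtain ⟨ns, -, hae⟩ := (tendstoInMeasure_of_tendsto_eLpNorm two_ne_zero
    (fun t => (gaussianSum_stronglyMeasurable u t).aestronglyMeasurable)
    (stronglyMeasurable_gaussianSeries u).aestronglyMeasurable
    (tendsto_eLpNorm_gaussianSeries hu)).exists_seq_tendsto_ae'
  have hc : Continuous fun y : H => ENNReal.ofReal (Real.exp (c * ‖y‖)) :=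
    ENNReal.continuous_ofReal.comp (by fun_prop)
  have h1 : ∫⁻ x, ENNReal.ofReal (Real.exp (c * ‖gaussianSeries u x‖)) ∂(stdGaussianPi I)
      = ∫⁻ x, liminf (fun n => ENNReal.ofReal (Real.exp (c * ‖gaussianSum u (ns n) x‖))) atTop
        ∂(stdGaussianPi I) := by
    refine lintegral_congr_ae ?_
    filter_upwards [hae] with x hx
    exact (((hc.tendsto _).comp hx).liminf_eq).symm
  rw [h1]
  refine (lintegral_liminf_le fun n => hc.measurable.comp
    (gaussianSum_measurable u (ns n))).trans ?_
  refine liminf_le_of_le ?_ ?_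
  · exact isBounded_ge_of_bot
  · intro b hb
    obtain ⟨n, hn⟩ := hb.exists
    refine hn.trans ((lintegral_exp_norm_gaussianSum_le u (ns n) c).trans ?_)
    refine ENNReal.ofReal_le_ofReal ?_
    have := hu.sum_le_tsum (ns n) fun i _ => sq_nonneg _
    gcongr

/-- Cauchy–Schwarz separates the distance to the partial sum from the exponential weight; the weight
is bounded in `L²` uniformly in `t`, so `L²` convergence of the sums gives `L¹` convergence of their
images under `h`. -/
theorem lintegral_abs_sub_gaussianSeries_le [Countable I] {u : I → H}
    (hu : Summable fun i => ‖u i‖ ^ 2) {h : H → ℝ} {K c : ℝ} (hK : 0 ≤ K)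
    (hh : ExpLipschitz K c h) (t : Finset I) :
    ∫⁻ x, ‖h (gaussianSum u t x) - h (gaussianSeries u x)‖ₑ ∂(stdGaussianPi I)
      ≤ ENNReal.ofReal K * (eLpNorm (gaussianSum u t - ⇑(gaussianSeries u)) 2 (stdGaussianPi I)
        * ENNReal.ofReal (2 * Real.exp ((4 * c) ^ 2 * (∑' j, ‖u j‖ ^ 2) / 2)) ^ (1 / 2 : ℝ)) := by
  set P := stdGaussianPi I
  set D : (I → ℝ) → ℝ≥0∞ := fun x => ENNReal.ofReal ‖gaussianSum u t x - gaussianSeries u x‖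
  set E : (I → ℝ) → ℝ≥0∞ := fun x =>
    ENNReal.ofReal (Real.exp (c * (‖gaussianSum u t x‖ + ‖gaussianSeries u x‖)))
  have hsm := gaussianSum_stronglyMeasurable u t
  have hsm' := stronglyMeasurable_gaussianSeries u
  have hD : Measurable D := ENNReal.measurable_ofReal.comp (hsm.sub hsm').norm.measurable
  have hE : Measurable E := ENNReal.measurable_ofReal.comp
    (Real.measurable_exp.comp ((hsm.norm.measurable.add hsm'.norm.measurable).const_mul c))
  have hm : ∀ {g : (I → ℝ) → H}, StronglyMeasurable g →
      Measurable fun x => ENNReal.ofReal (Real.exp (4 * c * ‖g x‖)) := fun hg =>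
    ENNReal.measurable_ofReal.comp (Real.measurable_exp.comp (hg.norm.measurable.const_mul _))
  have h1 : ∫⁻ x, ‖h (gaussianSum u t x) - h (gaussianSeries u x)‖ₑ ∂P
      ≤ ENNReal.ofReal K * ∫⁻ x, (D * E) x ∂P := by
    rw [← lintegral_const_mul _ (hD.mul hE)]
    refine lintegral_mono fun x => ?_
    simp only [Pi.mul_apply, D, E]
    rw [← ofReal_norm, ← ENNReal.ofReal_mul (norm_nonneg _), ← ENNReal.ofReal_mul hK, ← mul_assoc]
    exact ENNReal.ofReal_le_ofReal (hh _ _)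
  refine h1.trans (mul_le_mul_right ?_ _)
  refine (ENNReal.lintegral_mul_le_Lp_mul_Lq P Real.HolderConjugate.two_two hD.aemeasurable
    hE.aemeasurable).trans ?_
  refine mul_le_mul' (le_of_eq ?_) (ENNReal.rpow_le_rpow ?_ (by norm_num))
  · rw [eLpNorm_two_eq]
    congr 1
    refine lintegral_congr fun x => ?_
    simp only [D]
    rw [ENNReal.ofReal_rpow_of_nonneg (norm_nonneg _) zero_le_two]
    norm_num
  · have h2 : ∀ x, E x ^ (2 : ℝ) ≤ ENNReal.ofReal (1 / 2) *
        (ENNReal.ofReal (Real.exp (4 * c * ‖gaussianSum u t x‖))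
          + ENNReal.ofReal (Real.exp (4 * c * ‖gaussianSeries u x‖))) := by
      intro x
      simp only [E]
      rw [ENNReal.ofReal_rpow_of_nonneg (Real.exp_pos _).le zero_le_two,
        ← ENNReal.ofReal_add (Real.exp_pos _).le (Real.exp_pos _).le,
        ← ENNReal.ofReal_mul (by norm_num)]
      refine ENNReal.ofReal_le_ofReal ?_
      rw [← Real.exp_mul]
      have := exp_add_le_half (2 * c * ‖gaussianSum u t x‖) (2 * c * ‖gaussianSeries u x‖)
      ring_nf at this ⊢
      exact this
    refine (lintegral_mono h2).trans ?_
    rw [lintegral_const_mul' _ _ ENNReal.ofReal_ne_top, lintegral_add_left (hm hsm)]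
    have h3 := lintegral_exp_norm_gaussianSum_le u t (4 * c)
    have h4 := lintegral_exp_norm_gaussianSeries_le hu (4 * c)
    have h5 : ENNReal.ofReal (2 * Real.exp ((4 * c) ^ 2 * (∑ j ∈ t, ‖u j‖ ^ 2) / 2))
        ≤ ENNReal.ofReal (2 * Real.exp ((4 * c) ^ 2 * (∑' j, ‖u j‖ ^ 2) / 2)) := by
      refine ENNReal.ofReal_le_ofReal ?_
      have := hu.sum_le_tsum t fun i _ => sq_nonneg _
      gcongr
    refine (mul_le_mul_right (add_le_add (h3.trans h5) h4) _).trans (le_of_eq ?_)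
    rw [← ENNReal.ofReal_add (by positivity) (by positivity), ← ENNReal.ofReal_mul (by norm_num)]
    congr 1
    ring

theorem IsExpLipschitz.tendsto_lintegral_gaussianSeries [Countable I] {u : I → H}
    (hu : Summable fun i => ‖u i‖ ^ 2) {h : H → ℝ} (hh : IsExpLipschitz h) :
    Tendsto (fun t => ∫⁻ x, ‖h (gaussianSum u t x) - h (gaussianSeries u x)‖ₑ ∂(stdGaussianPi I))
      atTop (𝓝 0) := by
  obtain ⟨K, c, hK, hc, hh⟩ := hh
  have h1 := tendsto_eLpNorm_gaussianSeries hu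
  have h2 := ENNReal.Tendsto.mul_const (b := ENNReal.ofReal (2 * Real.exp ((4 * c) ^ 2 *
    (∑' j, ‖u j‖ ^ 2) / 2)) ^ (1 / 2 : ℝ)) h1
    (Or.inr (ENNReal.rpow_lt_top_of_nonneg (by norm_num) ENNReal.ofReal_ne_top).ne)
  have h3 := ENNReal.Tendsto.const_mul (a := ENNReal.ofReal K) h2 (Or.inr ENNReal.ofReal_ne_top)
  rw [zero_mul, mul_zero] at h3
  exact tendsto_of_tendsto_of_tendsto_of_le_of_le tendsto_const_nhds h3 (fun _ => zero_le)
    fun t => lintegral_abs_sub_gaussianSeries_le hu hK hh t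

theorem IsExpLipschitz.integrable_gaussianSeries [Countable I] {u : I → H}
    (hu : Summable fun i => ‖u i‖ ^ 2) {h : H → ℝ} (hh : IsExpLipschitz h) :
    Integrable (fun x => h (gaussianSeries u x)) (stdGaussianPi I) := by
  have hm := hh.continuous.comp_stronglyMeasurable (stronglyMeasurable_gaussianSeries u)
  obtain ⟨K, c, hK, hc, hh⟩ := hh
  have hi : Integrable (fun x => Real.exp ((c + 1) * ‖gaussianSeries u x‖)) (stdGaussianPi I) := by
    refine ⟨(Real.continuous_exp.comp_stronglyMeasurable
      ((stronglyMeasurable_gaussianSeries u).norm.const_mul (c + 1))).aestronglyMeasurable, ?_⟩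
    rw [hasFiniteIntegral_iff_ofReal (ae_of_all _ fun x => (Real.exp_pos _).le)]
    exact (lintegral_exp_norm_gaussianSeries_le hu _).trans_lt ENNReal.ofReal_lt_top
  exact (hi.const_mul (|h 0| + K)).mono' hm.aestronglyMeasurable
    (ae_of_all _ fun x => hh.abs_le hK hc _)

theorem IsExpLipschitz.tendsto_integral_gaussianSeries [Countable I] {u : I → H}
    (hu : Summable fun i => ‖u i‖ ^ 2) {h : H → ℝ} (hh : IsExpLipschitz h) :
    Tendsto (fun t => ∫ x, h (gaussianSum u t x) ∂(stdGaussianPi I)) atTop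
      (𝓝 (∫ x, h (gaussianSeries u x) ∂(stdGaussianPi I))) :=
  tendsto_integral_of_L1 _ (hh.integrable_gaussianSeries hu).aestronglyMeasurable
    (Eventually.of_forall fun t => hh.integrable_gaussianSum u t)
    (hh.tendsto_lintegral_gaussianSeries hu)

theorem IsExpLipschitz.integrable_gaussianLaw [Countable I] {h : H → ℝ} (hh : IsExpLipschitz h)
    {u : I → H} (hu : Summable fun i => ‖u i‖ ^ 2) : Integrable h (gaussianLaw u) :=
  (integrable_map_measure hh.continuous.aestronglyMeasurable
    (measurable_gaussianSeries u).aemeasurable).2 (hh.integrable_gaussianSeries hu)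

theorem IsExpLipschitz.memLp_gaussianLaw [Countable I] {h : H → ℝ} (hh : IsExpLipschitz h)
    {u : I → H} (hu : Summable fun i => ‖u i‖ ^ 2) : MemLp h 2 (gaussianLaw u) := by
  rw [memLp_two_iff_integrable_sq hh.continuous.aestronglyMeasurable]
  simp only [sq]
  exact (hh.mul hh).integrable_gaussianLaw hu

/-- The covariance of `f ∘ T` and `g` under the law of `∑ ξ_i u_i`. -/
theorem abs_covariance_gaussianLaw_le [Countable I] {u : I → H}
    (hu : Summable fun i => ‖u i‖ ^ 2) (T : H →L[ℝ] H) {M : ℝ}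
    (hTu : Summable fun i => ‖T (u i)‖ ^ 2) (hM : ∑' i, ‖u i‖ ^ 2 ≤ M)
    (hTM : ∑' i, ‖T (u i)‖ ^ 2 ≤ M) (hsum : Summable fun i => ‖T (u i)‖ * ‖u i‖)
    {f g : H → ℝ} {K c : ℝ} (hK : 0 ≤ K) (hc : 0 ≤ c)
    (hf : ExpLipschitz K c f) (hg : ExpLipschitz K c g) :
    |∫ y, f (T y) * g y ∂(gaussianLaw u) - (∫ y, f (T y) ∂(gaussianLaw u))
      * ∫ y, g y ∂(gaussianLaw u)| ≤ covConst K c M * ∑' i, ‖T (u i)‖ * ‖u i‖ := by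
  have hf' : IsExpLipschitz f := ⟨K, c, hK, hc, hf⟩
  have hg' : IsExpLipschitz g := ⟨K, c, hK, hc, hg⟩
  have hfT := hf'.comp_clm T
  rw [(hfT.mul hg').integral_gaussianLaw, hfT.integral_gaussianLaw, hg'.integral_gaussianLaw]
  have l1 := (hfT.mul hg').tendsto_integral_gaussianSeries hu
  have l2 := hfT.tendsto_integral_gaussianSeries hu
  have l3 := hg'.tendsto_integral_gaussianSeries hu
  refine le_of_tendsto ((l1.sub (l2.mul l3)).abs) (Eventually.of_forall fun t => ?_)
  -- The operator is absorbed into the family and not into `f`: the constants `K` and `c` stay those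
  -- of `f`, whatever the norm of `T`. This matters when `T` is replaced by its powers.
  have e : ∀ x, T (gaussianSum u t x) = gaussianSum (fun i => T (u i)) t x := by
    intro x
    simp [gaussianSum, map_sum]
  simp only [e]
  have hcv : 0 ≤ covConst K c M := by unfold covConst; positivity
  refine (abs_covariance_gaussianSum_le hK hc hf hg u _
    ((hu.sum_le_tsum t fun i _ => sq_nonneg _).trans hM)
    ((hTu.sum_le_tsum t fun i _ => sq_nonneg _).trans hTM)).trans ?_
  exact mul_le_mul_of_nonneg_left (hsum.sum_le_tsum t fun i _ => by positivity) hcv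

/-- Formally `T (∑ ξ_i u_i) = ∑ ξ_i u_(σ i) = ∑ ξ_(σ⁻¹ i) u_i`, and the relabelled variables have
the same joint law. The identity is proved in `L²`, where both sides are convergent sums. -/
theorem measurePreserving_gaussianLaw {u : I → H} (hu : Summable fun i => ‖u i‖ ^ 2)
    (T : H →L[ℝ] H) (σ : Equiv.Perm I) (hT : ∀ i, T (u i) = u (σ i)) :
    MeasurePreserving T (gaussianLaw u) (gaussianLaw u) := by
  have hS : MeasurePreserving (fun (x : I → ℝ) i => x (σ.symm i)) (stdGaussianPi I)
      (stdGaussianPi I) := stdGaussianPi_measurePreserving_comp σ.symm.injective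
  have h1 : HasSum (fun i => Lp.compMeasurePreserving _ hS (gaussianLp u {i}))
      (Lp.compMeasurePreserving _ hS (gaussianSeries u)) :=
    (hasSum_gaussianSeries hu).map (Lp.compMeasurePreserving _ hS)
      (Lp.isometry_compMeasurePreserving hS).continuous
  have h2 : HasSum (fun i => T.compLp (gaussianLp u {i})) (T.compLp (gaussianSeries u)) :=
    (hasSum_gaussianSeries hu).mapL (T.compLpL 2 (stdGaussianPi I))
  have h3 : ∀ i, Lp.compMeasurePreserving _ hS (gaussianLp u {σ i})
      = T.compLp (gaussianLp u {i}) := by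
    intro i
    refine Lp.ext ?_
    refine (Lp.coeFn_compMeasurePreserving _ hS).trans ?_
    refine ((hS.quasiMeasurePreserving.ae_eq_comp
      (MemLp.coeFn_toLp (memLp_gaussianSum u {σ i})))).trans ?_
    refine EventuallyEq.trans ?_ (T.coeFn_compLp' _).symm
    filter_upwards [MemLp.coeFn_toLp (memLp_gaussianSum u {i})] with x hx
    unfold gaussianLp
    rw [hx]
    simp [gaussianSum, hT]
  have h4 := (Equiv.hasSum_iff σ).2 h1
  simp only [Function.comp_def, h3] at h4
  have h5 := h4.unique h2
  have h6 : gaussianSeries u ∘ (fun (x : I → ℝ) i => x (σ.symm i))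
      =ᵐ[stdGaussianPi I] fun x => T (gaussianSeries u x) := by
    refine (Lp.coeFn_compMeasurePreserving _ hS).symm.trans ?_
    rw [h5]
    exact T.coeFn_compLp' _
  have hTm : Measurable T := T.continuous.measurable
  refine ⟨hTm, ?_⟩
  unfold gaussianLaw
  rw [Measure.map_map hTm (measurable_gaussianSeries u)]
  rw [show ⇑T ∘ ⇑(gaussianSeries u) = fun x => T (gaussianSeries u x) from rfl,
    ← Measure.map_congr h6, ← Measure.map_map (measurable_gaussianSeries u) hS.measurable,
    hS.map_eq]

end GaussianSeries

/-! ### Strong mixing from decay of correlations of Lipschitz functions -/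

section Mixing

variable {X : Type*} [PseudoEMetricSpace X] [MeasurableSpace X] [BorelSpace X]

/-- Inner regularity gives a closed `F ⊆ A` of almost the same measure, and the thickened indicators
of `F` are Lipschitz with integrals tending to `μ F`. Each of the two comparisons with the indicator
of `F` costs `ε / 2`. -/
theorem exists_lipschitz_approx_indicator (μ : Measure X) [IsProbabilityMeasure μ] {A : Set X}
    (hA : MeasurableSet A) {ε : ℝ} (hε : 0 < ε) :
    ∃ f : X → ℝ, (∃ K, LipschitzWith K f) ∧ (∀ x, 0 ≤ f x) ∧ (∀ x, f x ≤ 1) ∧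
      ∫ x, |A.indicator 1 x - f x| ∂μ ≤ ε := by
  obtain ⟨F, hFA, hF, hμ⟩ := hA.exists_isClosed_lt_add (measure_ne_top μ A)
    (ε := ENNReal.ofReal (ε / 2)) (by simpa using hε)
  have hδ : ∀ n : ℕ, (0 : ℝ) < 1 / (n + 1) := fun n => Nat.one_div_pos_of_nat
  have hlim := tendsto_lintegral_thickenedIndicator_of_isClosed μ hF hδ
    tendsto_one_div_add_atTop_nhds_zero_nat
  have hlt : μ F < μ F + ENNReal.ofReal (ε / 2) :=
    ENNReal.lt_add_right (measure_ne_top _ _) (by simpa using hε)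
  obtain ⟨n, hn⟩ := (hlim.eventually (gt_mem_nhds hlt)).exists
  set f : X → ℝ := fun x => (thickenedIndicator (hδ n) F x : ℝ)
  have hL := lipschitzWith_thickenedIndicator (hδ n) F
  have hfL : LipschitzWith (1 / (n + 1) : ℝ).toNNReal⁻¹ f := hL
  have hf1 : ∀ x, f x ≤ 1 := fun x => by
    exact NNReal.coe_le_one.2 (thickenedIndicator_le_one (hδ n) F x)
  have hf0 : ∀ x, 0 ≤ f x := fun x => NNReal.coe_nonneg _
  have hfF : ∀ x, F.indicator 1 x ≤ f x := by
    intro x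
    by_cases hx : x ∈ F
    · simp only [Set.indicator_of_mem hx, Pi.one_apply, f]
      rw [thickenedIndicator_one _ _ hx]
      simp
    · simpa [hx] using hf0 x
  have hAF : ∀ x, F.indicator (1 : X → ℝ) x ≤ A.indicator 1 x := fun x =>
    Set.indicator_le_indicator_of_subset hFA (fun _ => zero_le_one) x
  have hfi : Integrable f μ := by
    refine Integrable.of_bound hfL.continuous.aestronglyMeasurable 1 (ae_of_all _ fun x => ?_)
    rw [Real.norm_eq_abs, abs_of_nonneg (hf0 x)]
    exact hf1 x
  have hIi : ∀ {B : Set X}, MeasurableSet B → Integrable (B.indicator (1 : X → ℝ)) μ :=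
    fun hB => (integrable_indicator_iff hB).2 (integrable_const (1 : ℝ)).integrableOn
  refine ⟨f, ⟨_, hfL⟩, hf0, hf1, ?_⟩
  have hfint : ∫ x, f x ∂μ ≤ μ.real F + ε / 2 := by
    have h1 : ENNReal.ofReal (∫ x, f x ∂μ) = ∫⁻ x, thickenedIndicator (hδ n) F x ∂μ := by
      rw [ofReal_integral_eq_lintegral_ofReal hfi (ae_of_all _ hf0)]
      simp [f]
    rw [← h1] at hn
    have h2 := ENNReal.toReal_mono (by simp) hn.le
    rw [ENNReal.toReal_ofReal (integral_nonneg hf0), ENNReal.toReal_add (by simp) (by simp),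
      ENNReal.toReal_ofReal (by positivity)] at h2
    exact h2
  have hAint : μ.real A ≤ μ.real F + ε / 2 := by
    have h2 := ENNReal.toReal_mono (by simp) hμ.le
    rwa [ENNReal.toReal_add (by simp) (by simp), ENNReal.toReal_ofReal (by positivity)] at h2
  have hpt : ∀ x, |A.indicator 1 x - f x| ≤
      (A.indicator 1 x - F.indicator 1 x) + (f x - F.indicator 1 x) := by
    intro x
    have h1 := hAF x
    have h2 := hfF x
    rw [abs_le]
    constructor <;> linarith
  have hi1 : Integrable (fun x => A.indicator (1 : X → ℝ) x - F.indicator 1 x) μ :=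
    (hIi hA).sub (hIi hF.measurableSet)
  have hi2 : Integrable (fun x => f x - F.indicator 1 x) μ := hfi.sub (hIi hF.measurableSet)
  refine (integral_mono ((hIi hA).sub hfi).abs (hi1.add hi2) hpt).trans ?_
  have e := integral_add hi1 hi2
  have e1 := integral_sub (hIi hA) (hIi hF.measurableSet)
  have e2 := integral_sub hfi (hIi hF.measurableSet)
  rw [integral_indicator_one hA, integral_indicator_one hF.measurableSet] at e1
  rw [integral_indicator_one hF.measurableSet] at e2
  refine e.le.trans ?_
  rw [e1, e2]
  linarith

/-- Indicators are replaced by Lipschitz functions in `L¹`; invariance of `μ` makes the error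
uniform in `n`. -/
theorem stronglyMixing_of_lipschitz {T : X → X} {μ : Measure X} [IsProbabilityMeasure μ]
    (hT : MeasurePreserving T μ μ)
    (h : ∀ f g : X → ℝ, (∃ K, LipschitzWith K f) → (∃ K, LipschitzWith K g) →
      (∀ x, 0 ≤ f x) → (∀ x, f x ≤ 1) → (∀ x, 0 ≤ g x) → (∀ x, g x ≤ 1) →
      Tendsto (fun n => ∫ x, f (T^[n] x) * g x ∂μ) atTop (𝓝 ((∫ x, f x ∂μ) * ∫ x, g x ∂μ))) :
    StronglyMixing T μ := by
  intro A B hA hB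
  rw [← ENNReal.tendsto_toReal_iff (fun n => measure_ne_top _ _)
    (ENNReal.mul_ne_top (measure_ne_top _ _) (measure_ne_top _ _)), ENNReal.toReal_mul]
  change Tendsto (fun n => μ.real (A ∩ T^[n] ⁻¹' B)) atTop (𝓝 (μ.real A * μ.real B))
  rw [Metric.tendsto_atTop]
  intro ε hε
  obtain ⟨g, hgL, hg0, hg1, hgA⟩ := exists_lipschitz_approx_indicator μ hA
    (by positivity : 0 < ε / 8)
  obtain ⟨f, hfL, hf0, hf1, hfB⟩ := exists_lipschitz_approx_indicator μ hB
    (by positivity : 0 < ε / 8)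
  -- Three comparisons of `ε / 4` each: the correlations of sets and functions, the limit for
  -- functions, and the products of means.
  obtain ⟨N, hN⟩ := Metric.tendsto_atTop.1 (h f g hfL hgL hf0 hf1 hg0 hg1) (ε / 4) (by positivity)
  refine ⟨N, fun n hn => ?_⟩
  have hTn := hT.iterate n
  have hbd : ∀ {f : X → ℝ}, (∃ K, LipschitzWith K f) → (∀ x, 0 ≤ f x) → (∀ x, f x ≤ 1) →
      Integrable f μ := by
    intro f ⟨K, hK⟩ h0 h1
    refine Integrable.of_bound hK.continuous.aestronglyMeasurable 1 (ae_of_all _ fun x => ?_)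
    rw [Real.norm_eq_abs, abs_of_nonneg (h0 x)]
    exact h1 x
  have hfi := hbd hfL hf0 hf1
  have hgi := hbd hgL hg0 hg1
  have hIi : ∀ {B : Set X}, MeasurableSet B → Integrable (B.indicator (1 : X → ℝ)) μ :=
    fun hB => (integrable_indicator_iff hB).2 (integrable_const (1 : ℝ)).integrableOn
  have hI0 : ∀ (B : Set X) (x : X), 0 ≤ B.indicator (1 : X → ℝ) x := fun B x =>
    Set.indicator_nonneg (fun _ _ => zero_le_one) x
  have hI1 : ∀ (B : Set X) (x : X), B.indicator (1 : X → ℝ) x ≤ 1 := fun B x =>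
    Set.indicator_le_self' (fun _ _ => zero_le_one) x
  have hgAi : Integrable (fun x => |A.indicator 1 x - g x|) μ := ((hIi hA).sub hgi).abs
  have hfBi : Integrable (fun x => |B.indicator 1 x - f x|) μ := ((hIi hB).sub hfi).abs
  have hfBTi : Integrable (fun x => |B.indicator 1 (T^[n] x) - f (T^[n] x)|) μ :=
    hTn.integrable_comp_of_integrable hfBi
  have hfBT : ∫ x, |B.indicator 1 (T^[n] x) - f (T^[n] x)| ∂μ ≤ ε / 8 := by
    have h1 := integral_map (μ := μ) hTn.measurable.aemeasurable
      (f := fun x => |B.indicator 1 x - f x|) (by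
        rw [hTn.map_eq]; exact hfBi.aestronglyMeasurable)
    rw [hTn.map_eq] at h1
    rw [← h1]
    exact hfB
  have hAB : μ.real (A ∩ T^[n] ⁻¹' B)
      = ∫ x, B.indicator 1 (T^[n] x) * A.indicator (1 : X → ℝ) x ∂μ := by
    rw [← integral_indicator_one (hA.inter (hTn.measurable hB))]
    congr 1
    funext x
    by_cases hx : x ∈ A <;> by_cases hx' : T^[n] x ∈ B <;> simp [Set.indicator, hx, hx']
  have hi1 : Integrable (fun x => B.indicator 1 (T^[n] x) * A.indicator (1 : X → ℝ) x) μ := by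
    have : (fun x => B.indicator 1 (T^[n] x) * A.indicator (1 : X → ℝ) x)
        = (A ∩ T^[n] ⁻¹' B).indicator 1 := by
      funext x
      by_cases hx : x ∈ A <;> by_cases hx' : T^[n] x ∈ B <;> simp [Set.indicator, hx, hx']
    rw [this]
    exact hIi (hA.inter (hTn.measurable hB))
  have hi2 : Integrable (fun x => f (T^[n] x) * g x) μ := by
    refine hgi.mono' ((hTn.integrable_comp_of_integrable hfi).aestronglyMeasurable.mul
      hgi.aestronglyMeasurable) (ae_of_all _ fun x => ?_)
    rw [norm_mul, Real.norm_eq_abs, Real.norm_eq_abs, abs_of_nonneg (hf0 _), abs_of_nonneg (hg0 _)]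
    exact mul_le_of_le_one_left (hg0 _) (hf1 _)
  have h1 : |μ.real (A ∩ T^[n] ⁻¹' B) - ∫ x, f (T^[n] x) * g x ∂μ| ≤ ε / 8 + ε / 8 := by
    rw [hAB, ← integral_sub hi1 hi2, ← Real.norm_eq_abs]
    refine (norm_integral_le_of_norm_le (hfBTi.add hgAi) (ae_of_all _ fun x => ?_)).trans ?_
    · have e : B.indicator 1 (T^[n] x) * A.indicator (1 : X → ℝ) x - f (T^[n] x) * g x
          = (B.indicator 1 (T^[n] x) - f (T^[n] x)) * A.indicator 1 x
            + f (T^[n] x) * (A.indicator 1 x - g x) := by ring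
      rw [e, Real.norm_eq_abs]
      refine (abs_add_le _ _).trans (add_le_add ?_ ?_)
      · rw [abs_mul, abs_of_nonneg (hI0 A x)]
        exact mul_le_of_le_one_right (abs_nonneg _) (hI1 A x)
      · rw [abs_mul, abs_of_nonneg (hf0 _)]
        exact mul_le_of_le_one_left (abs_nonneg _) (hf1 _)
    · exact (integral_add hfBTi hgAi).le.trans (add_le_add hfBT hgA)
  have h2 : |μ.real A - ∫ x, g x ∂μ| ≤ ε / 8 := by
    rw [← integral_indicator_one hA, ← integral_sub (hIi hA) hgi]
    exact (abs_integral_le_integral_abs).trans hgA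
  have h3 : |μ.real B - ∫ x, f x ∂μ| ≤ ε / 8 := by
    rw [← integral_indicator_one hB, ← integral_sub (hIi hB) hfi]
    exact (abs_integral_le_integral_abs).trans hfB
  have h4 : |μ.real A * μ.real B - (∫ x, f x ∂μ) * ∫ x, g x ∂μ| ≤ ε / 8 + ε / 8 := by
    have e : μ.real A * μ.real B - (∫ x, f x ∂μ) * ∫ x, g x ∂μ
        = μ.real A * (μ.real B - ∫ x, f x ∂μ) + (∫ x, f x ∂μ) * (μ.real A - ∫ x, g x ∂μ) := by ring
    have hfi0 : 0 ≤ ∫ x, f x ∂μ := integral_nonneg hf0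
    have hfi1 : ∫ x, f x ∂μ ≤ 1 := by
      have := integral_mono hfi (integrable_const (1 : ℝ)) hf1
      simpa using this
    rw [e]
    refine (abs_add_le _ _).trans (add_le_add ?_ ?_)
    · rw [abs_mul, abs_of_nonneg measureReal_nonneg]
      exact (mul_le_of_le_one_left (abs_nonneg _) measureReal_le_one).trans h3
    · rw [abs_mul, abs_of_nonneg hfi0]
      exact (mul_le_of_le_one_left (abs_nonneg _) hfi1).trans h2
  have h5 := hN n hn
  rw [Real.dist_eq] at h5 ⊢
  rw [abs_lt] at h5 ⊢
  rw [abs_le] at h1 h4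
  constructor <;> linarith [h1.1, h1.2, h4.1, h4.2, h5.1, h5.2]

end Mixing

/-! ### Full support -/

instance isOpenPosMeasure_stdGaussianPi (J : Type*) : (stdGaussianPi J).IsOpenPosMeasure := by
  refine ⟨fun U hU ⟨c, hc⟩ => ?_⟩
  obtain ⟨s, o, ho, hsub⟩ := isOpen_pi_iff.1 hU c hc
  have : (ProbabilityTheory.gaussianReal 0 1).IsOpenPosMeasure :=
    (ProbabilityTheory.gaussianReal_absolutelyContinuous' 0 one_ne_zero).isOpenPosMeasure
  have hpos : stdGaussianPi J ((s : Set J).pi fun i => interior (o i)) ≠ 0 := by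
    unfold stdGaussianPi
    rw [Measure.infinitePi_pi _ fun i _ => isOpen_interior.measurableSet]
    refine Finset.prod_ne_zero_iff.2 fun i hi => ?_
    refine isOpen_interior.measure_ne_zero _ ⟨c i, ?_⟩
    rw [(ho i hi).1.interior_eq]
    exact (ho i hi).2
  intro h0
  refine hpos (measure_mono_null (fun x hx => hsub fun i hi => ?_) h0)
  exact interior_subset (hx i hi)

theorem continuous_gaussianSum {H I : Type*} [NormedAddCommGroup H] [NormedSpace ℝ H] (u : I → H)
    (t : Finset I) : Continuous (gaussianSum u t) := by
  unfold gaussianSum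
  fun_prop

section Support

variable {H : Type*} [NormedAddCommGroup H] [NormedSpace ℝ H] [MeasurableSpace H] [BorelSpace H]
  [InnerProductSpaceable H] {I : Type*} [CompleteSpace H]

/-- Take a finite combination `y` of the family in the open set. The sum over a finite `s'` is close
to `y` with positive probability, and the block over `t \ s'`, independent of it, is small with
probability at least `1/2`. For large `t` the remaining error is too rarely large to destroy the
intersection of these events. -/
theorem isOpenPosMeasure_gaussianLaw {u : I → H} (hu : Summable fun i => ‖u i‖ ^ 2)
    (hd : Dense (Submodule.span ℝ (Set.range u) : Set H)) : (gaussianLaw u).IsOpenPosMeasure := by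
  classical
  refine ⟨fun U hU hne h0 => ?_⟩
  set P := stdGaussianPi I
  set X := gaussianSeries u
  obtain ⟨y, hyU, hy⟩ := hd.inter_open_nonempty U hU hne
  obtain ⟨ε, hε, hball⟩ := Metric.isOpen_iff.1 hU y hyU
  obtain ⟨c, hc⟩ := (Finsupp.mem_span_range_iff_exists_finsupp).1 hy
  have hmeas := tendstoInMeasure_of_tendsto_eLpNorm two_ne_zero
    (fun t => (gaussianSum_stronglyMeasurable u t).aestronglyMeasurable)
    (stronglyMeasurable_gaussianSeries u).aestronglyMeasurable (tendsto_eLpNorm_gaussianSeries hu)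
  have hsmall : ∀ δ : ℝ≥0∞, 0 < δ →
      ∀ᶠ t in atTop, P {x | ε / 6 ≤ ‖gaussianSum u t x - X x‖} < δ := by
    intro δ hδ
    have h := (tendstoInMeasure_iff_norm.1 hmeas) (ε / 6) (by positivity)
    exact h.eventually (gt_mem_nhds hδ)
  -- The block over `t \ s'` is a difference of two errors, each large with probability below `1/4`.
  -- This choice does not involve `t`, so `t` can later be taken large depending on `P A`.
  obtain ⟨s, hs⟩ := eventually_atTop.1 (hsmall 4⁻¹ (by simp))
  set s' := s ∪ c.support
  have hyc : gaussianSum u s' c = y := by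
    rw [← hc, gaussianSum, Finsupp.sum]
    refine (Finset.sum_subset Finset.subset_union_right fun i _ hi => ?_).symm
    rw [Finsupp.notMem_support_iff.1 hi, zero_smul]
  set A : Set (I → ℝ) := gaussianSum u s' ⁻¹' Metric.ball y (ε / 3)
  have hA : P A ≠ 0 := (Metric.isOpen_ball.preimage (continuous_gaussianSum u s')).measure_ne_zero _
    ⟨c, by simp [hyc, hε]⟩
  have hA2 : P A / 2 ≠ 0 := by simpa using hA
  obtain ⟨t0, ht0⟩ := eventually_atTop.1 (hsmall (P A / 2) (pos_iff_ne_zero.2 hA2))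
  set t := t0 ∪ s'
  have hst : s' ⊆ t := Finset.subset_union_right
  have htd : ∀ x, gaussianSum u t x = gaussianSum u s' x + gaussianSum u (t \ s') x := by
    intro x
    rw [add_comm]
    exact (Finset.sum_sdiff hst).symm
  set B : Set (I → ℝ) := gaussianSum u (t \ s') ⁻¹' Metric.ball 0 (ε / 3)
  have hBc : P Bᶜ ≤ 2⁻¹ := by
    have hsub : Bᶜ ⊆ {x | ε / 6 ≤ ‖gaussianSum u t x - X x‖} ∪
        {x | ε / 6 ≤ ‖gaussianSum u s' x - X x‖} := by
      intro x hx
      by_contra hcon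
      simp only [Set.mem_union, Set.mem_ofPred_eq, not_or, not_le] at hcon
      refine hx ?_
      simp only [B, Set.mem_preimage, mem_ball_zero_iff]
      have e : gaussianSum u (t \ s') x
          = (gaussianSum u t x - X x) - (gaussianSum u s' x - X x) := by rw [htd]; abel
      rw [e]
      refine (norm_sub_le _ _).trans_lt ?_
      linarith [hcon.1, hcon.2]
    refine (measure_mono hsub).trans ((measure_union_le _ _).trans ?_)
    have h1 := (hs t (Finset.subset_union_left.trans hst)).le
    have h2 := (hs s' Finset.subset_union_left).le
    refine (add_le_add h1 h2).trans (le_of_eq ?_)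
    rw [← two_mul, show (4 : ℝ≥0∞) = 2 * 2 by norm_num, ENNReal.mul_inv (by simp) (by simp),
      ← mul_assoc, ENNReal.mul_inv_cancel (by simp) (by simp), one_mul]
  have hBm : MeasurableSet B := (gaussianSum_measurable u _) Metric.isOpen_ball.measurableSet
  have hB : 2⁻¹ ≤ P B := by
    have h1 := prob_add_prob_compl (μ := P) hBm
    have h2 : 1 ≤ P B + 2⁻¹ := h1 ▸ (add_le_add_right hBc _)
    have h3 : (1 : ℝ≥0∞) - 2⁻¹ ≤ P B := tsub_le_iff_right.2 h2
    rwa [ENNReal.one_sub_inv_two] at h3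
  have hAB : P (A ∩ B) = P A * P B :=
    (gaussianSum_indepFun u u (Finset.disjoint_sdiff (s := s') (t := t))).measure_inter_preimage_eq_mul
      _ _ Metric.isOpen_ball.measurableSet Metric.isOpen_ball.measurableSet
  have hXU : P (X ⁻¹' U) = 0 := by
    rw [gaussianLaw, Measure.map_apply (measurable_gaussianSeries u) hU.measurableSet] at h0
    exact h0
  have hsub : A ∩ B ⊆ X ⁻¹' U ∪ {x | ε / 6 ≤ ‖gaussianSum u t x - X x‖} := by
    rintro x ⟨hxA, hxB⟩
    by_contra hcon
    simp only [Set.mem_union, Set.mem_ofPred_eq, not_or, not_le] at hcon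
    refine hcon.1 (hball ?_)
    simp only [A, B, Set.mem_preimage, mem_ball_iff_norm, sub_zero] at hxA hxB ⊢
    have e : X x - y = (gaussianSum u s' x - y) + gaussianSum u (t \ s') x
        - (gaussianSum u t x - X x) := by rw [htd]; abel
    rw [e]
    refine (norm_sub_le _ _).trans_lt ?_
    have := norm_add_le (gaussianSum u s' x - y) (gaussianSum u (t \ s') x)
    linarith [hcon.2]
  have h1 : P A / 2 ≤ P (A ∩ B) := by
    rw [hAB, ENNReal.div_eq_inv_mul, mul_comm]
    exact mul_le_mul_right hB _
  have h2 := h1.trans ((measure_mono hsub).trans (measure_union_le _ _))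
  rw [hXU, zero_add] at h2
  exact absurd (ht0 t Finset.subset_union_left) (not_lt.2 h2)

end Support

/-! ### Mixing Gaussian measures for operators shifting a sequence of vectors -/

/-- Since `T^n` permutes the family, `∑ ‖T^n u_i‖²` does not depend on `n`, and the covariance
inequality holds with one constant for all `n`. It yields the rate directly, and mixing when applied
to bounded Lipschitz functions. -/
theorem exists_mixing_measure {H : Type*} [NormedAddCommGroup H] [NormedSpace ℝ H]
    [MeasurableSpace H] [BorelSpace H] [InnerProductSpaceable H] [CompleteSpace H]
    {I : Type*} [Countable I] {u : I → H} (hu : Summable fun i => ‖u i‖ ^ 2)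
    (hd : Dense (Submodule.span ℝ (Set.range u) : Set H)) (T : H →L[ℝ] H) (σ : Equiv.Perm I)
    (hT : ∀ i, T (u i) = u (σ i))
    (h0 : Tendsto (fun n : ℕ => ∑' i, ‖u ((σ ^ n) i)‖ * ‖u i‖) atTop (𝓝 0)) :
    ∃ μ : Measure H, IsProbabilityMeasure μ ∧ MeasurePreserving T μ μ ∧ StronglyMixing T μ ∧
      μ.IsOpenPosMeasure ∧ (∀ f, IsExpLipschitz f → MemLp f 2 μ) ∧
      ∀ f g, IsExpLipschitz f → IsExpLipschitz g →
        (fun n : ℕ => ProbabilityTheory.covariance (f ∘ T^[n]) g μ) =O[atTop]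
          fun n : ℕ => ∑' i, ‖u ((σ ^ n) i)‖ * ‖u i‖ := by
  have hTp := measurePreserving_gaussianLaw hu T σ hT
  have hiter : ∀ n : ℕ, ⇑(T ^ n) = T^[n] := FunLike.coe_pow_eq_iterate T
  have hTn : ∀ (n : ℕ) (i : I), (T ^ n) (u i) = u ((σ ^ n) i) := by
    intro n
    induction n with
    | zero => intro i; simp
    | succ n ih =>
      intro i
      rw [pow_succ', mul_apply_eq_comp, ih, hT, pow_succ', Equiv.Perm.mul_apply]
  set M := ∑' i, ‖u i‖ ^ 2
  have hs2 : ∀ n : ℕ, Summable fun i => ‖(T ^ n) (u i)‖ ^ 2 := by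
    intro n
    simp only [hTn]
    exact ((σ ^ n).summable_iff (f := fun i => ‖u i‖ ^ 2)).2 hu
  have hM2 : ∀ n : ℕ, ∑' i, ‖(T ^ n) (u i)‖ ^ 2 ≤ M := by
    intro n
    simp only [hTn]
    exact ((σ ^ n).tsum_eq fun i => ‖u i‖ ^ 2).le
  have hs : ∀ n : ℕ, Summable fun i => ‖(T ^ n) (u i)‖ * ‖u i‖ := by
    intro n
    refine Summable.of_nonneg_of_le (fun i => by positivity) (fun i => ?_) ((hs2 n).add hu)
    nlinarith [sq_nonneg (‖(T ^ n) (u i)‖ - ‖u i‖), sq_nonneg ‖(T ^ n) (u i)‖, sq_nonneg ‖u i‖]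
  have key : ∀ f g, IsExpLipschitz f → IsExpLipschitz g → ∃ C, ∀ n : ℕ,
      |∫ y, f (T^[n] y) * g y ∂(gaussianLaw u) - (∫ y, f y ∂(gaussianLaw u))
        * ∫ y, g y ∂(gaussianLaw u)| ≤ C * ∑' i, ‖u ((σ ^ n) i)‖ * ‖u i‖ := by
    intro f g hf hg
    have hfc := hf.continuous
    obtain ⟨K, c, hK, hc, hf⟩ := hf
    obtain ⟨L, d, hL, hd, hg⟩ := hg
    refine ⟨covConst (max K L) (max c d) M, fun n => ?_⟩
    have h := abs_covariance_gaussianLaw_le hu (T ^ n) (hs2 n) le_rfl (hM2 n) (hs n)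
      (hK.trans (le_max_left K L)) (hc.trans (le_max_left c d))
      (hf.mono (le_max_left K L) (hK.trans (le_max_left K L)) (le_max_left c d))
      (hg.mono (le_max_right K L) (hK.trans (le_max_left K L)) (le_max_right c d))
    have e : ∫ y, f ((T ^ n) y) ∂(gaussianLaw u) = ∫ y, f y ∂(gaussianLaw u) := by
      have hmp := hTp.iterate n
      rw [← hiter] at hmp
      have h1 := integral_map (μ := gaussianLaw u) hmp.measurable.aemeasurable (f := f)
        hfc.aestronglyMeasurable
      rw [hmp.map_eq] at h1
      exact h1.symm
    rw [e] at h
    simp only [hTn] at h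
    rwa [hiter] at h
  refine ⟨gaussianLaw u, inferInstance, hTp, ?_, isOpenPosMeasure_gaussianLaw hu hd,
    fun f hf => hf.memLp_gaussianLaw hu, fun f g hf hg => ?_⟩
  · refine stronglyMixing_of_lipschitz hTp fun f g hf hg _ _ _ _ => ?_
    obtain ⟨_, hf⟩ := hf
    obtain ⟨_, hg⟩ := hg
    obtain ⟨C, hC⟩ := key f g (.of_lipschitz hf) (.of_lipschitz hg)
    rw [tendsto_iff_norm_sub_tendsto_zero]
    refine squeeze_zero (fun _ => norm_nonneg _) hC ?_
    simpa using h0.const_mul C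
  · obtain ⟨C, hC⟩ := key f g hf hg
    refine Asymptotics.IsBigO.of_bound C (Eventually.of_forall fun n => ?_)
    have hfn : MemLp (f ∘ T^[n]) 2 (gaussianLaw u) :=
      (hf.memLp_gaussianLaw hu).comp_measurePreserving (hTp.iterate n)
    rw [ProbabilityTheory.covariance_eq_sub hfn (hg.memLp_gaussianLaw hu), Real.norm_eq_abs,
      Real.norm_eq_abs, abs_of_nonneg (a := ∑' i, ‖u ((σ ^ n) i)‖ * ‖u i‖)
        (tsum_nonneg fun i => by positivity)]
    have e : ∫ y, f (T^[n] y) ∂(gaussianLaw u) = ∫ y, f y ∂(gaussianLaw u) := by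
      have hmp := hTp.iterate n
      have h1 := integral_map (μ := gaussianLaw u) hmp.measurable.aemeasurable (f := f)
        hf.continuous.aestronglyMeasurable
      rw [hmp.map_eq] at h1
      exact h1.symm
    have := hC n
    rw [← e] at this
    exact this

/-! ### The Hardy space as a Hilbert space -/

namespace HardySpace

/-- The space of square summable coefficient sequences. -/
abbrev Coeffs : Type := lp (fun _ : ℕ => ℂ) 2

theorem summable_norm_coeffs_mul_pow (a : Coeffs) (z : 𝔻) :
    Summable fun n => a n * (z : ℂ) ^ n := by
  refine Summable.of_norm_bounded
    ((summable_geometric_of_lt_one (norm_nonneg _) z.norm_lt_one).mul_left ‖a‖) fun n => ?_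
  rw [norm_mul, norm_pow]
  gcongr
  exact lp.norm_apply_le_norm two_ne_zero a n

/-- The element of the Hardy space with given Taylor coefficients. -/
noncomputable def ofCoeffs (a : Coeffs) : HardySpace :=
  ⟨fun z => ∑' n, a n * (z : ℂ) ^ n, a, fun z => (summable_norm_coeffs_mul_pow a z).hasSum⟩

theorem coeff_eq_of_hasSum {f : HardySpace} {a : Coeffs}
    (h : ∀ z : 𝔻, HasSum (fun n => a n * (z : ℂ) ^ n) (f z)) : coeff f = a :=
  lp.ext (taylorCoeff_unique (hasSum_coeff f) h)

theorem coeff_ofCoeffs (a : Coeffs) : coeff (ofCoeffs a) = a :=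
  coeff_eq_of_hasSum fun z => (summable_norm_coeffs_mul_pow a z).hasSum

theorem ext_apply {f g : HardySpace} (h : ∀ z, f z = g z) : f = g := Subtype.ext (funext h)

/-- The Hardy space is isometric to the space of coefficient sequences. -/
noncomputable def coeffEquiv : HardySpace ≃ₗᵢ[ℂ] Coeffs where
  toLinearEquiv := LinearEquiv.ofBijective coeff
    ⟨coeff_injective, fun a => ⟨ofCoeffs a, coeff_ofCoeffs a⟩⟩
  norm_map' _ := rfl

instance : CompleteSpace HardySpace :=
  (completeSpace_congr (e := coeffEquiv.toLinearEquiv.toEquiv)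
    coeffEquiv.isometry.isUniformEmbedding).2 inferInstance

theorem norm_eq (f : HardySpace) : ‖f‖ = ‖coeff f‖ := rfl

/-- The parallelogram identity involves no scalar field, so real Gaussian sums can be formed in this
complex space. -/
instance : InnerProductSpaceable HardySpace := ⟨fun x y => by
  simp only [norm_eq, map_add, map_sub]
  exact parallelogram_law_with_norm_mul ℂ (coeff x) (coeff y)⟩

/-! ### Reproducing kernels -/

/-- The coefficient sequence of the reproducing kernel at `z`. -/
noncomputable def kernelVec (z : 𝔻) : Coeffs :=
  ⟨fun n => (starRingEnd ℂ) z ^ n, by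
    refine memℓp_gen ?_
    have h : ‖(z : ℂ)‖ ^ 2 < 1 := z.sq_norm_lt_one
    refine (summable_geometric_of_lt_one (by positivity) h).congr fun n => ?_
    rw [norm_pow, RCLike.norm_conj]
    simp [← pow_mul, mul_comm]⟩

theorem kernelVec_apply (z : 𝔻) (n : ℕ) : kernelVec z n = (starRingEnd ℂ) z ^ n := rfl

theorem hasSum_inner_kernelVec (z : 𝔻) (a : Coeffs) :
    HasSum (fun n => a n * (z : ℂ) ^ n) (inner ℂ (kernelVec z) a) := by
  have h := lp.hasSum_inner (𝕜 := ℂ) (kernelVec z) a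
  refine h.congr_fun fun n => ?_
  rw [kernelVec_apply, RCLike.inner_apply, map_pow, Complex.conj_conj]

theorem inner_kernelVec_coeff (z : 𝔻) (f : HardySpace) : inner ℂ (kernelVec z) (coeff f) = f z :=
  (hasSum_inner_kernelVec z (coeff f)).unique (hasSum_coeff f z)

theorem inner_kernelVec_kernelVec (z w : 𝔻) :
    inner ℂ (kernelVec z) (kernelVec w) = (1 - (starRingEnd ℂ) w * z)⁻¹ := by
  refine (hasSum_inner_kernelVec z (kernelVec w)).unique ?_
  simp only [kernelVec_apply, ← mul_pow]
  refine hasSum_geometric_of_norm_lt_one ?_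
  rw [norm_mul, RCLike.norm_conj]
  exact mul_lt_one_of_nonneg_of_lt_one_left (norm_nonneg _) w.norm_lt_one z.norm_lt_one.le

theorem kernelVec_ne_zero (z : 𝔻) : kernelVec z ≠ 0 := by
  intro h
  have := congrArg (fun a : Coeffs => a 0) h
  simp [kernelVec_apply] at this

/-! ### Composition operators induced by disc automorphisms -/

theorem orthonormal_single : Orthonormal ℂ fun n : ℕ => (lp.single 2 n (1 : ℂ) : Coeffs) := by
  classical
  rw [orthonormal_iff_ite]
  intro i j
  rw [lp.inner_single_left]
  simp only [lp.single_apply, Pi.single_apply, RCLike.inner_apply, map_one, mul_one]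

/-- Multiplication by `z`, on coefficient sequences. -/
noncomputable def shift : Coeffs →ₗᵢ[ℂ] Coeffs :=
  (orthonormal_single.comp Nat.succ Nat.succ_injective).orthogonalFamily.linearIsometry

theorem inner_kernelVec_single (z : 𝔻) (n : ℕ) :
    inner ℂ (kernelVec z) (lp.single 2 n (1 : ℂ) : Coeffs) = (z : ℂ) ^ n := by
  classical
  rw [lp.inner_single_right, kernelVec_apply, RCLike.inner_apply, map_pow, Complex.conj_conj,
    one_mul]

theorem inner_kernelVec_shift (z : 𝔻) (a : Coeffs) :
    inner ℂ (kernelVec z) (shift a) = z * inner ℂ (kernelVec z) a := by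
  have h1 := (orthonormal_single.comp Nat.succ
    Nat.succ_injective).orthogonalFamily.hasSum_linearIsometry a
  have h2 := h1.mapL (innerSL ℂ (kernelVec z))
  refine h2.unique ?_
  refine ((hasSum_inner_kernelVec z a).mul_left (z : ℂ)).congr_fun fun n => ?_
  simp only [LinearIsometry.toSpanSingleton_apply, Function.comp_apply, innerSL_apply_apply,
    inner_smul_right, inner_kernelVec_single, pow_succ]
  ring

/-- The operator form of `|z - a| = |1 - ā z|` on the unit circle: the shift is isometric and the
cross terms have equal real parts. -/
theorem norm_shift_sub_smul (a : ℂ) (h : Coeffs) :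
    ‖shift h - a • h‖ = ‖h - (starRingEnd ℂ) a • shift h‖ := by
  refine (sq_eq_sq₀ (norm_nonneg _) (norm_nonneg _)).1 ?_
  rw [norm_sub_sq (𝕜 := ℂ), norm_sub_sq (𝕜 := ℂ), norm_smul, norm_smul, shift.norm_map,
    inner_smul_right, inner_smul_right, RCLike.norm_conj]
  have : RCLike.re ((starRingEnd ℂ) a * inner ℂ h (shift h))
      = RCLike.re (a * inner ℂ (shift h) h) := by
    rw [← inner_conj_symm h (shift h), ← map_mul, RCLike.conj_re]
  rw [this]

/-- For `b(z) = c (z - a) / (1 - ā z)` with `|c| = 1`, multiplication by `b` is an isometry. -/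
theorem exists_blaschke_isometry (a : 𝔻) {c : ℂ} (hc : ‖c‖ = 1) :
    ∃ M : Coeffs →ₗᵢ[ℂ] Coeffs, ∀ (z : 𝔻) (h : Coeffs), inner ℂ (kernelVec z) (M h)
      = c * (z - a) / (1 - (starRingEnd ℂ) a * z) * inner ℂ (kernelVec z) h := by
  -- As `‖t‖ < 1`, the operator `1 - t` is invertible; its inverse `R` is multiplication by `1 / (1
  -- - ā z)`.
  set t : Coeffs →L[ℂ] Coeffs := (starRingEnd ℂ) (a : ℂ) • shift.toContinuousLinearMap
  have ht : ‖t‖ < 1 := by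
    refine (norm_smul_le ((starRingEnd ℂ) (a : ℂ)) shift.toContinuousLinearMap).trans_lt ?_
    rw [RCLike.norm_conj]
    exact mul_lt_one_of_nonneg_of_lt_one_left (norm_nonneg _) a.norm_lt_one
      shift.norm_toContinuousLinearMap_le
  set U := Units.oneSub t ht
  set R : Coeffs →L[ℂ] Coeffs := ↑U⁻¹
  have hR : ∀ h, R h - (starRingEnd ℂ) (a : ℂ) • shift (R h) = h := by
    intro h
    have := congrArg (fun A : Coeffs →L[ℂ] Coeffs => A h) U.mul_inv
    simpa [U, R, t] using this
  refine ⟨⟨(c • (shift.toContinuousLinearMap - (a : ℂ) • 1) * R : Coeffs →L[ℂ] Coeffs),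
    fun h => ?_⟩, fun z h => ?_⟩
  · have e : (c • (shift.toContinuousLinearMap - (a : ℂ) • 1) * R : Coeffs →L[ℂ] Coeffs) h
        = c • (shift (R h) - (a : ℂ) • R h) := by simp
    rw [ContinuousLinearMap.coe_coe, e, norm_smul, hc, one_mul, norm_shift_sub_smul, hR]
  · have e : (c • (shift.toContinuousLinearMap - (a : ℂ) • 1) * R : Coeffs →L[ℂ] Coeffs) h
        = c • (shift (R h) - (a : ℂ) • R h) := by simp
    change inner ℂ (kernelVec z)
      ((c • (shift.toContinuousLinearMap - (a : ℂ) • 1) * R : Coeffs →L[ℂ] Coeffs) h) = _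
    have h1 : (1 - (starRingEnd ℂ) a * z) * inner ℂ (kernelVec z) (R h)
        = inner ℂ (kernelVec z) h := by
      conv_rhs => rw [← hR h]
      rw [inner_sub_right, inner_smul_right, inner_kernelVec_shift]
      ring
    have h2 : (1 - (starRingEnd ℂ) a * z : ℂ) ≠ 0 := by
      intro h0
      have h3 : ‖(starRingEnd ℂ) a * (z : ℂ)‖ = 1 := by
        rw [← sub_eq_zero.1 h0, norm_one]
      rw [norm_mul, RCLike.norm_conj] at h3
      exact (mul_lt_one_of_nonneg_of_lt_one_left (norm_nonneg _) a.norm_lt_one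
        z.norm_lt_one.le).ne h3
    rw [e, inner_smul_right, inner_sub_right, inner_smul_right, inner_kernelVec_shift, ← h1,
      div_mul_eq_mul_div, eq_div_iff h2]
    ring

/-- Let `M` be multiplication by `φ` and `k = 1 / (1 - ā z)` the kernel at `a`. Everything in the
range of `M` vanishes at `a`, so is orthogonal to `k`; as `M` is isometric, the `φ^n k` are pairwise
orthogonal of equal norm. Hence `∑ a_n z^n ↦ ∑ a_n φ^n k / ‖k‖` is an isometry, and multiplying by
`‖k‖ (1 - ā z)` gives composition with `φ`. -/
theorem exists_comp_clm {φ : 𝔻 → 𝔻} {a : 𝔻} {c : ℂ} (hc : ‖c‖ = 1)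
    (hφ : ∀ z, (φ z : ℂ) = c * (z - a) / (1 - (starRingEnd ℂ) a * z)) :
    ∃ T : HardySpace →L[ℂ] HardySpace, ∀ (f : HardySpace) (z : 𝔻), T f z = f (φ z) := by
  obtain ⟨M, hM⟩ := exists_blaschke_isometry a hc
  set k := kernelVec a
  have hMa : ∀ h, inner ℂ k (M h) = 0 := fun h => by rw [hM]; simp
  have hk : ‖k‖ ≠ 0 := norm_ne_zero_iff.2 (kernelVec_ne_zero a)
  have hn : ∀ n, ‖M^[n] k‖ = ‖k‖ := by
    intro n
    induction n with
    | zero => rfl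
    | succ n ih => rw [Function.iterate_succ_apply', M.norm_map, ih]
  have horth : ∀ n m, inner ℂ (M^[n] k) (M^[n + (m + 1)] k) = 0 := by
    intro n m
    induction n with
    | zero =>
      rw [zero_add, Function.iterate_succ_apply', Function.iterate_zero, id]
      exact hMa _
    | succ n ih =>
      rw [show n + 1 + (m + 1) = (n + (m + 1)) + 1 by ring, Function.iterate_succ_apply',
        Function.iterate_succ_apply', M.inner_map_map, ih]
  have hv : Orthonormal ℂ fun n : ℕ => ((‖k‖ : ℂ)⁻¹) • M^[n] k := by
    refine ⟨fun n => ?_, fun n m hnm => ?_⟩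
    · rw [norm_smul, hn, norm_inv, Complex.norm_real, norm_norm, inv_mul_cancel₀ hk]
    · change inner ℂ ((‖k‖ : ℂ)⁻¹ • M^[n] k) ((‖k‖ : ℂ)⁻¹ • M^[m] k) = 0
      rw [inner_smul_left, inner_smul_right]
      have h0 : inner ℂ (M^[n] k) (M^[m] k) = 0 := by
        rcases lt_or_gt_of_ne hnm with h | h
        · obtain ⟨d, rfl⟩ := Nat.exists_eq_add_of_lt h
          exact horth n d
        · obtain ⟨d, rfl⟩ := Nat.exists_eq_add_of_lt h
          rw [← inner_conj_symm, show m + d + 1 = m + (d + 1) by ring, horth, map_zero]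
      rw [h0]
      simp
  set W := hv.orthogonalFamily.linearIsometry
  have hden : ∀ z : 𝔻, (1 - (starRingEnd ℂ) a * z : ℂ) ≠ 0 := by
    intro z h0
    have h3 : ‖(starRingEnd ℂ) a * (z : ℂ)‖ = 1 := by
      rw [← sub_eq_zero.1 h0, norm_one]
    rw [norm_mul, RCLike.norm_conj] at h3
    exact (mul_lt_one_of_nonneg_of_lt_one_left (norm_nonneg _) a.norm_lt_one
      z.norm_lt_one.le).ne h3
  have hMn : ∀ (z : 𝔻) (n : ℕ), inner ℂ (kernelVec z) (M^[n] k)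
      = (φ z : ℂ) ^ n * (1 - (starRingEnd ℂ) a * z)⁻¹ := by
    intro z n
    induction n with
    | zero => rw [Function.iterate_zero, id, inner_kernelVec_kernelVec, pow_zero, one_mul]
    | succ n ih => rw [Function.iterate_succ_apply', hM, ih, ← hφ, pow_succ']; ring
  set A : Coeffs →L[ℂ] Coeffs :=
    (‖k‖ : ℂ) • (1 - (starRingEnd ℂ) (a : ℂ) • shift.toContinuousLinearMap)
  refine ⟨coeffEquiv.symm.toContinuousLinearEquiv.toContinuousLinearMap ∘L
    (A ∘L (W.toContinuousLinearMap ∘L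
      coeffEquiv.toContinuousLinearEquiv.toContinuousLinearMap)), fun f z => ?_⟩
  set x := W (coeff f)
  set g : HardySpace := coeffEquiv.symm (A x)
  change g z = f (φ z)
  have hg : coeff g = A x := coeffEquiv.apply_symm_apply (A x)
  have hA : A x = (‖k‖ : ℂ) • (x - (starRingEnd ℂ) (a : ℂ) • shift x) := rfl
  rw [← inner_kernelVec_coeff, hg, hA, inner_smul_right, inner_sub_right, inner_smul_right,
    inner_kernelVec_shift]
  have h1 := (hv.orthogonalFamily.hasSum_linearIsometry (coeff f)).mapL (innerSL ℂ (kernelVec z))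
  have h2 : HasSum (fun n => coeff f n * (φ z : ℂ) ^ n *
      ((‖k‖ : ℂ)⁻¹ * (1 - (starRingEnd ℂ) a * z)⁻¹)) (inner ℂ (kernelVec z) x) := by
    refine HasSum.congr_fun h1 fun n => ?_
    simp only [LinearIsometry.toSpanSingleton_apply, innerSL_apply_apply, inner_smul_right, hMn]
    ring
  rw [h2.unique ((hasSum_coeff f (φ z)).mul_right _)]
  have hk' : (‖k‖ : ℂ) ≠ 0 := by exact_mod_cast hk
  have := hden z
  field_simp

end HardySpace

/-! ### Automorphisms of the disc -/

section Automorphism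

open Metric Set

/-- The open mapping theorem makes `g` continuous, and the inverse function theorem makes it
differentiable where `f'` is nonzero. By injectivity the zeros of `f'` are isolated, so the
exceptional points of `g` are removable. -/
theorem differentiableOn_of_leftInverse {f g : ℂ → ℂ} (hf : DifferentiableOn ℂ f (ball 0 1))
    (hgm : MapsTo g (ball 0 1) (ball 0 1))
    (hfg : ∀ w ∈ ball (0 : ℂ) 1, f (g w) = w) (hgf : ∀ z ∈ ball (0 : ℂ) 1, g (f z) = z) :
    DifferentiableOn ℂ g (ball 0 1) := by
  have hpre : IsPreconnected (ball (0 : ℂ) 1) := (convex_ball _ _).isPreconnected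
  have han : AnalyticOnNhd ℂ f (ball 0 1) := hf.analyticOnNhd isOpen_ball
  have hinj : InjOn f (ball 0 1) := fun x hx y hy h => by rw [← hgf x hx, h, hgf y hy]
  have h0 : (0 : ℂ) ∈ ball (0 : ℂ) 1 := mem_ball_self one_pos
  have h2 : (1 / 2 : ℂ) ∈ ball (0 : ℂ) 1 := by norm_num [mem_ball_zero_iff]
  have hopen : ∀ s ⊆ ball (0 : ℂ) 1, IsOpen s → IsOpen (f '' s) := by
    rcases han.is_constant_or_isOpen hpre with ⟨w, hw⟩ | h
    · have := hinj h0 h2 ((hw 0 h0).trans (hw _ h2).symm)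
      norm_num at this
    · exact h
  have hcont : ∀ w ∈ ball (0 : ℂ) 1, ContinuousAt g w := by
    intro w hw V hV
    obtain ⟨s, hsV, hs, hws⟩ := _root_.mem_nhds_iff.1 (inter_mem hV (isOpen_ball.mem_nhds (hgm hw)))
    have hsub : s ⊆ ball 0 1 := fun x hx => (hsV hx).2
    refine mem_map.2 (mem_of_superset ((hopen s hsub hs).mem_nhds ⟨g w, hws, hfg w hw⟩) ?_)
    rintro _ ⟨x, hx, rfl⟩
    rw [mem_preimage, hgf x (hsub hx)]
    exact (hsV hx).1
  have hdiff : ∀ w ∈ ball (0 : ℂ) 1, deriv f (g w) ≠ 0 → DifferentiableAt ℂ g w := by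
    intro w hw hd
    refine (HasStrictDerivAt.of_local_left_inverse (hcont w hw)
      (han _ (hgm hw)).hasStrictDerivAt hd ?_).hasDerivAt.differentiableAt
    filter_upwards [isOpen_ball.mem_nhds hw] with y hy using hfg y hy
  intro w hw
  refine (Complex.analyticAt_of_differentiable_on_punctured_nhds_of_continuousAt ?_
    (hcont w hw)).differentiableAt.differentiableWithinAt
  rcases (han.deriv _ (hgm hw)).eventually_eq_zero_or_eventually_ne_zero with h | h
  · exfalso
    obtain ⟨r, hr, hball⟩ := Metric.eventually_nhds_iff_ball.1
      (h.and (isOpen_ball.mem_nhds (hgm hw)))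
    have hsub : ball (g w) r ⊆ ball 0 1 := fun x hx => (hball x hx).2
    obtain ⟨c, hc⟩ := isOpen_ball.exists_is_const_of_deriv_eq_zero
      (convex_ball (g w) r).isPreconnected (hf.mono hsub) fun x hx => (hball x hx).1
    have hx1 : g w ∈ ball (g w) r := mem_ball_self hr
    have hx2 : g w + (r / 2 : ℝ) ∈ ball (g w) r := by
      rw [mem_ball_iff_norm, add_sub_cancel_left, Complex.norm_real, Real.norm_eq_abs,
        abs_of_pos (by positivity)]
      linarith
    have := hinj (hsub hx1) (hsub hx2) ((hc _ hx1).trans (hc _ hx2).symm)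
    have h3 : ((r / 2 : ℝ) : ℂ) = 0 := by simpa using this
    rw [Complex.ofReal_eq_zero] at h3
    linarith
  · have ht : Tendsto g (𝓝[≠] w) (𝓝[≠] (g w)) := by
      refine tendsto_nhdsWithin_iff.2 ⟨(hcont w hw).tendsto.mono_left nhdsWithin_le_nhds, ?_⟩
      filter_upwards [self_mem_nhdsWithin, nhdsWithin_le_nhds (isOpen_ball.mem_nhds hw)] with y hy hyb
      intro he
      refine hy ?_
      rw [mem_singleton_iff, ← hfg y hyb, he, hfg w hw]
    filter_upwards [ht.eventually h, nhdsWithin_le_nhds (isOpen_ball.mem_nhds hw)] with y hy hyb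
    exact hdiff y hyb hy

/-- The Schwarz lemma for `f` and for its inverse gives `‖f z₀‖ = ‖z₀‖` at one nonzero point, and
the equality case forces a rotation. -/
theorem exists_eq_mul_of_bijOn_ball {f : ℂ → ℂ} (hf : DifferentiableOn ℂ f (ball 0 1))
    (hb : BijOn f (ball 0 1) (ball 0 1)) (h0 : f 0 = 0) :
    ∃ c : ℂ, ‖c‖ = 1 ∧ ∀ z ∈ ball (0 : ℂ) 1, f z = c * z := by
  set g := Function.invFunOn f (ball 0 1)
  have hinv : InvOn g f (ball 0 1) (ball 0 1) := hb.invOn_invFunOn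
  have hgm : MapsTo g (ball 0 1) (ball 0 1) := hb.surjOn.mapsTo_invFunOn
  have hg := differentiableOn_of_leftInverse hf hgm (fun w hw => hinv.2 hw)
    fun z hz => hinv.1 hz
  have hz0 : (0 : ℂ) ∈ ball (0 : ℂ) 1 := mem_ball_self one_pos
  have hg0 : g 0 = 0 := by
    have := hinv.1 hz0
    rwa [h0] at this
  set z₀ : ℂ := 1 / 2
  have hz₀ : z₀ ∈ ball (0 : ℂ) 1 := by norm_num [z₀, mem_ball_zero_iff]
  have hz₀n : z₀ ≠ 0 := by norm_num [z₀]
  have h1 := Complex.norm_le_norm_of_mapsTo_ball hf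
    (hb.mapsTo.mono_right ball_subset_closedBall) h0 (mem_ball_zero_iff.1 hz₀)
  have h2 := Complex.norm_le_norm_of_mapsTo_ball hg
    (hgm.mono_right ball_subset_closedBall) hg0 (mem_ball_zero_iff.1 (hb.mapsTo hz₀))
  rw [hinv.1 hz₀] at h2
  have h3 : ‖dslope f 0 z₀‖ = 1 / 1 := by
    rw [dslope_of_ne _ hz₀n, slope_def_field, h0, sub_zero, sub_zero, norm_div, le_antisymm h1 h2,
      div_one, div_self (norm_ne_zero_iff.2 hz₀n)]
  obtain ⟨c, hc, hE⟩ := Complex.affine_of_mapsTo_ball_of_exists_norm_dslope_eq_div' hf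
    (by rw [h0]; exact hb.mapsTo.mono_right ball_subset_closedBall) ⟨z₀, hz₀, h3⟩
  refine ⟨c, by simpa using hc, fun z hz => ?_⟩
  rw [hE hz]
  simp [h0, mul_comm]

theorem one_sub_conj_mul_ne_zero {a z : ℂ} (ha : ‖a‖ < 1) (hz : ‖z‖ ≤ 1) :
    1 - (starRingEnd ℂ) a * z ≠ 0 := by
  intro h0
  have h3 : ‖(starRingEnd ℂ) a * z‖ = 1 := by rw [← sub_eq_zero.1 h0, norm_one]
  rw [norm_mul, RCLike.norm_conj] at h3
  exact (mul_lt_one_of_nonneg_of_lt_one_left (norm_nonneg _) ha hz).ne h3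

theorem norm_moebius_lt_one {a z : ℂ} (ha : ‖a‖ < 1) (hz : ‖z‖ < 1) :
    ‖(z - a) / (1 - (starRingEnd ℂ) a * z)‖ < 1 := by
  have hd := one_sub_conj_mul_ne_zero ha hz.le
  rw [norm_div, div_lt_one (norm_pos_iff.2 hd)]
  refine lt_of_pow_lt_pow_left₀ 2 (norm_nonneg _) ?_
  rw [← Complex.normSq_eq_norm_sq, ← Complex.normSq_eq_norm_sq]
  have ha' : Complex.normSq a < 1 := by
    rw [Complex.normSq_eq_norm_sq]; exact pow_lt_one₀ (norm_nonneg _) ha two_ne_zero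
  have hz' : Complex.normSq z < 1 := by
    rw [Complex.normSq_eq_norm_sq]; exact pow_lt_one₀ (norm_nonneg _) hz two_ne_zero
  rw [Complex.normSq_apply] at *
  simp only [Complex.sub_re, Complex.sub_im, Complex.one_re, Complex.one_im, Complex.mul_re,
    Complex.mul_im, Complex.conj_re, Complex.conj_im, Complex.normSq_apply] at *
  nlinarith [mul_pos (sub_pos.2 ha') (sub_pos.2 hz')]

theorem moebius_moebius {a z : ℂ} (ha : ‖a‖ < 1) (hz : ‖z‖ < 1) :
    ((z - a) / (1 - (starRingEnd ℂ) a * z) + a)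
      / (1 + (starRingEnd ℂ) a * ((z - a) / (1 - (starRingEnd ℂ) a * z))) = z := by
  have hd := one_sub_conj_mul_ne_zero ha hz.le
  have hd2 := one_sub_conj_mul_ne_zero ha ha.le
  have e : 1 + (starRingEnd ℂ) a * ((z - a) / (1 - (starRingEnd ℂ) a * z))
      = (1 - (starRingEnd ℂ) a * a) / (1 - (starRingEnd ℂ) a * z) := by
    rw [mul_div_assoc', eq_div_iff hd, add_mul, div_mul_cancel₀ _ hd]
    ring
  have e2 : (z - a) / (1 - (starRingEnd ℂ) a * z) + a
      = z * ((1 - (starRingEnd ℂ) a * a) / (1 - (starRingEnd ℂ) a * z)) := by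
    rw [mul_div_assoc', eq_div_iff hd, add_mul, div_mul_cancel₀ _ hd]
    ring
  rw [e, e2, mul_div_assoc, div_self (div_ne_zero hd2 hd), mul_one]

/-- With `a` the zero of `φ`, precomposing with the Möbius map that sends `0` to `a` gives an
automorphism fixing `0`, that is, a rotation. -/
theorem IsDiscAutomorphism.exists_moebius {φ : 𝔻 → 𝔻} (h : IsDiscAutomorphism φ) :
    ∃ (a : 𝔻) (c : ℂ), ‖c‖ = 1 ∧
      ∀ z : 𝔻, (φ z : ℂ) = c * (z - a) / (1 - (starRingEnd ℂ) a * z) := by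
  obtain ⟨hbij, F, hF, hFφ⟩ := h
  obtain ⟨a, ha⟩ := hbij.2 0
  have hFb : BijOn F (ball 0 1) (ball 0 1) := by
    refine ⟨fun z hz => ?_, fun z hz w hw hzw => ?_, fun w hw => ?_⟩
    · lift z to 𝔻 using mem_ball_zero_iff.1 hz
      rw [hFφ, mem_ball_zero_iff]
      exact (φ z).norm_lt_one
    · lift z to 𝔻 using mem_ball_zero_iff.1 hz
      lift w to 𝔻 using mem_ball_zero_iff.1 hw
      rw [hFφ, hFφ] at hzw
      rw [hbij.1 (Complex.UnitDisc.coe_injective hzw)]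
    · lift w to 𝔻 using mem_ball_zero_iff.1 hw
      obtain ⟨z, rfl⟩ := hbij.2 w
      exact ⟨z, mem_ball_zero_iff.2 z.norm_lt_one, hFφ z⟩
  have han : ‖(a : ℂ)‖ < 1 := a.norm_lt_one
  have hna : ‖-(a : ℂ)‖ < 1 := by rwa [norm_neg]
  set m : ℂ → ℂ := fun w => (w + a) / (1 + (starRingEnd ℂ) a * w)
  have hm_eq : ∀ w, m w = (w - -(a : ℂ)) / (1 - (starRingEnd ℂ) (-(a : ℂ)) * w) := by
    intro w
    simp only [m, map_neg, sub_neg_eq_add, neg_mul]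
  have hmb : BijOn m (ball 0 1) (ball 0 1) := by
    refine InvOn.bijOn (f' := fun z => (z - a) / (1 - (starRingEnd ℂ) a * z))
      ⟨fun w hw => ?_, fun z hz => moebius_moebius han (mem_ball_zero_iff.1 hz)⟩
      (fun w hw => ?_) (fun z hz => ?_)
    · have := moebius_moebius hna (mem_ball_zero_iff.1 hw)
      simp only [map_neg, sub_neg_eq_add, neg_mul, ← sub_eq_add_neg] at this
      exact this
    · rw [hm_eq, mem_ball_zero_iff]
      exact norm_moebius_lt_one hna (mem_ball_zero_iff.1 hw)
    · rw [mem_ball_zero_iff]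
      exact norm_moebius_lt_one han (mem_ball_zero_iff.1 hz)
  have hmd : DifferentiableOn ℂ m (ball 0 1) := by
    intro w hw
    have hd := one_sub_conj_mul_ne_zero hna (mem_ball_zero_iff.1 hw).le
    simp only [map_neg, neg_mul, sub_neg_eq_add] at hd
    refine DifferentiableAt.differentiableWithinAt ?_
    exact DifferentiableAt.div (by fun_prop) (by fun_prop) hd
  obtain ⟨c, hc, hψ⟩ := exists_eq_mul_of_bijOn_ball (hF.comp hmd hmb.mapsTo) (hFb.comp hmb) (by
    simp only [Function.comp, m, zero_add, mul_zero, add_zero, div_one]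
    rw [hFφ, ha]
    rfl)
  refine ⟨a, c, hc, fun z => ?_⟩
  have hz := norm_moebius_lt_one han z.norm_lt_one
  have h1 := hψ _ (mem_ball_zero_iff.2 hz)
  simp only [Function.comp, m] at h1
  rw [moebius_moebius han z.norm_lt_one, hFφ] at h1
  rw [h1, mul_div_assoc]

/-- The Möbius formula is continuous at every point of the circle, so the boundary limit is its
value there; clearing the denominator gives the quadratic. -/
theorem isBoundaryFixedPoint_iff {φ : 𝔻 → 𝔻} {a : 𝔻} {c : ℂ}
    (hφ : ∀ z : 𝔻, (φ z : ℂ) = c * (z - a) / (1 - (starRingEnd ℂ) a * z)) (η : ℂ) :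
    IsBoundaryFixedPoint φ η ↔
      ‖η‖ = 1 ∧ (starRingEnd ℂ) a * η ^ 2 + (c - 1) * η - c * a = 0 := by
  refine and_congr_right fun hη => ?_
  have hd := one_sub_conj_mul_ne_zero a.norm_lt_one hη.le
  have hne : (comap (fun z : 𝔻 => (z : ℂ)) (𝓝 η)).NeBot := by
    rw [comap_neBot_iff]
    intro t ht
    have hcl : η ∈ closure (ball (0 : ℂ) 1) := by
      rw [closure_ball _ one_ne_zero, mem_closedBall_zero_iff]
      exact hη.le
    obtain ⟨z, hzt, hz⟩ := mem_closure_iff_nhds.1 hcl t ht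
    exact ⟨Complex.UnitDisc.mk z (mem_ball_zero_iff.1 hz), hzt⟩
  have hF : ContinuousAt (fun z : ℂ => c * (z - a) / (1 - (starRingEnd ℂ) a * z)) η :=
    ContinuousAt.div (by fun_prop) (by fun_prop) hd
  have hlim : Tendsto (fun z : 𝔻 => (φ z : ℂ)) (comap (fun z : 𝔻 => (z : ℂ)) (𝓝 η))
      (𝓝 (c * (η - a) / (1 - (starRingEnd ℂ) a * η))) := by
    refine (hF.tendsto.comp tendsto_comap).congr fun z => ?_
    rw [Function.comp_apply, hφ]
  have key : c * (η - a) / (1 - (starRingEnd ℂ) a * η) = η ↔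
      (starRingEnd ℂ) a * η ^ 2 + (c - 1) * η - c * a = 0 := by
    rw [div_eq_iff hd, ← sub_eq_zero]
    ring_nf
  rw [← key]
  constructor
  · intro h
    exact tendsto_nhds_unique hlim h
  · intro h
    rwa [h] at hlim

/-- Uniqueness of the fixed point makes `ζ` a double root of the quadratic. With `q = ā ζ` this says
`c = 1 - 2 q`, and `|c| = 1` becomes `Re q = |q|²`, that is, `q / (1 - q)` is imaginary. This number
is the translation. -/
theorem IsParabolicAutomorphism.exists_normal_form {φ : 𝔻 → 𝔻} (h : IsParabolicAutomorphism φ) :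
    ∃ (w : ℂ) (b : ℝ), ‖w‖ = 1 ∧ b ≠ 0 ∧
      ∀ z : 𝔻, (1 - w * φ z)⁻¹ = (1 - w * z)⁻¹ + b * Complex.I := by
  obtain ⟨haut, ζ, hζ, huniq⟩ := h
  obtain ⟨a, c, hc, hφ⟩ := haut.exists_moebius
  simp only [isBoundaryFixedPoint_iff hφ] at hζ huniq
  obtain ⟨hζ1, hζ2⟩ := hζ
  have hζ0 : ζ ≠ 0 := by
    rintro rfl
    simp at hζ1
  have ha0 : (a : ℂ) ≠ 0 := by
    -- If `a = 0`, the equation reduces to `c = 1`, and then `1` and `-1` are both fixed.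
    intro ha
    simp only [ha, map_zero, zero_mul, mul_zero, zero_add, sub_zero, mul_eq_zero, hζ0,
      or_false] at hζ2 huniq
    have h1 := huniq 1 ⟨by simp, Or.inl hζ2⟩
    have h2 := huniq (-1) ⟨by simp, Or.inl hζ2⟩
    rw [← h2] at h1
    norm_num at h1
  set ā := (starRingEnd ℂ) (a : ℂ)
  have hā0 : ā ≠ 0 := by simpa [ā] using ha0
  have hān : ‖ā‖ = ‖(a : ℂ)‖ := RCLike.norm_conj _
  -- By Vieta the left side is the other root; it again has modulus one, so it must coincide with
  -- `ζ`.
  have h2 : -(c * a) / (ā * ζ) = ζ := by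
    refine huniq _ ⟨?_, ?_⟩
    · rw [norm_div, norm_neg, norm_mul, norm_mul, hc, hζ1, hān, one_mul, mul_one,
        div_self (norm_ne_zero_iff.2 ha0)]
    · have e : ā * (-(c * a) / (ā * ζ)) ^ 2 + (c - 1) * (-(c * a) / (ā * ζ)) - c * a
          = -(c * a / (ā * ζ ^ 2)) * (ā * ζ ^ 2 + (c - 1) * ζ - c * a) := by
        field_simp
        ring
      rw [e, hζ2, mul_zero]
  rw [div_eq_iff (mul_ne_zero hā0 hζ0)] at h2
  set q := ā * ζ
  have hca : c * a = -(q * ζ) := by linear_combination -h2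
  have hcq : c = 1 - 2 * q := by
    refine mul_right_cancel₀ hζ0 ?_
    simp only [q] at hca ⊢
    linear_combination hζ2 + hca
  have hqn : ‖q‖ < 1 := by
    rw [norm_mul, hζ1, mul_one, hān]
    exact a.norm_lt_one
  have hq0 : q ≠ 0 := mul_ne_zero hā0 hζ0
  have hq1 : 1 - q ≠ 0 := by
    intro h0
    rw [← sub_eq_zero.1 h0, norm_one] at hqn
    exact lt_irrefl _ hqn
  have hre : q.re = Complex.normSq q := by
    have h3 : Complex.normSq c = 1 := by rw [Complex.normSq_eq_norm_sq, hc, one_pow]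
    rw [hcq, Complex.normSq_apply] at h3
    rw [Complex.normSq_apply]
    simp at h3
    linarith
  set w := (starRingEnd ℂ) ζ
  have hwζ : w * ζ = 1 := by
    rw [mul_comm, Complex.mul_conj, Complex.normSq_eq_norm_sq, hζ1]
    simp
  have hw1 : ‖w‖ = 1 := by rw [RCLike.norm_conj, hζ1]
  have hāq : ā = q * w := by
    simp only [q]
    rw [mul_assoc, mul_comm ζ, hwζ, mul_one]
  have hbI : q / (1 - q) = ((q / (1 - q)).im : ℂ) * Complex.I := by
    have hr : (q / (1 - q)).re = 0 := by
      rw [Complex.div_re]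
      have : q.re * (1 - q).re + q.im * (1 - q).im = 0 := by
        simp only [Complex.sub_re, Complex.sub_im, Complex.one_re, Complex.one_im]
        rw [Complex.normSq_apply] at hre
        linarith
      rw [← add_div, this, zero_div]
    conv_lhs => rw [← Complex.re_add_im (q / (1 - q)), hr]
    simp
  refine ⟨w, (q / (1 - q)).im, hw1, fun h0 => ?_, fun z => ?_⟩
  · rw [h0] at hbI
    simp [hq0, hq1] at hbI
  · rw [← hbI]
    have hwz : 1 - w * z ≠ 0 := by
      intro h0
      have h3 : ‖w * (z : ℂ)‖ = 1 := by rw [← sub_eq_zero.1 h0, norm_one]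
      rw [norm_mul, hw1, one_mul] at h3
      exact z.norm_ne_one h3
    have hd := one_sub_conj_mul_ne_zero a.norm_lt_one z.norm_lt_one.le
    change 1 - ā * z ≠ 0 at hd
    have e : 1 - w * φ z = (1 - q) * (1 - w * z) / (1 - ā * z) := by
      rw [hφ, mul_div_assoc', eq_div_iff hd, sub_mul, div_mul_cancel₀ _ hd, mul_sub c, hca, hcq,
        hāq]
      linear_combination -q * hwζ
    rw [e, inv_div, hāq]
    field_simp
    ring

end Automorphism

/-! ### A family of functions translated by parabolic automorphisms -/

namespace HardySpace

/-- The number `1 / (1 + i s)`. -/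
noncomputable def paraBeta (s : ℝ) : ℂ := (1 + s * Complex.I)⁻¹

theorem one_add_mul_I_ne_zero (s : ℝ) : (1 + s * Complex.I : ℂ) ≠ 0 := by
  intro h
  have := congrArg Complex.re h
  simp at this

theorem norm_one_add_mul_I_sq (s : ℝ) : ‖(1 + s * Complex.I : ℂ)‖ ^ 2 = 1 + s ^ 2 := by
  rw [← Complex.normSq_eq_norm_sq, Complex.normSq_apply]
  simp [sq]

theorem paraBeta_ne_zero (s : ℝ) : paraBeta s ≠ 0 := inv_ne_zero (one_add_mul_I_ne_zero s)

theorem norm_paraBeta_sq (s : ℝ) : ‖paraBeta s‖ ^ 2 = (1 + s ^ 2)⁻¹ := by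
  rw [paraBeta, norm_inv, inv_pow, norm_one_add_mul_I_sq]

theorem one_sub_paraBeta (s : ℝ) : 1 - paraBeta s = s * Complex.I * paraBeta s := by
  have := one_add_mul_I_ne_zero s
  unfold paraBeta
  field_simp
  ring

theorem norm_one_sub_paraBeta_sq (s : ℝ) : ‖1 - paraBeta s‖ ^ 2 = s ^ 2 / (1 + s ^ 2) := by
  rw [one_sub_paraBeta, norm_mul, norm_mul, Complex.norm_I, mul_one, mul_pow, norm_paraBeta_sq,
    Complex.norm_real, Real.norm_eq_abs, sq_abs, div_eq_mul_inv]

theorem norm_one_sub_paraBeta_lt_one (s : ℝ) : ‖1 - paraBeta s‖ < 1 := by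
  refine lt_of_pow_lt_pow_left₀ 2 zero_le_one ?_
  rw [norm_one_sub_paraBeta_sq, one_pow, div_lt_one (by positivity)]
  linarith

/-- The Taylor coefficients of `z ↦ ((1 - w z)⁻¹ + i s)⁻¹`. -/
noncomputable def paraCoeff (w : ℂ) (s : ℝ) : ℕ → ℂ
  | 0 => paraBeta s
  | n + 1 => -(paraBeta s ^ 2 * (1 - paraBeta s) ^ n * w ^ (n + 1))

/-- The constant term and the geometric tail, of ratio `s² / (1 + s²)`, contribute `1 / (1 + s²)`
each. The resulting decay of the norm like `1 / |s|` determines the correlation rate. -/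
theorem hasSum_norm_paraCoeff_sq {w : ℂ} (hw : ‖w‖ = 1) (s : ℝ) :
    HasSum (fun n => ‖paraCoeff w s n‖ ^ 2) (2 * (1 + s ^ 2)⁻¹) := by
  rw [← hasSum_nat_add_iff' 1]
  simp only [Finset.range_one, Finset.sum_singleton, paraCoeff, norm_paraBeta_sq]
  have h := (hasSum_geometric_of_lt_one (by positivity) (by
    rw [div_lt_one (by positivity)]; linarith : s ^ 2 / (1 + s ^ 2) < 1)).mul_left
    ((1 + s ^ 2)⁻¹ ^ 2)
  have e : (1 + s ^ 2)⁻¹ ^ 2 * (1 - s ^ 2 / (1 + s ^ 2))⁻¹ = 2 * (1 + s ^ 2)⁻¹ - (1 + s ^ 2)⁻¹ := by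
    have h0 : (1 + s ^ 2 : ℝ) ≠ 0 := by positivity
    have : 1 - s ^ 2 / (1 + s ^ 2) = (1 + s ^ 2)⁻¹ := by field_simp; ring
    rw [this, inv_inv]
    field_simp
    ring
  rw [e] at h
  refine h.congr_fun fun n => ?_
  rw [norm_neg, norm_mul, norm_mul, norm_pow, norm_pow, norm_pow, hw, one_pow, mul_one,
    norm_paraBeta_sq, mul_pow, ← pow_mul, mul_comm n, pow_mul, norm_one_sub_paraBeta_sq]

/-- With `β = 1 / (1 + i s)` one has `1 - β = i s β`, so the function equals `β (1 - w z) / (1 - (1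
- β) w z)`, and `|1 - β| < 1` allows a geometric expansion on the disc. -/
theorem hasSum_paraCoeff {w : ℂ} (hw : ‖w‖ = 1) (s : ℝ) (z : 𝔻) :
    HasSum (fun n => paraCoeff w s n * (z : ℂ) ^ n) ((1 - w * z)⁻¹ + s * Complex.I)⁻¹ := by
  have hwz : ‖w * (z : ℂ)‖ < 1 := by rw [norm_mul, hw, one_mul]; exact z.norm_lt_one
  have h1 : (1 - w * z : ℂ) ≠ 0 := by
    intro h0
    rw [← sub_eq_zero.1 h0, norm_one] at hwz
    exact lt_irrefl _ hwz
  have hr : ‖(1 - paraBeta s) * (w * z)‖ < 1 := by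
    rw [norm_mul]
    exact mul_lt_one_of_nonneg_of_lt_one_left (norm_nonneg _) (norm_one_sub_paraBeta_lt_one s)
      hwz.le
  have h2 : (1 - (1 - paraBeta s) * (w * z) : ℂ) ≠ 0 := by
    intro h0
    rw [← sub_eq_zero.1 h0, norm_one] at hr
    exact lt_irrefl _ hr
  rw [← hasSum_nat_add_iff' 1]
  simp only [Finset.range_one, Finset.sum_singleton, paraCoeff, pow_zero, mul_one]
  have h := (hasSum_geometric_of_norm_lt_one hr).mul_left (-(paraBeta s ^ 2 * (w * z)))
  have e : ((1 - w * z : ℂ)⁻¹ + s * Complex.I)⁻¹ - paraBeta s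
      = -(paraBeta s ^ 2 * (w * z)) * (1 - (1 - paraBeta s) * (w * z))⁻¹ := by
    have h3 := one_add_mul_I_ne_zero s
    have h4 : ((1 - w * z : ℂ)⁻¹ + s * Complex.I)⁻¹
        = paraBeta s * (1 - w * z) * (1 - (1 - paraBeta s) * (w * z))⁻¹ := by
      rw [inv_eq_iff_eq_inv, mul_inv, mul_inv, inv_inv, one_sub_paraBeta]
      unfold paraBeta
      rw [inv_inv]
      field_simp
      ring
    rw [h4]
    linear_combination paraBeta s * mul_inv_cancel₀ h2
  rw [e]
  refine h.congr_fun fun n => ?_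
  rw [mul_pow, mul_pow]
  ring

/-- The function `z ↦ ((1 - w z)⁻¹ + i s)⁻¹`, as an element of the Hardy space. -/
noncomputable def paraFun {w : ℂ} (hw : ‖w‖ = 1) (s : ℝ) : HardySpace :=
  ofCoeffs ⟨paraCoeff w s, memℓp_gen (by simpa using (hasSum_norm_paraCoeff_sq hw s).summable)⟩

theorem coeff_paraFun {w : ℂ} (hw : ‖w‖ = 1) (s : ℝ) (n : ℕ) :
    coeff (paraFun hw s) n = paraCoeff w s n := by
  rw [paraFun, coeff_ofCoeffs]

theorem paraFun_apply {w : ℂ} (hw : ‖w‖ = 1) (s : ℝ) (z : 𝔻) :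
    paraFun hw s z = ((1 - w * z)⁻¹ + s * Complex.I)⁻¹ :=
  (hasSum_paraCoeff hw s z).tsum_eq

theorem norm_paraFun_sq {w : ℂ} (hw : ‖w‖ = 1) (s : ℝ) :
    ‖paraFun hw s‖ ^ 2 = 2 * (1 + s ^ 2)⁻¹ := by
  have h := lp.hasSum_norm (p := 2) (by norm_num) (coeff (paraFun hw s))
  simp only [ENNReal.toReal_ofNat, Real.rpow_ofNat, coeff_paraFun] at h
  exact h.unique (hasSum_norm_paraCoeff_sq hw s)

theorem comp_paraFun {w : ℂ} (hw : ‖w‖ = 1) {b : ℝ} {φ : 𝔻 → 𝔻}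
    (hφ : ∀ z : 𝔻, (1 - w * φ z)⁻¹ = (1 - w * z)⁻¹ + b * Complex.I)
    {T : HardySpace →L[ℂ] HardySpace} (hT : ∀ (f : HardySpace) (z : 𝔻), T f z = f (φ z)) (s : ℝ) :
    T (paraFun hw s) = paraFun hw (s + b) := by
  refine ext_apply fun z => ?_
  rw [hT, paraFun_apply, paraFun_apply, hφ]
  push_cast
  ring_nf

/-! ### Density -/

theorem hasFPowerSeriesAt_of_coeffs (y : Coeffs) :
    HasFPowerSeriesAt (fun z : ℂ => ∑' n, y n * z ^ n)
      (FormalMultilinearSeries.ofScalars ℂ (fun n => y n)) 0 := by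
  refine hasFPowerSeriesAt_iff.2 ?_
  filter_upwards [Metric.ball_mem_nhds (0 : ℂ) one_pos] with z hz
  have h := (summable_norm_coeffs_mul_pow y (Complex.UnitDisc.mk z (by simpa using hz))).hasSum
  simp only [Complex.UnitDisc.coe_mk] at h
  simpa only [zero_add, FormalMultilinearSeries.coeff_ofScalars, smul_eq_mul, mul_comm] using h

/-- By the identity theorem the power series is `y 0 / (1 - w z)`, so `y n = y 0 * w ^ n` has
constant modulus; square summability forces it to vanish. -/
theorem coeffs_eq_zero_of_frequently {w : ℂ} (hw : ‖w‖ = 1) (y : Coeffs)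
    (h : ∃ᶠ z : ℂ in 𝓝[≠] 0, (∑' n, y n * z ^ n) * (1 - w * z) = y 0) : y = 0 := by
  have hy := hasFPowerSeriesAt_of_coeffs y
  have hlin : AnalyticAt ℂ (fun z : ℂ => 1 - w * z) 0 := by fun_prop
  have han : AnalyticAt ℂ (fun z : ℂ => (∑' n, y n * z ^ n) * (1 - w * z) - y 0) 0 :=
    (hy.analyticAt.mul hlin).sub analyticAt_const
  have hev := han.frequently_zero_iff_eventually_zero.1 (h.mono fun z hz => sub_eq_zero.2 hz)
  have h2 : HasFPowerSeriesAt (fun z : ℂ => ∑' n, y n * z ^ n)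
      (FormalMultilinearSeries.ofScalars ℂ (fun n => y 0 * w ^ n)) 0 := by
    refine hasFPowerSeriesAt_iff.2 ?_
    filter_upwards [Metric.ball_mem_nhds (0 : ℂ) one_pos, hev] with z hz hz2
    have hwz : ‖w * z‖ < 1 := by rw [norm_mul, hw, one_mul]; simpa using hz
    have h1 : (1 - w * z : ℂ) ≠ 0 := by
      intro h0
      rw [← sub_eq_zero.1 h0, norm_one] at hwz
      exact lt_irrefl _ hwz
    have e : ∑' n, y n * z ^ n = y 0 * (1 - w * z)⁻¹ := by
      rw [← sub_eq_zero.1 hz2, mul_assoc, mul_inv_cancel₀ h1, mul_one]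
    simp only [zero_add, e, FormalMultilinearSeries.coeff_ofScalars, smul_eq_mul]
    refine ((hasSum_geometric_of_norm_lt_one hwz).mul_left (y 0)).congr_fun fun n => ?_
    rw [mul_pow]
    ring
  have h3 : ∀ n, y n = y 0 * w ^ n := by
    intro n
    have := congrArg (fun p : FormalMultilinearSeries ℂ ℂ ℂ => p.coeff n)
      (hy.eq_formalMultilinearSeries h2)
    simpa [FormalMultilinearSeries.coeff_ofScalars] using this
  have h4 : Tendsto (fun n => ‖y n‖ ^ 2) atTop (𝓝 0) := by
    have := (lp.hasSum_norm (p := 2) (by norm_num) y).summable.tendsto_atTop_zero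
    simpa using this
  have h5 : ∀ n, ‖y n‖ ^ 2 = ‖y 0‖ ^ 2 := fun n => by
    rw [h3 n, norm_mul, norm_pow, hw, one_pow, mul_one]
  simp only [h5] at h4
  have h6 : y 0 = 0 := by
    have := tendsto_nhds_unique h4 tendsto_const_nhds
    simpa using this.symm
  refine lp.ext (funext fun n => ?_)
  rw [h3, h6, zero_mul]
  rfl

/-- The coefficients of `paraFun` are geometric from degree one on, so the inner product combines
the value of the power series of `y` at `p` with `y 0`. Orthogonality becomes a point condition. -/
theorem hasSum_inner_paraFun {w : ℂ} (hw : ‖w‖ = 1) {s : ℝ} (hs : s ≠ 0) (y : Coeffs) (p : 𝔻)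
    (hp : (p : ℂ) = (starRingEnd ℂ) ((1 - paraBeta s) * w))
    (h : inner ℂ (coeff (paraFun hw s)) y = 0) :
    (∑' n, y n * (p : ℂ) ^ n) * (1 - w * p) = y 0 := by
  set β := (starRingEnd ℂ) (paraBeta s)
  have hβ : β ≠ 0 := (map_ne_zero _).2 (paraBeta_ne_zero s)
  have hr0 : 1 - β ≠ 0 := by
    have h1 : 1 - paraBeta s ≠ 0 := by
      rw [one_sub_paraBeta]
      exact mul_ne_zero (mul_ne_zero (by exact_mod_cast hs) Complex.I_ne_zero) (paraBeta_ne_zero s)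
    intro h2
    refine h1 ((map_eq_zero (starRingEnd ℂ)).1 ?_)
    rw [map_sub, map_one]
    exact h2
  have hp' : (p : ℂ) = (1 - β) * (starRingEnd ℂ) w := by
    rw [hp, map_mul, map_sub, map_one]
  have hww : w * (starRingEnd ℂ) w = 1 := by
    rw [Complex.mul_conj, Complex.normSq_eq_norm_sq, hw]
    simp
  have h1 := ((summable_norm_coeffs_mul_pow y p).hasSum.mul_left (-(β ^ 2 / (1 - β)))).add
    -- Correction in degree `0`: the true coefficient is `β` and the geometric formula gives `-β² /
    -- (1 - β)`; the difference is `β / (1 - β)`.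
    (hasSum_ite_eq (0 : ℕ) (β / (1 - β) * y 0))
  have h2 := lp.hasSum_inner (𝕜 := ℂ) (coeff (paraFun hw s)) y
  have h3 : HasSum (fun n => inner ℂ (coeff (paraFun hw s) n) (y n))
      (-(β ^ 2 / (1 - β)) * (∑' n, y n * (p : ℂ) ^ n) + β / (1 - β) * y 0) := by
    refine h1.congr_fun fun n => ?_
    rw [RCLike.inner_apply, coeff_paraFun]
    cases n with
    | zero =>
      simp only [paraCoeff, if_true, pow_zero, mul_one]
      change y 0 * β = _
      field_simp
      ring
    | succ n =>
      simp only [paraCoeff, Nat.succ_ne_zero, if_false, add_zero, map_neg, map_mul, map_pow,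
        map_sub, map_one]
      rw [hp']
      change y (n + 1) * -(β ^ 2 * (1 - β) ^ n * (starRingEnd ℂ) w ^ (n + 1)) = _
      rw [mul_pow, pow_succ (1 - β)]
      field_simp
  have h4 := h2.unique h3
  rw [h] at h4
  have e : 1 - w * p = β := by
    rw [hp']
    linear_combination (-(1 - β)) * hww
  rw [e]
  field_simp at h4
  refine mul_left_cancel₀ hβ ?_
  linear_combination h4

/-- For a vector orthogonal to the span, the point conditions hold at nonzero points that tend to
`0`, inside the disc, so the identity theorem applies. -/
theorem dense_span_paraFun {w : ℂ} (hw : ‖w‖ = 1) {s : ℕ → ℝ} (hs : ∀ j, s j ≠ 0)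
    (hs0 : Tendsto s atTop (𝓝 0)) :
    Dense (Submodule.span ℂ (Set.range fun j => paraFun hw (s j)) : Set HardySpace) := by
  set D : Submodule ℂ Coeffs := Submodule.span ℂ (Set.range fun j => coeff (paraFun hw (s j)))
  have hD : Dᗮ = ⊥ := by
    rw [Submodule.eq_bot_iff]
    intro y hy
    refine coeffs_eq_zero_of_frequently hw y ?_
    set p : ℕ → ℂ := fun j => (starRingEnd ℂ) ((1 - paraBeta (s j)) * w)
    have hp0 : Tendsto p atTop (𝓝[≠] 0) := by
      refine tendsto_nhdsWithin_iff.2 ⟨?_, Eventually.of_forall fun j => ?_⟩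
      · have hc : Continuous fun r : ℝ => (starRingEnd ℂ) ((1 - paraBeta r) * w) := by
          unfold paraBeta
          refine Complex.continuous_conj.comp (Continuous.mul ?_ continuous_const)
          refine continuous_const.sub (Continuous.inv₀ (by fun_prop) one_add_mul_I_ne_zero)
        have h0 := (hc.tendsto 0).comp hs0
        have e : (starRingEnd ℂ) ((1 - paraBeta 0) * w) = 0 := by simp [paraBeta]
        rw [e] at h0
        exact h0
      · have hw0 : w ≠ 0 := norm_ne_zero_iff.1 (by rw [hw]; exact one_ne_zero)
        refine (map_ne_zero _).2 (mul_ne_zero ?_ hw0)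
        rw [one_sub_paraBeta]
        exact mul_ne_zero (mul_ne_zero (by exact_mod_cast hs j) Complex.I_ne_zero)
          (paraBeta_ne_zero _)
    refine hp0.frequently (Frequently.of_forall fun j => ?_)
    have hpn : ‖p j‖ < 1 := by
      simp only [p]
      rw [RCLike.norm_conj, norm_mul, hw, mul_one]
      exact norm_one_sub_paraBeta_lt_one _
    exact hasSum_inner_paraFun hw (hs j) y (Complex.UnitDisc.mk (p j) hpn) rfl
      ((Submodule.mem_orthogonal D y).1 hy _ (Submodule.subset_span ⟨j, rfl⟩))
  have hdense : Dense (D : Set Coeffs) :=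
    (Submodule.dense_iff_topologicalClosure_eq_top).2
      ((Submodule.topologicalClosure_eq_top_iff).2 hD)
  have hmap : (Submodule.span ℂ (Set.range fun j => paraFun hw (s j))).map
      coeffEquiv.toLinearEquiv.toLinearMap = D := by
    rw [Submodule.map_span, ← Set.range_comp]
    rfl
  have himg : coeffEquiv '' (Submodule.span ℂ (Set.range fun j => paraFun hw (s j)) : Set HardySpace)
      = D := by
    rw [← hmap]
    rfl
  rw [← himg] at hdense
  exact (coeffEquiv.toHomeomorph.isDenseEmbedding.isInducing.dense_iff).2 fun x => by
    exact hdense (coeffEquiv x)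

end HardySpace

/-! ### A convolution estimate -/

/-- The larger of `p` and `q` is at least `n / 2`: its power `-β` gives the decay in `n`, and its
remaining power `β - 1` is handed to the smaller one. For `β < 1` the exponent `β - 2` is summable
over the integers. -/
theorem inv_mul_inv_le_of_le_add {β p q n : ℝ} (hβ0 : 0 ≤ β) (hβ1 : β ≤ 1) (hp : 0 < p)
    (hq : 0 < q) (hn : 0 < n) (hnpq : n ≤ p + q) :
    p⁻¹ * q⁻¹ ≤ 2 ^ β * n ^ (-β) * (p ^ (β - 2) + q ^ (β - 2)) := by
  wlog hpq : q ≤ p generalizing p q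
  · have := this hq hp (by linarith) (le_of_not_ge hpq)
    rw [mul_comm p⁻¹, add_comm (p ^ _)]
    exact this
  have h1 : p ^ (-β) ≤ 2 ^ β * n ^ (-β) := by
    have h2 : p ^ (-β) ≤ (n / 2) ^ (-β) :=
      Real.rpow_le_rpow_of_nonpos (by positivity) (by linarith) (by linarith)
    rw [Real.div_rpow hn.le zero_le_two, Real.rpow_neg zero_le_two, div_inv_eq_mul] at h2
    linarith
  have h3 : p ^ (β - 1) ≤ q ^ (β - 1) :=
    Real.rpow_le_rpow_of_nonpos hq hpq (by linarith)
  have hp1 : p⁻¹ = p ^ (-β) * p ^ (β - 1) := by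
    rw [← Real.rpow_add hp, ← Real.rpow_neg_one]
    ring_nf
  have hq1 : q ^ (β - 1) * q⁻¹ = q ^ (β - 2) := by
    rw [← Real.rpow_neg_one, ← Real.rpow_add hq]
    ring_nf
  calc p⁻¹ * q⁻¹ = p ^ (-β) * (p ^ (β - 1) * q⁻¹) := by rw [hp1, mul_assoc]
    _ ≤ 2 ^ β * n ^ (-β) * (q ^ (β - 1) * q⁻¹) := by gcongr
    _ ≤ 2 ^ β * n ^ (-β) * (p ^ (β - 2) + q ^ (β - 2)) := by
        rw [hq1]
        gcongr
        exact le_add_of_nonneg_left (by positivity)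

theorem summable_one_add_abs_int_rpow {γ : ℝ} (hγ : γ < -1) :
    Summable fun k : ℤ => (1 + |(k : ℝ)|) ^ γ := by
  have h : Summable fun k : ℕ => (1 + |(k : ℝ)|) ^ γ := by
    refine ((summable_nat_add_iff 1).2 (Real.summable_nat_rpow.2 hγ)).congr fun k => ?_
    rw [abs_of_nonneg (Nat.cast_nonneg k)]
    push_cast
    rw [add_comm]
  refine Summable.of_nat_of_neg ?_ ?_ <;> simpa using h

/-- The translation of the first coordinate by one. -/
def intShift (κ : Type*) : Equiv.Perm (ℤ × κ) :=
  Equiv.prodCongr (Equiv.addRight 1) (Equiv.refl κ)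

theorem intShift_pow_apply {κ : Type*} (n : ℕ) (i : ℤ × κ) :
    (intShift κ ^ n) i = (i.1 + n, i.2) := by
  induction n with
  | zero => simp
  | succ n ih =>
    rw [pow_succ', Equiv.Perm.mul_apply, ih]
    simp [intShift, add_assoc]

/-- A summable weighted family whose terms decay like `1 / (1 + |k|)` along the translations
has correlations of order `n ^ (-β)` for every `β < 1`. -/
theorem exists_tsum_intShift_le {κ : Type*} {c : κ → ℝ} (hc0 : ∀ j, 0 ≤ c j) (hc1 : ∀ j, c j ≤ 1)
    (hc : Summable c) {f : ℤ × κ → ℝ} (hf0 : ∀ i, 0 ≤ f i) {C : ℝ}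
    (hf : ∀ i, f i ≤ C * (c i.2 * (1 + |(i.1 : ℝ)|)⁻¹)) {β : ℝ} (hβ0 : 0 ≤ β) (hβ1 : β < 1) :
    (∃ K, ∀ n : ℕ, 0 < n → ∑' i, f ((intShift κ ^ n) i) * f i ≤ K * (n : ℝ) ^ (-β)) ∧
      Summable fun i => f i ^ 2 := by
  set S : ℤ × κ → ℝ := fun i => (1 + |(i.1 : ℝ)|) ^ (β - 2) * c i.2
  have hpos : ∀ k : ℤ, (0 : ℝ) < 1 + |(k : ℝ)| := fun k => by positivity
  have hS : Summable S := (summable_one_add_abs_int_rpow (by linarith)).mul_of_nonneg hc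
    (fun k => by positivity) hc0
  have hfC : ∀ i j : ℤ × κ, f i * f j ≤
      C ^ 2 * (c i.2 * c j.2) * ((1 + |(i.1 : ℝ)|)⁻¹ * (1 + |(j.1 : ℝ)|)⁻¹) := by
    intro i j
    refine (mul_le_mul (hf i) (hf j) (hf0 j) ((hf0 i).trans (hf i))).trans_eq ?_
    ring
  constructor
  · refine ⟨C ^ 2 * 2 ^ β * (2 * ∑' i, S i), fun n hn => ?_⟩
    have hSn : Summable fun i => S ((intShift κ ^ n) i) :=
      (intShift κ ^ n).summable_iff.2 hS
    have hle : ∀ i, f ((intShift κ ^ n) i) * f i ≤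
        C ^ 2 * 2 ^ β * (n : ℝ) ^ (-β) * (S ((intShift κ ^ n) i) + S i) := by
      intro i
      have hn' : (0 : ℝ) < n := by exact_mod_cast hn
      have h1 := inv_mul_inv_le_of_le_add hβ0 hβ1.le (hpos (i.1 + n)) (hpos i.1) hn' (by
        have : |((i.1 + n : ℤ) : ℝ) - (i.1 : ℝ)| = n := by
          push_cast
          rw [add_sub_cancel_left, Nat.abs_cast]
        have h2 := abs_sub ((i.1 + n : ℤ) : ℝ) (i.1 : ℝ)
        linarith)
      -- One of the two weights is dropped to match the majorant `S`, which carries a single one.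
      have h3 : c i.2 * c i.2 ≤ c i.2 := mul_le_of_le_one_right (hc0 _) (hc1 _)
      refine (hfC _ _).trans ?_
      rw [intShift_pow_apply]
      have h4 : 0 ≤ c i.2 := hc0 _
      calc C ^ 2 * (c i.2 * c i.2) * ((1 + |((i.1 + n : ℤ) : ℝ)|)⁻¹ * (1 + |(i.1 : ℝ)|)⁻¹)
          ≤ C ^ 2 * c i.2 * (2 ^ β * (n : ℝ) ^ (-β) *
            ((1 + |((i.1 + n : ℤ) : ℝ)|) ^ (β - 2) + (1 + |(i.1 : ℝ)|) ^ (β - 2))) := by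
            gcongr
        _ = _ := by
            simp only [S]
            ring
    have hsum := (hSn.add hS).mul_left (C ^ 2 * 2 ^ β * (n : ℝ) ^ (-β))
    have hfs : Summable fun i => f ((intShift κ ^ n) i) * f i :=
      Summable.of_nonneg_of_le (fun i => mul_nonneg (hf0 _) (hf0 _)) hle hsum
    refine (hfs.tsum_le_tsum hle hsum).trans_eq ?_
    rw [tsum_mul_left, hSn.tsum_add hS, (intShift κ ^ n).tsum_eq]
    ring
  · refine Summable.of_nonneg_of_le (fun i => sq_nonneg _) (fun i => ?_) (hS.mul_left (C ^ 2))
    rw [sq]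
    refine (hfC i i).trans ?_
    have h3 : c i.2 * c i.2 ≤ c i.2 := mul_le_of_le_one_right (hc0 _) (hc1 _)
    have h4 : 0 ≤ c i.2 := hc0 _
    have h5 : (1 + |(i.1 : ℝ)|)⁻¹ * (1 + |(i.1 : ℝ)|)⁻¹ ≤ (1 + |(i.1 : ℝ)|) ^ (β - 2) := by
      rw [← mul_inv, ← sq, ← Real.rpow_natCast, ← Real.rpow_neg (hpos _).le]
      refine Real.rpow_le_rpow_of_exponent_le ?_ ?_
      · exact le_add_of_nonneg_right (abs_nonneg _)
      · push_cast
        linarith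
    calc _ ≤ C ^ 2 * c i.2 * (1 + |(i.1 : ℝ)|) ^ (β - 2) := by gcongr
      _ = _ := by
        simp only [S]
        ring

/-! ### The real spanning family -/

/-- A real span stable under multiplication by `i` is a complex subspace. The real span is the one
that matters, because the Gaussian coefficients are real. -/
theorem dense_real_span_of_complex {E : Type*} [NormedAddCommGroup E] [NormedSpace ℂ E] {K : Set E}
    {L : Set E} (hL : Dense (Submodule.span ℂ L : Set E)) (h1 : ∀ x ∈ L, x ∈ Submodule.span ℝ K)
    (hI : ∀ x ∈ K, Complex.I • x ∈ Submodule.span ℝ K) :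
    Dense (Submodule.span ℝ K : Set E) := by
  have hI' : ∀ x ∈ Submodule.span ℝ K, Complex.I • x ∈ Submodule.span ℝ K := by
    intro x hx
    induction hx using Submodule.span_induction with
    | mem x hx => exact hI x hx
    | zero => rw [smul_zero]; exact Submodule.zero_mem _
    | add x y _ _ hx hy => rw [smul_add]; exact Submodule.add_mem _ hx hy
    | smul r x _ hx => rw [smul_comm]; exact Submodule.smul_mem _ r hx
  refine hL.mono fun x hx => ?_
  induction hx using Submodule.span_induction with
  | mem x hx => exact h1 x hx
  | zero => exact Submodule.zero_mem _
  | add x y _ _ hx hy => exact Submodule.add_mem _ hx hy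
  | smul r x _ hx =>
    have e : r • x = r.re • x + r.im • (Complex.I • x) := by
      conv_lhs => rw [← Complex.re_add_im r]
      rw [add_smul, mul_smul, Complex.coe_smul, Complex.coe_smul]
    rw [e]
    exact Submodule.add_mem _ (Submodule.smul_mem _ _ hx) (Submodule.smul_mem _ _ (hI' x hx))

namespace HardySpace

/-- The scalars `2⁻ʲ` and `2⁻ʲ i`. -/
noncomputable def dyadicScalar (j : ℕ × Bool) : ℂ :=
  (1 / 2) ^ j.1 * if j.2 then 1 else Complex.I

theorem norm_dyadicScalar (j : ℕ × Bool) : ‖dyadicScalar j‖ = (1 / 2) ^ j.1 := by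
  rw [dyadicScalar, norm_mul, norm_pow]
  split_ifs <;> simp

/-- The orbit family of a parabolic composition operator with translation length `b`. -/
noncomputable def orbitFamily {w : ℂ} (hw : ‖w‖ = 1) (b : ℝ) (i : ℤ × (ℕ × Bool)) : HardySpace :=
  dyadicScalar i.2 • paraFun hw (b * i.1 + 1 / (i.2.1 + 1))

theorem norm_orbitFamily_le {w : ℂ} (hw : ‖w‖ = 1) {b : ℝ} (hb : b ≠ 0) (i : ℤ × (ℕ × Bool)) :
    ‖orbitFamily hw b i‖ ≤ 2 * (1 + 2 / |b|) * ((1 / 2) ^ i.2.1 * (1 + |(i.1 : ℝ)|)⁻¹) := by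
  set s : ℝ := b * i.1 + 1 / (i.2.1 + 1) with hs
  have hb' : 0 < |b| := abs_pos.2 hb
  -- After squaring this is `(1 + |s|)² ≤ 2 (1 + s²)`, that is, `(|s| - 1)² ≥ 0`.
  have h1 : ‖paraFun hw s‖ ≤ 2 * (1 + |s|)⁻¹ := by
    refine (pow_le_pow_iff_left₀ (norm_nonneg _) (by positivity) two_ne_zero).1 ?_
    rw [norm_paraFun_sq, mul_pow, inv_pow, ← div_eq_mul_inv, ← div_eq_mul_inv,
      div_le_div_iff₀ (by positivity) (by positivity), ← sq_abs s]
    nlinarith [sq_nonneg (|s| - 1)]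
  have h2 : |b| * |(i.1 : ℝ)| ≤ |s| + 1 := by
    have h3 : b * i.1 = s - 1 / (i.2.1 + 1) := by rw [hs]; ring
    have h4 : |(1 / ((i.2.1 : ℝ) + 1))| ≤ 1 := by
      rw [abs_of_nonneg (by positivity), div_le_one (by positivity)]
      exact le_add_of_nonneg_left (Nat.cast_nonneg _)
    rw [← abs_mul, h3]
    exact (abs_sub _ _).trans (by linarith)
  have h5 : (1 + |s|)⁻¹ ≤ (1 + 2 / |b|) * (1 + |(i.1 : ℝ)|)⁻¹ := by
    rw [← div_eq_mul_inv, ← one_div, div_le_div_iff₀ (by positivity) (by positivity), one_mul]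
    have h6 : |(i.1 : ℝ)| ≤ (|s| + 1) / |b| := by
      rw [le_div_iff₀ hb', mul_comm]
      exact h2
    have h7 : (1 + 2 / |b|) * (1 + |s|) = 1 + |s| + 2 * ((|s| + 1) / |b|) := by ring
    have h8 : 0 ≤ (|s| + 1) / |b| := by positivity
    rw [h7]
    linarith [abs_nonneg s]
  rw [orbitFamily, norm_smul, norm_dyadicScalar]
  calc (1 / 2 : ℝ) ^ i.2.1 * ‖paraFun hw s‖
      ≤ (1 / 2 : ℝ) ^ i.2.1 * (2 * ((1 + 2 / |b|) * (1 + |(i.1 : ℝ)|)⁻¹)) := by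
        gcongr
        exact h1.trans (by gcongr)
    _ = _ := by ring

/-- The vectors with `k = 0` already suffice: their parameters `1 / (j + 1)` are nonzero and tend to
`0`. The scalars `i` in the family make the real span a complex one. -/
theorem dense_real_span_orbitFamily {w : ℂ} (hw : ‖w‖ = 1) (b : ℝ) :
    Dense (Submodule.span ℝ (Set.range (orbitFamily hw b)) : Set HardySpace) := by
  have hs0 : Tendsto (fun j : ℕ => 1 / ((j : ℝ) + 1)) atTop (𝓝 0) :=
    tendsto_one_div_add_atTop_nhds_zero_nat
  refine dense_real_span_of_complex (dense_span_paraFun hw (fun j => by positivity) hs0) ?_ ?_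
  · rintro _ ⟨j, rfl⟩
    have h := Submodule.smul_mem _ ((2 : ℝ) ^ j) (Submodule.subset_span (R := ℝ)
      (Set.mem_range_self (f := orbitFamily hw b) (0, (j, true))))
    convert h using 1
    rw [orbitFamily, ← Complex.coe_smul, smul_smul, dyadicScalar]
    simp
  · rintro _ ⟨⟨k, j, ε⟩, rfl⟩
    cases ε with
    | true =>
      refine Submodule.subset_span ⟨(k, (j, false)), ?_⟩
      simp only [orbitFamily, smul_smul, dyadicScalar]
      simp [mul_comm]
    | false =>
      have h := Submodule.neg_mem _ (Submodule.subset_span (R := ℝ)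
        (Set.mem_range_self (f := orbitFamily hw b) (k, (j, true))))
      convert h using 1
      simp only [orbitFamily, smul_smul, dyadicScalar, ← neg_smul]
      congr 1
      simp only [if_true, Bool.false_eq_true, if_false]
      linear_combination (1 / 2 : ℂ) ^ j * Complex.I_mul_I

theorem map_orbitFamily {w : ℂ} (hw : ‖w‖ = 1) {b : ℝ} {φ : 𝔻 → 𝔻}
    (hφ : ∀ z : 𝔻, (1 - w * φ z)⁻¹ = (1 - w * z)⁻¹ + b * Complex.I)
    {T : HardySpace →L[ℂ] HardySpace} (hT : ∀ (f : HardySpace) (z : 𝔻), T f z = f (φ z))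
    (i : ℤ × (ℕ × Bool)) :
    T (orbitFamily hw b i) = orbitFamily hw b (intShift _ i) := by
  rw [orbitFamily, map_smul, comp_paraFun hw hφ hT]
  simp only [orbitFamily, intShift, Equiv.prodCongr_apply, Prod.map_fst, Prod.map_snd,
    Equiv.coe_addRight, Equiv.refl_apply, Int.cast_add, Int.cast_one]
  congr 2
  ring

theorem summable_half_pow_prod_bool : Summable fun j : ℕ × Bool => (1 / 2 : ℝ) ^ j.1 := by
  have h : Summable fun j : ℕ × Bool => (1 / 2 : ℝ) ^ j.1 * (fun _ : Bool => (1 : ℝ)) j.2 :=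
    summable_geometric_two.mul_of_nonneg (Summable.of_finite)
      (fun _ => by positivity) (fun _ => zero_le_one)
  simpa using h

end HardySpace

theorem mainTheorem6 (φ : 𝔻 → 𝔻) (hφ : IsParabolicAutomorphism φ) (α : ℝ) (hα : α < 1)
    (ω : ℕ → ℝ) (hω : ∀ k, 1 < ω k) (hω_top : Tendsto ω atTop atTop) :
    ∃ T : HardySpace →L[ℂ] HardySpace, (∀ (f : HardySpace) (z : 𝔻), T f z = f (φ z)) ∧
      ∃ μ : Measure HardySpace, IsProbabilityMeasure μ ∧ MeasurePreserving T μ μ ∧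
        StronglyMixing T μ ∧ μ.IsOpenPosMeasure ∧
        (∀ f ∈ classE HardySpace ω, MemLp f 2 μ) ∧
        ∀ f ∈ classE HardySpace ω, ∀ g ∈ classE HardySpace ω,
          (fun n : ℕ => ProbabilityTheory.covariance (f ∘ T^[n]) g μ) =O[atTop]
            (fun n : ℕ => (n : ℝ) ^ (1 - 2 * α)) := by
  obtain ⟨a, c, hc, hac⟩ := hφ.1.exists_moebius
  obtain ⟨T, hT⟩ := HardySpace.exists_comp_clm hc hac
  obtain ⟨w, b, hw, hb, hwb⟩ := hφ.exists_normal_form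
  refine ⟨T, hT, ?_⟩
  -- At least `2α - 1` for the rate, positive for mixing, and below `1` because `α < 1`.
  set β : ℝ := max (1 / 2) (2 * α - 1)
  have hβ0 : 0 < β := lt_max_of_lt_left (by norm_num)
  have hβ1 : β < 1 := max_lt (by norm_num) (by linarith)
  obtain ⟨⟨K, hK⟩, hsum⟩ := exists_tsum_intShift_le (c := fun j : ℕ × Bool => (1 / 2 : ℝ) ^ j.1)
    (fun j => by positivity) (fun j => pow_le_one₀ (by norm_num) (by norm_num))
    HardySpace.summable_half_pow_prod_bool (f := fun i => ‖HardySpace.orbitFamily hw b i‖) (fun i => norm_nonneg _)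
    (HardySpace.norm_orbitFamily_le hw hb) hβ0.le hβ1
  set r : ℕ → ℝ := fun n =>
    ∑' i, ‖HardySpace.orbitFamily hw b ((intShift _ ^ n) i)‖ * ‖HardySpace.orbitFamily hw b i‖
  have hr0 : ∀ n, 0 ≤ r n := fun n =>
    tsum_nonneg fun i => mul_nonneg (norm_nonneg _) (norm_nonneg _)
  have hr : r =O[atTop] fun n : ℕ => (n : ℝ) ^ (-β) := by
    refine Asymptotics.IsBigO.of_bound K ?_
    filter_upwards [eventually_gt_atTop 0] with n hn
    rw [Real.norm_of_nonneg (hr0 n), Real.norm_of_nonneg (by positivity)]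
    exact hK n hn
  have hβ : (fun n : ℕ => (n : ℝ) ^ (-β)) =O[atTop] fun n : ℕ => (n : ℝ) ^ (1 - 2 * α) := by
    refine Asymptotics.IsBigO.of_bound 1 ?_
    filter_upwards [eventually_gt_atTop 0] with n hn
    rw [Real.norm_of_nonneg (by positivity), Real.norm_of_nonneg (by positivity), one_mul]
    refine Real.rpow_le_rpow_of_exponent_le (by exact_mod_cast hn) ?_
    have := le_max_right (1 / 2) (2 * α - 1)
    linarith
  have hlim : Tendsto r atTop (𝓝 0) :=
    hr.trans_tendsto ((tendsto_rpow_neg_atTop hβ0).comp tendsto_natCast_atTop_atTop)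
  obtain ⟨μ, h1, h2, h3, h4, h5, h6⟩ := exists_mixing_measure hsum
    (HardySpace.dense_real_span_orbitFamily hw b) (T.restrictScalars ℝ) (intShift _)
    (HardySpace.map_orbitFamily hw hwb hT) hlim
  refine ⟨μ, h1, h2, h3, h4, fun f hf => h5 f (isExpLipschitz_of_mem_classE hω hf),
    fun f hf g hg => ?_⟩
  exact ((h6 f g (isExpLipschitz_of_mem_classE hω hf)
    (isExpLipschitz_of_mem_classE hω hg)).trans hr).trans hβ
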